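/- Work over $\mathbb{C}$, and polarize $\mathbb{P}^1\times\mathbb{P}^1$ by $\mathcal{O}(1,1)$. For a coherent sheaf $\mathcal{F}$ on $\mathbb{P}^1\times\mathbb{P}^1$ with support of dimension $1$ write $\chi(\mathcal{F}(m,n)) = rm+sn+t$ for all $m,n\in\mathbb{Z}$ (the Hilbert polynomial of $\mathcal{F}$) and $\operatorname{p}(\mathcal{F}) = t/(r+s)$ (the slope of $\mathcal{F}$). Such an $\mathcal{F}$ is called semi-stable (respectively stable) if it contains no coherent subsheaf with support of dimension $0$ and if $\operatorname{p}(\mathcal{E})\le \operatorname{p}(\mathcal{F})$ (respectively $\operatorname{p}(\mathcal{E})<\operatorname{p}(\mathcal{F})$) for every non-zero proper coherent subsheaf $\mathcal{E}\subset\mathcal{F}$. Let $s,r\ge 0$ be integers, not both zero, and let $C\subset\mathbb{P}^1\times\mathbb{P}^1$ be a curve of bidegree $(s,r)$, that is, the closed subscheme defined by a non-zero polynomial that is homogeneous of degree $s$ in the homogeneous coordinates of the first factor and of degree $r$ in those of the second factor. Then the structure sheaf $\mathcal{O}_C$ is semi-stable. If $r>0$ and $s>0$, then $\mathcal{O}_C$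 is stable. -/

import Mathlib

open CategoryTheory CategoryTheory.Limits AlgebraicGeometry

noncomputable section

namespace BiProj

/-! ### The surface `ℙ¹ × ℙ¹` over the complex numbers -/

/-- The standard grading of `ℂ[x₀, x₁]`. -/
abbrev grading : ℕ → Submodule ℂ (MvPolynomial (Fin 2) ℂ) :=
  MvPolynomial.homogeneousSubmodule (Fin 2) ℂ

instance gradedAlgebra_grading : GradedAlgebra grading := MvPolynomial.gradedAlgebra

/-- The complex projective line. -/
abbrev P1 : Scheme.{0} := Proj grading

/-- The structure morphism `ℙ¹ ⟶ Spec ℂ`. -/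
def P1.toSpec : P1 ⟶ Spec (.of ℂ) :=
  Proj.toSpecZero grading ≫ Spec.map (CommRingCat.ofHom (algebraMap ℂ (grading 0)))

/-- The surface `ℙ¹ × ℙ¹`, fibred product over `Spec ℂ`. -/
abbrev P1P1 : Scheme.{0} := pullback P1.toSpec P1.toSpec

/-- The first projection. -/
def pr₁ : P1P1 ⟶ P1 := pullback.fst P1.toSpec P1.toSpec

/-- The second projection. -/
def pr₂ : P1P1 ⟶ P1 := pullback.snd P1.toSpec P1.toSpec

/-- The structure morphism `ℙ¹ × ℙ¹ ⟶ Spec ℂ`. -/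
def P1P1.toSpec : P1P1 ⟶ Spec (.of ℂ) := pr₁ ≫ P1.toSpec

/-- The ring map `ℂ → Γ(ℙ¹ × ℙ¹, U)`. -/
def scalar (U : P1P1.Opens) : ℂ →+* Γ(P1P1, U) :=
  ((Scheme.ΓSpecIso (.of ℂ)).inv ≫ P1P1.toSpec.appTop ≫
    P1P1.presheaf.map (homOfLE le_top : U ⟶ ⊤).op).hom

/-- Restriction of functions on `ℙ¹ × ℙ¹`. -/
def resO {V W : P1P1.Opens} (h : V ≤ W) : Γ(P1P1, W) →+* Γ(P1P1, V) :=
  (P1P1.presheaf.map (homOfLE h).op).hom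

lemma resO_scalar {V W : P1P1.Opens} (h : V ≤ W) (c : ℂ) :
    resO h (scalar W c) = scalar V c := by
  simp only [resO, scalar, CommRingCat.hom_comp, RingHom.comp_apply]
  rw [← RingHom.comp_apply (P1P1.presheaf.map (homOfLE h).op).hom, ← CommRingCat.hom_comp,
    ← Functor.map_comp]
  rfl

/-! ### Standard charts and coordinates -/

/-- The standard open `{xᵢ ≠ 0}` of `ℙ¹`. -/
abbrev P1.chart (i : Fin 2) : P1.Opens := Proj.basicOpen grading (MvPolynomial.X i)

/-- The function `x_k / x_i` on `{x_i ≠ 0} ⊆ ℙ¹`. -/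
def P1.coord (i k : Fin 2) : Γ(P1, P1.chart i) :=
  (Proj.awayToSection grading (MvPolynomial.X i)).hom
    (HomogeneousLocalization.Away.mk grading (f := MvPolynomial.X i) (d := 1)
      ((MvPolynomial.mem_homogeneousSubmodule 1 _).2 (MvPolynomial.isHomogeneous_X ℂ i))
      1 (MvPolynomial.X k)
      ((MvPolynomial.mem_homogeneousSubmodule _ _).2 (MvPolynomial.isHomogeneous_X ℂ k)))

/-- Indices of the four standard charts of `ℙ¹ × ℙ¹`, ordered lexicographically. -/
abbrev ChartIdx : Type := Fin 2 ×ₗ Fin 2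

/-- First component of a chart index. -/
def ChartIdx.fst (a : ChartIdx) : Fin 2 := (ofLex a).1

/-- Second component of a chart index. -/
def ChartIdx.snd (a : ChartIdx) : Fin 2 := (ofLex a).2

/-- The affine chart `{x_i ≠ 0} × {z_j ≠ 0}` of `ℙ¹ × ℙ¹`, for `a = (i, j)`. -/
def chart (a : ChartIdx) : P1P1.Opens :=
  pr₁ ⁻¹ᵁ P1.chart a.fst ⊓ pr₂ ⁻¹ᵁ P1.chart a.snd

/-- The function `x_k / x_i` on the chart `a = (i, j)`; here `x₀, x₁` are the homogeneous
coordinates of the first factor. -/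
def xCoord (a : ChartIdx) (k : Fin 2) : Γ(P1P1, chart a) :=
  resO (inf_le_left : chart a ≤ pr₁ ⁻¹ᵁ P1.chart a.fst)
    ((pr₁.app (P1.chart a.fst)).hom (P1.coord a.fst k))

/-- The function `z_l / z_j` on the chart `a = (i, j)`; here `z₀, z₁` are the homogeneous
coordinates of the second factor. -/
def zCoord (a : ChartIdx) (l : Fin 2) : Γ(P1P1, chart a) :=
  resO (inf_le_right : chart a ≤ pr₂ ⁻¹ᵁ P1.chart a.snd)
    ((pr₂.app (P1.chart a.snd)).hom (P1.coord a.snd l))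

/-! ### Curves -/

/-- The ring `ℂ[x₀, x₁, z₀, z₁]`; `Sum.inl` indexes the `x`'s and `Sum.inr` the `z`'s. -/
abbrev BiPoly : Type := MvPolynomial (Fin 2 ⊕ Fin 2) ℂ

/-- `f` is bihomogeneous of degree `s` in `x₀, x₁` and of degree `r` in `z₀, z₁`. -/
def IsBihomogeneous (f : BiPoly) (s r : ℕ) : Prop :=
  MvPolynomial.IsWeightedHomogeneous
    (Sum.elim (fun _ => ((1, 0) : ℕ × ℕ)) (fun _ => ((0, 1) : ℕ × ℕ))) f (s, r)

/-- The local equation of `f` on the chart `a = (i, j)`: for `f` bihomogeneous of bidegree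
`(s, r)` this is `f / (x_i ^ s * z_j ^ r)`. -/
def dehomogenize (f : BiPoly) (a : ChartIdx) : Γ(P1P1, chart a) :=
  MvPolynomial.eval₂ (scalar (chart a)) (Sum.elim (xCoord a) (zCoord a)) f

/-- The closed immersion `i : C ⟶ ℙ¹ × ℙ¹` is the curve of bidegree `(s, r)` given by an equation
`f = 0`, where `f ≠ 0` is bihomogeneous of bidegree `(s, r)`: on every standard chart the ideal of
`C` is generated by the local equation of `f`. -/
def IsCurveOfBidegree {C : Scheme.{0}} (i : C ⟶ P1P1) (s r : ℕ) : Prop :=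
  IsClosedImmersion i ∧ ∃ f : BiPoly, f ≠ 0 ∧ IsBihomogeneous f s r ∧
    ∀ a : ChartIdx, RingHom.ker (i.app (chart a)).hom = Ideal.span {dehomogenize f a}

/-- The structure sheaf of `C`, as a sheaf of modules on `ℙ¹ × ℙ¹`. -/
def structureSheaf {C : Scheme.{0}} (i : C ⟶ P1P1) : P1P1.Modules :=
  (Scheme.Modules.pushforward i).obj (SheafOfModules.unit C.ringCatSheaf)

/-! ### Sections as complex vector spaces -/

/-- The sections of a sheaf of modules `F` on `ℙ¹ × ℙ¹` over `U`. -/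
def Sec (F : P1P1.Modules) (U : P1P1.Opens) : Type := Γ(F, U)

instance (F : P1P1.Modules) (U : P1P1.Opens) : AddCommGroup (Sec F U) :=
  inferInstanceAs (AddCommGroup Γ(F, U))

instance (F : P1P1.Modules) (U : P1P1.Opens) : Module Γ(P1P1, U) (Sec F U) :=
  inferInstanceAs (Module Γ(P1P1, U) Γ(F, U))

/-- Sections of a sheaf of modules on `ℙ¹ × ℙ¹` form a complex vector space. -/
instance (F : P1P1.Modules) (U : P1P1.Opens) : Module ℂ (Sec F U) :=
  Module.compHom (Sec F U) (scalar U)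

lemma smul_def (F : P1P1.Modules) (U : P1P1.Opens) (c : ℂ) (x : Sec F U) :
    c • x = scalar U c • x := rfl

/-- Restriction of sections. -/
def resAdd (F : P1P1.Modules) {V W : P1P1.Opens} (h : V ≤ W) : Sec F W →+ Sec F V :=
  (F.presheaf.map (homOfLE h).op).hom

lemma resAdd_smul (F : P1P1.Modules) {V W : P1P1.Opens} (h : V ≤ W) (g : Γ(P1P1, W))
    (x : Sec F W) : resAdd F h (g • x) = resO h g • resAdd F h x :=
  Scheme.Modules.map_smul F (homOfLE h) g x

/-- Restriction of sections, as a `ℂ`-linear map. -/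
def res (F : P1P1.Modules) {V W : P1P1.Opens} (h : V ≤ W) : Sec F W →ₗ[ℂ] Sec F V where
  toFun x := resAdd F h x
  map_add' x y := map_add (resAdd F h) x y
  map_smul' c x := by
    rw [RingHom.id_apply, smul_def, smul_def, resAdd_smul, resO_scalar]

lemma res_res (F : P1P1.Modules) {U V W : P1P1.Opens} (h : U ≤ V) (h' : V ≤ W) (x : Sec F W) :
    res F h (res F h' x) = res F (h.trans h') x := by
  change (F.presheaf.map (homOfLE h').op ≫ F.presheaf.map (homOfLE h).op).hom x = _
  rw [← Functor.map_comp]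
  rfl

/-- Multiplication of sections by a function, as a `ℂ`-linear map. -/
def mulBy (F : P1P1.Modules) {V : P1P1.Opens} (g : Γ(P1P1, V)) : Sec F V →ₗ[ℂ] Sec F V where
  toFun x := g • x
  map_add' x y := smul_add g x y
  map_smul' c x := by
    rw [RingHom.id_apply, smul_def, smul_def, smul_smul, smul_smul, mul_comm]

lemma res_mulBy (F : P1P1.Modules) {V W : P1P1.Opens} (h : V ≤ W) (g : Γ(P1P1, W))
    (x : Sec F W) : res F h (mulBy F g x) = mulBy F (resO h g) (res F h x) :=
  resAdd_smul F h g x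

/-! ### Twists -/

/-- The transition function of `𝒪(m, n)` on the intersection of the charts `a = (i, j)` and
`b = (k, l)`: it is `(x_k / x_i) ^ m * (z_l / z_j) ^ n`, a negative power of `x_k / x_i` being
written as a positive power of `x_i / x_k`. -/
def transition (m n : ℤ) (a b : ChartIdx) : Γ(P1P1, chart a ⊓ chart b) :=
  resO inf_le_left (xCoord a b.fst) ^ m.toNat * resO inf_le_right (xCoord b a.fst) ^ (-m).toNat *
    (resO inf_le_left (zCoord a b.snd) ^ n.toNat *
      resO inf_le_right (zCoord b a.snd) ^ (-n).toNat)

/-- Sections over `V` of the twisted sheaf `F(m, n) = F ⊗ 𝒪(m, n)`, described through the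
standard trivialisations of `𝒪(m, n)`: families of sections `y_a` of `F` over `V ∩ chart a` such
that `y_a = transition m n a b • y_b` on overlaps. -/
def twist (F : P1P1.Modules) (m n : ℤ) (V : P1P1.Opens) :
    Submodule ℂ (∀ a : ChartIdx, Sec F (V ⊓ chart a)) :=
  ⨅ (a : ChartIdx) (b : ChartIdx), LinearMap.eqLocus
    (res F (inf_le_inf_left V inf_le_left : V ⊓ (chart a ⊓ chart b) ≤ V ⊓ chart a) ∘ₗ
      LinearMap.proj a)
    (mulBy F (resO (inf_le_right : V ⊓ (chart a ⊓ chart b) ≤ chart a ⊓ chart b)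
        (transition m n a b)) ∘ₗ
      res F (inf_le_inf_left V inf_le_right : V ⊓ (chart a ⊓ chart b) ≤ V ⊓ chart b) ∘ₗ
      LinearMap.proj b)

lemma mem_twist {F : P1P1.Modules} {m n : ℤ} {V : P1P1.Opens}
    (y : ∀ a : ChartIdx, Sec F (V ⊓ chart a)) :
    y ∈ twist F m n V ↔ ∀ a b : ChartIdx,
      res F (inf_le_inf_left V inf_le_left : V ⊓ (chart a ⊓ chart b) ≤ V ⊓ chart a) (y a) =
        mulBy F (resO inf_le_right (transition m n a b))
          (res F (inf_le_inf_left V inf_le_right : V ⊓ (chart a ⊓ chart b) ≤ V ⊓ chart b)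
            (y b)) := by
  simp only [twist, Submodule.mem_iInf, LinearMap.mem_eqLocus]
  rfl

instance (F : P1P1.Modules) (m n : ℤ) (V : P1P1.Opens) : AddCommGroup (twist F m n V) :=
  Submodule.addCommGroup _

/-- Restriction of sections of `F(m, n)`. -/
def twistRes (F : P1P1.Modules) (m n : ℤ) {V W : P1P1.Opens} (h : V ≤ W) :
    twist F m n W →ₗ[ℂ] twist F m n V :=
  LinearMap.restrict
    (LinearMap.pi fun a => res F (inf_le_inf_right (chart a) h) ∘ₗ LinearMap.proj a) (by
      intro y hy
      rw [mem_twist] at hy ⊢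
      intro a b
      have hab := congrArg (res F (inf_le_inf_right (chart a ⊓ chart b) h)) (hy a b)
      rw [res_mulBy, res_res, res_res] at hab
      simp only [LinearMap.pi_apply, LinearMap.comp_apply, LinearMap.proj_apply, res_res]
      rw [hab]
      congr 2
      change ((P1P1.presheaf.map _) ≫ (P1P1.presheaf.map _)).hom _ = _
      rw [← Functor.map_comp]
      rfl)

/-! ### Cohomology and the Hilbert polynomial -/

/-- Indices of the ordered Čech `p`-cochains: strictly increasing sequences
`a₀ < ⋯ < a_p` of charts. -/
abbrev CechIdx (p : ℕ) : Type := Fin (p + 1) ↪o ChartIdx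

/-- The intersection of the charts of a sequence. -/
def inter {p : ℕ} (σ : CechIdx p) : P1P1.Opens := ⨅ k, chart (σ k)

/-- The sequence with the `k`-th entry left out. -/
def face {p : ℕ} (σ : CechIdx (p + 1)) (k : Fin (p + 2)) : CechIdx p :=
  (Fin.succAboveOrderEmb k).trans σ

lemma inter_le_inter_face {p : ℕ} (σ : CechIdx (p + 1)) (k : Fin (p + 2)) :
    inter σ ≤ inter (face σ k) :=
  le_iInf fun l => iInf_le (fun j => chart (σ j)) (k.succAbove l)

/-- Ordered Čech `p`-cochains of `F(m, n)` for the standard affine cover. -/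
abbrev CechCochain (F : P1P1.Modules) (m n : ℤ) (p : ℕ) : Type :=
  ∀ σ : CechIdx p, twist F m n (inter σ)

/-- The Čech differential, `(d c)_σ = ∑ₖ (-1)ᵏ c_{∂ₖ σ}`. -/
def cechD (F : P1P1.Modules) (m n : ℤ) (p : ℕ) :
    CechCochain F m n p →ₗ[ℂ] CechCochain F m n (p + 1) :=
  LinearMap.pi fun σ => ∑ k : Fin (p + 2), ((-1 : ℂ) ^ (k : ℕ)) •
    (twistRes F m n (inter_le_inter_face σ k) ∘ₗ LinearMap.proj (face σ k))

/-- Čech coboundaries. -/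
def cechB (F : P1P1.Modules) (m n : ℤ) : (p : ℕ) → Submodule ℂ (CechCochain F m n p)
  | 0 => ⊥
  | p + 1 => LinearMap.range (cechD F m n p)

/-- The cohomology space `Hᵖ(F(m, n))` of a quasi-coherent sheaf `F`, computed by the Čech complex
of the standard affine cover of `ℙ¹ × ℙ¹`. -/
abbrev Cohomology (F : P1P1.Modules) (m n : ℤ) (p : ℕ) : Type :=
  LinearMap.ker (cechD F m n p) ⧸
    (cechB F m n p).comap (LinearMap.ker (cechD F m n p)).subtype

/-- The Euler characteristic `χ(F(m, n))`. There are no ordered cochains in degrees `p ≥ 4`. -/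
def eulerChar (F : P1P1.Modules) (m n : ℤ) : ℤ :=
  ∑ p ∈ Finset.range 4, (-1) ^ p * (Module.finrank ℂ (Cohomology F m n p) : ℤ)

/-- `F` has Hilbert polynomial `P_F(m, n) = r m + s n + t`: all cohomology of all twists is finite
dimensional, and `χ(F(m, n)) = r m + s n + t` for all integers `m, n`. -/
def HasHilbertPolynomial (F : P1P1.Modules) (r s t : ℤ) : Prop :=
  ∀ m n : ℤ, (∀ p, FiniteDimensional ℂ (Cohomology F m n p)) ∧
    eulerChar F m n = r * m + s * n + t

/-- `F` has a linear Hilbert polynomial `r m + s n + t` with `r + s ≠ 0`, and its slope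
`t / (r + s)` is `q`. -/
def HasSlope (F : P1P1.Modules) (q : ℚ) : Prop :=
  ∃ r s t : ℤ, HasHilbertPolynomial F r s t ∧ r + s ≠ 0 ∧ q = (t : ℚ) / ((r : ℚ) + (s : ℚ))

/-! ### Stability -/

/-- Coherent sheaves on the Noetherian scheme `ℙ¹ × ℙ¹`: quasi-coherent and of finite type. -/
def IsCoherent (F : P1P1.Modules) : Prop :=
  SheafOfModules.IsQuasicoherent.{0} F ∧ SheafOfModules.IsFiniteType.{0} F

/-- The support of a sheaf. -/
def support (F : P1P1.Modules) : Set P1P1 :=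
  {x | Nontrivial (F.presheaf.stalk x)}

/-- The dimension of the support of a sheaf (`⊥` if the support is empty). -/
def dimSupport (F : P1P1.Modules) : WithBot ℕ∞ := topologicalKrullDim (support F)

/-- `F` is a coherent sheaf with support of dimension one that does not contain coherent subsheaves
with support of dimension zero. -/
def IsPureOneDimensional (F : P1P1.Modules) : Prop :=
  IsCoherent F ∧ dimSupport F = 1 ∧
    ∀ (E : P1P1.Modules) (φ : E ⟶ F), Mono φ → IsCoherent E → dimSupport E ≠ 0

/-- Semi-stability with respect to `𝒪(1, 1)`: `F` is coherent of dimension one, has no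
zero-dimensional subsheaves, and `p(E) ≤ p(F)` for all proper non-zero coherent subsheaves `E`
(the slopes being defined). -/
def IsSemistable (F : P1P1.Modules) : Prop :=
  IsPureOneDimensional F ∧ ∃ q : ℚ, HasSlope F q ∧
    ∀ (E : P1P1.Modules) (φ : E ⟶ F), Mono φ → IsCoherent E → ¬ IsZero E → ¬ IsIso φ →
      ∃ q' : ℚ, HasSlope E q' ∧ q' ≤ q

/-- Stability with respect to `𝒪(1, 1)`: as semi-stability, with `p(E) < p(F)`. -/
def IsStable (F : P1P1.Modules) : Prop :=
  IsPureOneDimensional F ∧ ∃ q : ℚ, HasSlope F q ∧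
    ∀ (E : P1P1.Modules) (φ : E ⟶ F), Mono φ → IsCoherent E → ¬ IsZero E → ¬ IsIso φ →
      ∃ q' : ℚ, HasSlope E q' ∧ q' < q

end BiProj

end

/-!
# Semi-stability of the structure sheaf of a curve on `ℙ¹ × ℙ¹`

A function on an intersection of standard charts of `ℙ¹ × ℙ¹` is a Laurent polynomial in two
variables whose exponents lie in a cone (`lau`, `cone`). A quasi-coherent subsheaf `E` of the
structure sheaf of a curve with equation `f` is therefore described by a system of ideals `J ⊇ (f)`
in rings of Laurent polynomials (`IdealSystem`, `sheafIdeal`), and the Čech cohomology of `E(m, n)`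
is that of `J(m, n)` modulo `(f)(m, n)` (`cohomology_equiv`). From there on the argument is one
about Laurent polynomials.

The Euler characteristic of `𝒪(m, n)` is `(m + 1) (n + 1)`, because the contribution of each
monomial to the Čech complex can be computed by adding and removing a chart (`chi_lineSys`). Since
polynomial rings over `ℂ` in two variables are factorial of dimension two, `J = h J'` for a greatest
common divisor `h` of some bidegree `(s', r')` and an ideal `J'` of finite colength
(`IdealSystem.exists_divides_finite`). If `ℓ` is the length of the quotient by `J'`, then

`χ(E(m, n)) = (m - s' + 1) (n - r' + 1) - ℓ - (m - s + 1) (n - r + 1) = R m + S n + t`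

with `R = r - r'`, `S = s - s'` and `t = R (1 - s') + S (1 - r') - R S - ℓ`. For `E = 𝒪_C` this
gives the slope `(r + s - r s) / (r + s)`, and the inequality of the slopes is

`(r + s - r s) (R + S) - t (r + s) = R S (r' + s') + R s'² + S r'² + ℓ (r + s) ≥ 0`.

Here `ℓ` is at least the colength of `J'` on each chart (`IdealSystem.colength_le_length`), so that
it is not negative. If `r` and `s` are positive, equality implies that `s' = r' = 0` and `ℓ = 0`, so
that `J` is the unit ideal and `E = 𝒪_C` (`IdealSystem.exists_hilbert`).

That the structure sheaf is pure of dimension one follows from Krull's theory of dimension and the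
Nullstellensatz: the support of a non-zero subsheaf contains the zero locus of a prime divisor of
`f` in some chart, which has a generic point and a closed point (`one_le_dimSupport`).
-/

noncomputable section

namespace BiProj

/-! ### Laurent polynomials -/

/-- Laurent polynomials in two variables: functions on the intersection of the four charts. -/
abbrev Laurent : Type := AddMonoidAlgebra ℂ (ℤ × ℤ)

/-- The Laurent monomial with exponent `u`. -/
abbrev mon (u : ℤ × ℤ) : Laurent := AddMonoidAlgebra.single u 1

lemma mon_add (u v : ℤ × ℤ) : mon (u + v) = mon u * mon v := by
  rw [AddMonoidAlgebra.single_mul_single, one_mul]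

lemma mon_zero : mon 0 = 1 := rfl

lemma mon_neg_mul_mon (u : ℤ × ℤ) : mon (-u) * mon u = 1 := by
  rw [← mon_add, neg_add_cancel, mon_zero]

lemma mon_mul_mon_neg (u : ℤ × ℤ) : mon u * mon (-u) = 1 := by
  rw [← mon_add, add_neg_cancel, mon_zero]

lemma mon_ne_zero (u : ℤ × ℤ) : mon u ≠ 0 := by
  intro h
  have := mon_neg_mul_mon u
  rw [h, mul_zero] at this
  exact zero_ne_one this

lemma coeff_mon_mul (u : ℤ × ℤ) (g : Laurent) (e : ℤ × ℤ) :
    (mon u * g).coeff e = g.coeff (e - u) := by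
  rw [AddMonoidAlgebra.coeff_single_mul_apply, one_mul, neg_add_eq_sub]

/-- Laurent polynomials with exponents in `S`. -/
def supp (S : Set (ℤ × ℤ)) : Submodule ℂ Laurent where
  carrier := {g | ∀ e ∉ S, g.coeff e = 0}
  add_mem' hg hh e he := by
    rw [AddMonoidAlgebra.coeff_add, Finsupp.add_apply, hg e he, hh e he, add_zero]
  zero_mem' _ _ := rfl
  smul_mem' c g hg e he := by
    rw [AddMonoidAlgebra.coeff_smul_apply, hg e he, smul_zero]

lemma mem_supp {S : Set (ℤ × ℤ)} {g : Laurent} : g ∈ supp S ↔ ∀ e ∉ S, g.coeff e = 0 := Iff.rfl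

lemma mem_supp_iff_support {S : Set (ℤ × ℤ)} {g : Laurent} :
    g ∈ supp S ↔ ∀ e, g.coeff e ≠ 0 → e ∈ S := by
  rw [mem_supp]
  exact forall_congr' fun e => by tauto

lemma supp_mono {S S' : Set (ℤ × ℤ)} (h : S ⊆ S') : supp S ≤ supp S' :=
  fun _ hg e he => hg e fun h' => he (h h')

lemma mon_mem_supp {S : Set (ℤ × ℤ)} {u : ℤ × ℤ} (h : u ∈ S) : mon u ∈ supp S := by
  intro e he
  rw [AddMonoidAlgebra.coeff_single, Finsupp.single_apply, if_neg]
  rintro rfl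
  exact he h

lemma mon_mul_mem_supp {S : Set (ℤ × ℤ)} {u : ℤ × ℤ} {g : Laurent} :
    mon u * g ∈ supp S ↔ g ∈ supp {e | e + u ∈ S} := by
  rw [mem_supp, mem_supp]
  constructor
  · intro h e he
    have := h (e + u) he
    rwa [coeff_mon_mul, add_sub_cancel_right] at this
  · intro h e he
    rw [coeff_mon_mul]
    exact h _ (by simpa using he)

lemma mul_mem_supp {S S' S'' : Set (ℤ × ℤ)} (hS : ∀ e ∈ S, ∀ e' ∈ S', e + e' ∈ S'')
    {g h : Laurent} (hg : g ∈ supp S) (hh : h ∈ supp S') : g * h ∈ supp S'' := by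
  classical
  rw [mem_supp_iff_support] at *
  intro e he
  have := AddMonoidAlgebra.support_coeff_mul_subset g h (Finsupp.mem_support_iff.2 he)
  obtain ⟨a, ha, b, hb, rfl⟩ := Finset.mem_add.1 this
  exact hS _ (hg _ (Finsupp.mem_support_iff.1 ha)) _ (hh _ (Finsupp.mem_support_iff.1 hb))

/-- The part of a Laurent polynomial with exponents in `S`. -/
def part (S : Set (ℤ × ℤ)) (g : Laurent) : Laurent :=
  open Classical in .ofCoeff (g.coeff.filter (· ∈ S))

lemma coeff_part (S : Set (ℤ × ℤ)) (g : Laurent) (e : ℤ × ℤ) [Decidable (e ∈ S)] :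
    (part S g).coeff e = if e ∈ S then g.coeff e else 0 := by
  rw [part, AddMonoidAlgebra.coeff_ofCoeff, Finsupp.filter_apply]
  congr

lemma part_mem_supp (S : Set (ℤ × ℤ)) (g : Laurent) : part S g ∈ supp S := by
  classical
  intro e he
  rw [coeff_part, if_neg he]

lemma part_add_part_compl (S : Set (ℤ × ℤ)) (g : Laurent) : part S g + part Sᶜ g = g := by
  classical
  ext e
  rw [AddMonoidAlgebra.coeff_add, Finsupp.add_apply, coeff_part, coeff_part]
  by_cases h : e ∈ S <;> simp [h]

/-- If `p q` has no exponents below `c + d` in the direction `l`, if `p` has none below `c` and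
some at `c`, then `q` has no exponents below `d`. -/
lemma mem_supp_of_mul_mem_supp {l : ℤ × ℤ →+ ℤ} {c d : ℤ} {p q : Laurent}
    (hp : p ∈ supp {e | c ≤ l e}) (hp0 : ∃ e, p.coeff e ≠ 0 ∧ l e = c)
    (hpq : p * q ∈ supp {e | c + d ≤ l e}) : q ∈ supp {e | d ≤ l e} := by
  classical
  by_contra hq
  obtain ⟨e₀, he₀, hle⟩ : ∃ e, q.coeff e ≠ 0 ∧ l e < d := by
    rw [mem_supp_iff_support] at hq
    push Not at hq
    simpa using hq
  obtain ⟨e₁, he₁, hmin⟩ := Finset.exists_min_image q.coeff.support l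
    ⟨e₀, Finsupp.mem_support_iff.2 he₀⟩
  have he₁d : l e₁ < d := (hmin e₀ (Finsupp.mem_support_iff.2 he₀)).trans_lt hle
  -- The product of the parts of lowest degree of `p` and `q` is the part of degree `c + l e₁` of
  -- `p q`, which vanishes because `l e₁ < d`.
  set S : Set (ℤ × ℤ) := {e | l e = c}
  set S' : Set (ℤ × ℤ) := {e | l e = l e₁}
  have hp1 : part Sᶜ p ∈ supp {e | c + 1 ≤ l e} := by
    intro e he
    rw [coeff_part]
    split_ifs with h
    · refine hp e fun h' => ?_
      simp [S] at he h h'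
      omega
    · rfl
  have hq1 : part S'ᶜ q ∈ supp {e | l e₁ + 1 ≤ l e} := by
    intro e he
    rw [coeff_part]
    split_ifs with h
    · by_contra h2
      have := hmin e (Finsupp.mem_support_iff.2 h2)
      simp [S'] at he h
      omega
    · rfl
  have hSS : part S p * part S' q ∈ supp {e | l e = c + l e₁} :=
    mul_mem_supp (fun e he e' he' => by simp [S, S'] at *; omega) (part_mem_supp S p)
      (part_mem_supp S' q)
  have hrest : part S p * part S' q ∈ supp {e | c + l e₁ + 1 ≤ l e} := by
    have h : part S p * part S' q = p * q - p * part S'ᶜ q - part Sᶜ p * part S' q := by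
      conv_rhs => rw [← part_add_part_compl S p, ← part_add_part_compl S' q]
      have h2 : part S'ᶜ (part S' q + part S'ᶜ q) = part S'ᶜ q := by
        rw [part_add_part_compl]
      have h3 : part Sᶜ (part S p + part Sᶜ p) = part Sᶜ p := by
        rw [part_add_part_compl]
      have h4 : part S' (part S' q + part S'ᶜ q) = part S' q := by
        rw [part_add_part_compl]
      rw [h2, h3, h4]
      ring
    rw [h]
    refine sub_mem (sub_mem (supp_mono ?_ hpq) ?_) ?_
    · intro e he
      simp at *
      omega
    · exact mul_mem_supp (fun e he e' he' => by simp at *; omega) hp hq1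
    · exact mul_mem_supp (fun e he e' he' => by simp [S'] at *; omega) hp1 (part_mem_supp S' q)
  have hzero : part S p * part S' q = 0 := by
    ext e
    by_cases h : l e = c + l e₁
    · exact hrest e (by simp; omega)
    · exact hSS e h
  rcases mul_eq_zero.1 hzero with h | h
  · obtain ⟨e, he, hec⟩ := hp0
    apply he
    have := congrArg (fun g => AddMonoidAlgebra.coeff g e) h
    simpa [coeff_part, S, hec] using this
  · apply Finsupp.mem_support_iff.1 he₁
    have := congrArg (fun g => AddMonoidAlgebra.coeff g e₁) h
    simpa [coeff_part, S'] using this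

/-! ### Monomials on intersections of charts -/

/-- Exponents of the monomials that are regular on the intersection of the charts of `T`. -/
def cone (T : Finset ChartIdx) : Set (ℤ × ℤ) :=
  {e | ((∀ a ∈ T, a.fst = 0) → 0 ≤ e.1) ∧ ((∀ a ∈ T, a.fst = 1) → e.1 ≤ 0) ∧
    ((∀ a ∈ T, a.snd = 0) → 0 ≤ e.2) ∧ ((∀ a ∈ T, a.snd = 1) → e.2 ≤ 0)}

lemma mem_cone_singleton {a : ChartIdx} {e : ℤ × ℤ} : e ∈ cone {a} ↔
    (a.fst = 0 → 0 ≤ e.1) ∧ (a.fst = 1 → e.1 ≤ 0) ∧ (a.snd = 0 → 0 ≤ e.2) ∧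
      (a.snd = 1 → e.2 ≤ 0) := by
  change (_ ∧ _ ∧ _ ∧ _) ↔ _
  simp only [Finset.mem_singleton, forall_eq]

lemma cone_mono {T T' : Finset ChartIdx} (h : T ⊆ T') : cone T ⊆ cone T' :=
  fun _ he => ⟨fun h' => he.1 fun a ha => h' a (h ha), fun h' => he.2.1 fun a ha => h' a (h ha),
    fun h' => he.2.2.1 fun a ha => h' a (h ha), fun h' => he.2.2.2 fun a ha => h' a (h ha)⟩

lemma add_mem_cone {T : Finset ChartIdx} {e e' : ℤ × ℤ} (h : e ∈ cone T) (h' : e' ∈ cone T) :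
    e + e' ∈ cone T :=
  ⟨fun x => add_nonneg (h.1 x) (h'.1 x), fun x => add_nonpos (h.2.1 x) (h'.2.1 x),
    fun x => add_nonneg (h.2.2.1 x) (h'.2.2.1 x), fun x => add_nonpos (h.2.2.2 x) (h'.2.2.2 x)⟩

lemma zero_mem_cone (T : Finset ChartIdx) : 0 ∈ cone T :=
  ⟨fun _ => le_rfl, fun _ => le_rfl, fun _ => le_rfl, fun _ => le_rfl⟩

lemma nsmul_mem_cone {T : Finset ChartIdx} {e : ℤ × ℤ} (h : e ∈ cone T) (n : ℕ) :
    n • e ∈ cone T := by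
  induction n with
  | zero => rw [zero_nsmul]; exact zero_mem_cone T
  | succ n ih => rw [succ_nsmul]; exact add_mem_cone ih h

/-- The Laurent polynomials that are regular on the intersection of the charts of `T`. -/
abbrev regular (T : Finset ChartIdx) : Submodule ℂ Laurent := supp (cone T)

lemma mul_mem_regular {T : Finset ChartIdx} {g h : Laurent} (hg : g ∈ regular T)
    (hh : h ∈ regular T) : g * h ∈ regular T :=
  mul_mem_supp (fun _ he _ he' => add_mem_cone he he') hg hh

lemma one_mem_regular (T : Finset ChartIdx) : (1 : Laurent) ∈ regular T :=
  mon_mem_supp (zero_mem_cone T)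

/-- The exponent of the transition function of `𝒪(m, n)` from the chart `(0, 0)` to the
chart `a`. -/
def tau (m n : ℤ) (a : ChartIdx) : ℤ × ℤ := (-(m * (a.fst : ℕ)), -(n * (a.snd : ℕ)))

lemma tau_add (m n m' n' : ℤ) (a : ChartIdx) :
    tau (m + m') (n + n') a = tau m n a + tau m' n' a := by
  ext <;> simp [tau] <;> ring

lemma tau_sub_mem_cone (m n : ℤ) {a b : ChartIdx} {T : Finset ChartIdx} (ha : a ∈ T) (hb : b ∈ T) :
    tau m n a - tau m n b ∈ cone T := by
  refine ⟨fun h => ?_, fun h => ?_, fun h => ?_, fun h => ?_⟩ <;>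
  simp [tau, h a ha, h b hb]

/-- A function on the intersection of the charts of `T` becomes regular on the chart `a` when it is
multiplied by a suitable monomial that is regular on the chart `a` and invertible on the
intersection. -/
lemma exists_mem_cone_neg_mem_cone {a : ChartIdx} {T : Finset ChartIdx} (ha : a ∈ T)
    {g : Laurent} (hg : g ∈ regular T) :
    ∃ u ∈ cone {a}, -u ∈ cone T ∧ mon u * g ∈ regular {a} := by
  classical
  obtain ⟨N, hN⟩ : ∃ N : ℤ, 0 ≤ N ∧ ∀ e ∈ g.coeff.support, |e.1| ≤ N ∧ |e.2| ≤ N := by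
    refine ⟨∑ e ∈ g.coeff.support, (|e.1| + |e.2|), by positivity, fun e he => ?_⟩
    have := Finset.single_le_sum (f := fun e : ℤ × ℤ => |e.1| + |e.2|)
      (fun e _ => by positivity) he
    have h1 := abs_nonneg e.1
    have h2 := abs_nonneg e.2
    constructor <;> omega
  have hf : a.fst = 0 ∨ a.fst = 1 := by
    generalize a.fst = i; fin_cases i <;> simp
  have hs : a.snd = 0 ∨ a.snd = 1 := by
    generalize a.snd = i; fin_cases i <;> simp
  refine ⟨(if ∀ b ∈ T, b.fst = a.fst then 0 else N * (1 - 2 * (a.fst : ℕ)),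
    if ∀ b ∈ T, b.snd = a.snd then 0 else N * (1 - 2 * (a.snd : ℕ))), ?_, ?_, ?_⟩
  · rw [mem_cone_singleton]
    refine ⟨fun h => ?_, fun h => ?_, fun h => ?_, fun h => ?_⟩ <;> split_ifs <;> simp [h, hN.1]
  · refine ⟨fun h => ?_, fun h => ?_, fun h => ?_, fun h => ?_⟩ <;>
    dsimp only [Prod.fst_neg, Prod.snd_neg] <;> rw [if_pos (fun b hb => by rw [h b hb, h a ha])] <;>
    simp
  · rw [mon_mul_mem_supp]
    rw [mem_supp_iff_support] at hg ⊢
    intro e he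
    obtain ⟨h1, h2, h3, h4⟩ := hg e he
    obtain ⟨hx, hz⟩ := hN.2 e (Finsupp.mem_support_iff.2 he)
    rw [abs_le] at hx hz
    change _ ∈ cone {a}
    rw [mem_cone_singleton]
    simp only [Prod.fst_add, Prod.snd_add]
    refine ⟨fun h => ?_, fun h => ?_, fun h => ?_, fun h => ?_⟩ <;> split_ifs with h' <;>
    simp only [h, add_zero] at h' ⊢ <;> first | (simp; omega) | tauto

/-- A quasi-coherent sheaf of ideals on `ℙ¹ × ℙ¹`, given by its sections over the intersections
of the standard charts, as ideals of rings of Laurent polynomials. -/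
structure IdealSystem where
  /-- The ideal of the intersection of the charts of `T`; only non-empty `T` matter. -/
  J : Finset ChartIdx → Submodule ℂ Laurent
  le_regular : ∀ {T}, T.Nonempty → J T ≤ regular T
  mul_mem : ∀ {T g h}, T.Nonempty → g ∈ regular T → h ∈ J T → g * h ∈ J T
  mono : ∀ {T T'}, T.Nonempty → T ⊆ T' → J T ≤ J T'
  /-- Quasi-coherence: an element over an intersection of charts is the quotient of an element over
  any of these charts by a monomial that is invertible on the intersection. -/
  loc : ∀ {T a g}, a ∈ T → g ∈ J T → ∃ u ∈ cone {a}, -u ∈ cone T ∧ mon u * g ∈ J {a}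

/-! ### Subquotients and Euler characteristics of complexes -/

section Subquotient

variable {K : Type*} [Field K] {X Y W : Type*} [AddCommGroup X] [Module K X]
  [AddCommGroup Y] [Module K Y] [AddCommGroup W] [Module K W]

/-- The subquotient `A / (A ∩ B)` of a vector space. -/
abbrev Subquot (A B : Submodule K X) : Type _ := A ⧸ B.submoduleOf A

/-- The map of subquotients induced by a linear map. -/
def subquotMap (φ : X →ₗ[K] Y) {A B : Submodule K X} {A' B' : Submodule K Y}
    (hA : ∀ x ∈ A, φ x ∈ A') (hB : ∀ x ∈ A, x ∈ B → φ x ∈ B') : Subquot A B →ₗ[K] Subquot A' B' :=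
  Submodule.mapQ _ _ (φ.restrict hA) fun x hx => hB x x.2 hx

lemma subquotMap_mk (φ : X →ₗ[K] Y) {A B : Submodule K X} {A' B' : Submodule K Y}
    (hA : ∀ x ∈ A, φ x ∈ A') (hB : ∀ x ∈ A, x ∈ B → φ x ∈ B') (x : A) :
    subquotMap φ hA hB (Submodule.Quotient.mk x) = Submodule.Quotient.mk ⟨φ x, hA x x.2⟩ := rfl

lemma subquot_mk_eq_zero {A B : Submodule K X} (x : A) :
    (Submodule.Quotient.mk x : Subquot A B) = 0 ↔ (x : X) ∈ B := by
  rw [Submodule.Quotient.mk_eq_zero]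
  rfl

lemma subsingleton_subquot {A B : Submodule K X} (h : A ≤ B) : Subsingleton (Subquot A B) :=
  Submodule.Quotient.subsingleton_iff.2 (eq_top_iff.2 fun x _ => h x.2)

lemma subquotMap_injective (φ : X →ₗ[K] Y) {A B : Submodule K X} {A' B' : Submodule K Y}
    (hA : ∀ x ∈ A, φ x ∈ A') (hB : ∀ x ∈ A, x ∈ B → φ x ∈ B')
    (h : ∀ x ∈ A, φ x ∈ B' → x ∈ B) : Function.Injective (subquotMap φ hA hB) := by
  rw [injective_iff_map_eq_zero]
  intro x hx
  obtain ⟨x, rfl⟩ := Submodule.Quotient.mk_surjective _ x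
  rw [subquotMap_mk, subquot_mk_eq_zero] at hx
  exact (subquot_mk_eq_zero x).2 (h x x.2 hx)

lemma subquotMap_surjective (φ : X →ₗ[K] Y) {A B : Submodule K X} {A' B' : Submodule K Y}
    (hA : ∀ x ∈ A, φ x ∈ A') (hB : ∀ x ∈ A, x ∈ B → φ x ∈ B')
    (h : ∀ y ∈ A', ∃ x ∈ A, y - φ x ∈ B') : Function.Surjective (subquotMap φ hA hB) := by
  intro y
  obtain ⟨y, rfl⟩ := Submodule.Quotient.mk_surjective _ y
  obtain ⟨x, hx, hxy⟩ := h y y.2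
  refine ⟨Submodule.Quotient.mk ⟨x, hx⟩, ?_⟩
  rw [subquotMap_mk, eq_comm, ← sub_eq_zero, ← Submodule.Quotient.mk_sub, subquot_mk_eq_zero]
  exact hxy

lemma subquotMap_exact (φ : X →ₗ[K] Y) (ψ : Y →ₗ[K] W) {A B : Submodule K X}
    {A' B' : Submodule K Y} {A'' B'' : Submodule K W}
    (hA : ∀ x ∈ A, φ x ∈ A') (hB : ∀ x ∈ A, x ∈ B → φ x ∈ B')
    (hA' : ∀ x ∈ A', ψ x ∈ A'') (hB' : ∀ x ∈ A', x ∈ B' → ψ x ∈ B'')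
    (h : ∀ x ∈ A, ψ (φ x) ∈ B'') (h' : ∀ y ∈ A', ψ y ∈ B'' → ∃ x ∈ A, y - φ x ∈ B') :
    Function.Exact (subquotMap φ hA hB) (subquotMap ψ hA' hB') := by
  intro y
  obtain ⟨y, rfl⟩ := Submodule.Quotient.mk_surjective _ y
  rw [subquotMap_mk, subquot_mk_eq_zero]
  constructor
  · intro hy
    obtain ⟨x, hx, hxy⟩ := h' y y.2 hy
    refine ⟨Submodule.Quotient.mk ⟨x, hx⟩, ?_⟩
    rw [subquotMap_mk, eq_comm, ← sub_eq_zero, ← Submodule.Quotient.mk_sub, subquot_mk_eq_zero]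
    exact hxy
  · rintro ⟨x, hx⟩
    obtain ⟨x, rfl⟩ := Submodule.Quotient.mk_surjective _ x
    rw [subquotMap_mk, ← sub_eq_zero, ← Submodule.Quotient.mk_sub, subquot_mk_eq_zero] at hx
    have := hB' _ (sub_mem (hA x x.2) y.2) hx
    rw [map_sub] at this
    simpa using sub_mem (h x x.2) this

/-- The first isomorphism theorem for subquotients. -/
def subquotEquivPi {ι : Type*} {Z : ι → Type*} [∀ i, AddCommGroup (Z i)] [∀ i, Module K (Z i)]
    {A B : Submodule K X} (φ : A →ₗ[K] ∀ i, Z i)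
    (hφ : ∀ x, φ x = 0 ↔ (x : X) ∈ B) (hs : Function.Surjective φ) :
    Subquot A B ≃ₗ[K] ∀ i, Z i :=
  LinearEquiv.ofBijective ((B.submoduleOf A).liftQ φ fun c hc => LinearMap.mem_ker.2 ((hφ c).2 hc))
    (by
      constructor
      · rw [injective_iff_map_eq_zero]
        intro x hx
        obtain ⟨x, rfl⟩ := Submodule.Quotient.mk_surjective _ x
        exact (subquot_mk_eq_zero _).2 ((hφ x).1 hx)
      · intro y
        obtain ⟨x, hx⟩ := hs y
        exact ⟨Submodule.Quotient.mk x, hx⟩)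

lemma finite_of_exact {f : X →ₗ[K] Y} {g : Y →ₗ[K] W} (h : Function.Exact f g)
    (hX : Module.Finite K X) (hW : Module.Finite K W) : Module.Finite K Y := by
  have : Module.Finite K (LinearMap.ker g) := by
    rw [LinearMap.exact_iff.1 h]; infer_instance
  have : Module.Finite K (Y ⧸ LinearMap.ker g) := .equiv g.quotKerEquivRange.symm
  exact .of_submodule_quotient (LinearMap.ker g)

lemma finrank_eq_add_of_exact {f : X →ₗ[K] Y} {g : Y →ₗ[K] W} (h : Function.Exact f g)
    [Module.Finite K Y] : Module.finrank K Y =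
      Module.finrank K (LinearMap.range f) + Module.finrank K (LinearMap.range g) := by
  rw [← LinearMap.exact_iff.1 h, add_comm, LinearMap.finrank_range_add_finrank_ker]

/-- The alternating sum of the dimensions in a long exact sequence
`0 → A₀ → B₀ → C₀ → A₁ → ⋯ → C₃ → 0`. -/
lemma alternating_sum_finrank_eq_zero {A B C : ℕ → Type*} [∀ p, AddCommGroup (A p)]
    [∀ p, Module K (A p)] [∀ p, AddCommGroup (B p)] [∀ p, Module K (B p)]
    [∀ p, AddCommGroup (C p)] [∀ p, Module K (C p)]
    (f : ∀ p, A p →ₗ[K] B p) (g : ∀ p, B p →ₗ[K] C p) (δ : ∀ p, C p →ₗ[K] A (p + 1))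
    (hA : ∀ p, Module.Finite K (A p)) (hB : ∀ p, Module.Finite K (B p))
    (hC : ∀ p, Module.Finite K (C p))
    (hf : Function.Injective (f 0)) (hfg : ∀ p, Function.Exact (f p) (g p))
    (hgδ : ∀ p, Function.Exact (g p) (δ p)) (hδf : ∀ p, Function.Exact (δ p) (f (p + 1)))
    (h4 : Subsingleton (A 4)) :
    ∑ p ∈ Finset.range 4, (-1) ^ p * (Module.finrank K (B p) : ℤ) =
      ∑ p ∈ Finset.range 4, (-1) ^ p * (Module.finrank K (A p) : ℤ) +
      ∑ p ∈ Finset.range 4, (-1) ^ p * (Module.finrank K (C p) : ℤ) := by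
  have h3 : Module.finrank K (LinearMap.range (δ 3)) = 0 := by
    have : Subsingleton (LinearMap.range (δ 3)) := inferInstance
    exact Module.finrank_zero_of_subsingleton
  have h0 : Module.finrank K (A 0) = Module.finrank K (LinearMap.range (f 0)) :=
    (LinearMap.finrank_range_of_inj hf).symm
  have hB' p := finrank_eq_add_of_exact (hfg p)
  have hC' p := finrank_eq_add_of_exact (hgδ p)
  have hA' p := finrank_eq_add_of_exact (hδf p)
  simp only [Finset.sum_range_succ, Finset.sum_range_zero, hB', hC', h0,
    show Module.finrank K (A 1) = _ from hA' 0, show Module.finrank K (A 2) = _ from hA' 1,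
    show Module.finrank K (A 3) = _ from hA' 2, h3]
  push_cast
  ring

end Subquotient

section Complex

variable {K : Type*} [Field K] {X : Type*} [AddCommGroup X] [Module K X] {d : X →ₗ[K] X}

/-- A bounded complex of subspaces of the ambient space with differential `d`. The index `p + 1`
stands for the cochains of degree `p`. -/
structure SubCx (d : X →ₗ[K] X) where
  /-- The subspaces of the complex. -/
  carr : ℕ → Submodule K X
  d_mem : ∀ {k x}, x ∈ carr k → d x ∈ carr (k + 1)
  zero : carr 0 = ⊥
  bdd : ∀ k, 5 ≤ k → carr k = ⊥

/-- The cocycles of `M / N` in degree `p`, lifted to `M`. -/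
def cyc (M N : SubCx d) (p : ℕ) : Submodule K X := M.carr (p + 1) ⊓ (N.carr (p + 2)).comap d

lemma mem_cyc {M N : SubCx d} {p : ℕ} {x : X} :
    x ∈ cyc M N p ↔ x ∈ M.carr (p + 1) ∧ d x ∈ N.carr (p + 2) := Iff.rfl

/-- The coboundaries of `M / N` in degree `p`, lifted to the ambient space. -/
def bdy (M N : SubCx d) (p : ℕ) : Submodule K X := N.carr (p + 1) ⊔ (M.carr p).map d

/-- The cohomology of the quotient of the complex `M` by the subcomplex `N`. -/
abbrev RelH (M N : SubCx d) (p : ℕ) : Type _ := Subquot (cyc M N p) (bdy M N p)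

/-- The cohomology of `M / N` is finite dimensional, with Euler characteristic `e`. Only the degrees
up to `3` contribute, since the complexes vanish above. -/
def HasEulerChar (M N : SubCx d) (e : ℤ) : Prop :=
  (∀ p, Module.Finite K (RelH M N p)) ∧
    ∑ p ∈ Finset.range 4, (-1) ^ p * (Module.finrank K (RelH M N p) : ℤ) = e

instance : PartialOrder (SubCx d) where
  le M N := ∀ k, M.carr k ≤ N.carr k
  le_refl M k := le_rfl
  le_trans M N P h h' k := (h k).trans (h' k)
  le_antisymm M N h h' := by
    cases M; cases N; congr; funext k; exact le_antisymm (h k) (h' k)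

lemma mem_bdy {M N : SubCx d} {p : ℕ} {x : X} :
    x ∈ bdy M N p ↔ ∃ m ∈ M.carr p, x - d m ∈ N.carr (p + 1) := by
  rw [bdy, Submodule.mem_sup]
  constructor
  · rintro ⟨n, hn, _, ⟨m, hm, rfl⟩, rfl⟩
    exact ⟨m, hm, by simpa using hn⟩
  · rintro ⟨m, hm, h⟩
    exact ⟨_, h, _, ⟨m, hm, rfl⟩, by simp⟩

variable {M N P : SubCx d}

/-- The map `Hᵖ(M / N) → Hᵖ(P / N)`. -/
def relHIncl (hMP : M ≤ P) (p : ℕ) : RelH M N p →ₗ[K] RelH P N p :=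
  subquotMap LinearMap.id (fun _ hx => ⟨hMP _ hx.1, hx.2⟩)
    (fun _ _ h => by
      obtain ⟨m, hm, h⟩ := mem_bdy.1 h
      exact mem_bdy.2 ⟨m, hMP _ hm, h⟩)

/-- The map `Hᵖ(P / N) → Hᵖ(P / M)`. -/
def relHProj (hNM : N ≤ M) (p : ℕ) : RelH P N p →ₗ[K] RelH P M p :=
  subquotMap LinearMap.id (fun _ hx => ⟨hx.1, hNM _ hx.2⟩)
    (fun _ _ h => by
      obtain ⟨m, hm, h⟩ := mem_bdy.1 h
      exact mem_bdy.2 ⟨m, hm, hNM _ h⟩)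

variable (M N P) in
/-- The connecting map `Hᵖ(P / M) → Hᵖ⁺¹(M / N)`. -/
def relHConn (hd : ∀ x, d (d x) = 0) (p : ℕ) : RelH P M p →ₗ[K] RelH M N (p + 1) :=
  subquotMap d (fun x hx => mem_cyc.2 ⟨hx.2, by
      rw [hd]; exact zero_mem _⟩)
    (fun x hx h => by
      obtain ⟨m, hm, h⟩ := mem_bdy.1 h
      exact mem_bdy.2 ⟨_, h, by rw [map_sub, hd, sub_zero, sub_self]; exact zero_mem _⟩)

lemma relHIncl_zero_injective (hMP : M ≤ P) :
    Function.Injective (relHIncl (N := N) hMP 0) :=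
  subquotMap_injective _ _ _ fun x _ h => by
    obtain ⟨m, hm, h⟩ := mem_bdy.1 h
    rw [P.zero, Submodule.mem_bot] at hm
    exact mem_bdy.2 ⟨0, zero_mem _, by simpa [hm] using h⟩

lemma relHIncl_relHProj_exact (hd : ∀ x, d (d x) = 0) (hNM : N ≤ M) (hMP : M ≤ P) (p : ℕ) :
    Function.Exact (relHIncl hMP p) (relHProj hNM p) :=
  subquotMap_exact _ _ _ _ _ _
    (fun x hx => mem_bdy.2 ⟨0, zero_mem _, by simpa using hx.1⟩)
    (fun y hy h => by
      obtain ⟨m, hm, h⟩ := mem_bdy.1 h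
      refine ⟨y - d m, mem_cyc.2 ⟨h, ?_⟩, mem_bdy.2 ⟨m, hm, ?_⟩⟩
      · rw [map_sub, hd, sub_zero]
        exact hy.2
      · simp)

lemma relHProj_relHConn_exact (hd : ∀ x, d (d x) = 0) (hNM : N ≤ M) (hMP : M ≤ P) (p : ℕ) :
    Function.Exact (relHProj hNM p) (relHConn M N P hd p) :=
  subquotMap_exact _ _ _ _ _ _
    (fun x hx => mem_bdy.2 ⟨0, zero_mem _, by simpa using hx.2⟩)
    (fun y hy h => by
      obtain ⟨m, hm, h⟩ := mem_bdy.1 h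
      refine ⟨y - m, mem_cyc.2 ⟨sub_mem hy.1 (hMP _ hm), ?_⟩, mem_bdy.2 ⟨0, zero_mem _, ?_⟩⟩
      · rw [map_sub]
        exact h
      · simpa using hm)

lemma relHConn_relHIncl_exact (hd : ∀ x, d (d x) = 0) (hNM : N ≤ M) (hMP : M ≤ P) (p : ℕ) :
    Function.Exact (relHConn M N P hd p) (relHIncl hMP (p + 1)) :=
  subquotMap_exact _ _ _ _ _ _
    (fun x hx => mem_bdy.2 ⟨x, hx.1, by simp⟩)
    (fun y hy h => by
      obtain ⟨m, hm, h⟩ := mem_bdy.1 h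
      refine ⟨m, mem_cyc.2 ⟨hm, ?_⟩, mem_bdy.2 ⟨0, zero_mem _, by simpa using h⟩⟩
      have := sub_mem hy.1 (hNM _ h)
      simpa using this)

lemma subsingleton_relH {p : ℕ} (hp : 4 ≤ p) : Subsingleton (RelH M N p) := by
  refine subsingleton_subquot fun x hx => ?_
  have := (mem_cyc.1 hx).1
  rw [M.bdd _ (by omega), Submodule.mem_bot] at this
  rw [this]
  exact zero_mem _

/-- The long exact sequence of `N ≤ M ≤ P`, on the level of Euler characteristics. -/
lemma HasEulerChar.sum_eq (hd : ∀ x, d (d x) = 0) (hNM : N ≤ M) (hMP : M ≤ P)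
    (h1 : ∀ p, Module.Finite K (RelH M N p)) (h2 : ∀ p, Module.Finite K (RelH P N p))
    (h3 : ∀ p, Module.Finite K (RelH P M p)) :
    ∑ p ∈ Finset.range 4, (-1) ^ p * (Module.finrank K (RelH P N p) : ℤ) =
      ∑ p ∈ Finset.range 4, (-1) ^ p * (Module.finrank K (RelH M N p) : ℤ) +
      ∑ p ∈ Finset.range 4, (-1) ^ p * (Module.finrank K (RelH P M p) : ℤ) :=
  alternating_sum_finrank_eq_zero (relHIncl hMP) (relHProj hNM) (relHConn M N P hd)
    h1 h2 h3 (relHIncl_zero_injective hMP) (relHIncl_relHProj_exact hd hNM hMP)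
    (relHProj_relHConn_exact hd hNM hMP) (relHConn_relHIncl_exact hd hNM hMP)
    (subsingleton_relH le_rfl)

lemma HasEulerChar.add (hd : ∀ x, d (d x) = 0) (hNM : N ≤ M) (hMP : M ≤ P) {e e' : ℤ}
    (h : HasEulerChar M N e) (h' : HasEulerChar P M e') : HasEulerChar P N (e + e') := by
  have h2 p := finite_of_exact (relHIncl_relHProj_exact hd hNM hMP p) (h.1 p) (h'.1 p)
  exact ⟨h2, by rw [sum_eq hd hNM hMP h.1 h2 h'.1, h.2, h'.2]⟩

lemma HasEulerChar.sub_right (hd : ∀ x, d (d x) = 0) (hNM : N ≤ M) (hMP : M ≤ P) {e e' : ℤ}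
    (h : HasEulerChar P N e) (h' : HasEulerChar M N e') : HasEulerChar P M (e - e') := by
  have h2 p := finite_of_exact (relHProj_relHConn_exact hd hNM hMP p) (h.1 p) (h'.1 (p + 1))
  exact ⟨h2, by rw [← h.2, sum_eq hd hNM hMP h'.1 h.1 h2, h'.2]; ring⟩

lemma HasEulerChar.sub_left (hd : ∀ x, d (d x) = 0) (hNM : N ≤ M) (hMP : M ≤ P) {e e' : ℤ}
    (h : HasEulerChar P N e) (h' : HasEulerChar P M e') : HasEulerChar M N (e - e') := by
  have h2 : ∀ p, Module.Finite K (RelH M N p)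
    | 0 => have := h.1 0; .of_injective _ (relHIncl_zero_injective hMP)
    | p + 1 => finite_of_exact (relHConn_relHIncl_exact hd hNM hMP p) (h'.1 p) (h.1 (p + 1))
  exact ⟨h2, by rw [← h.2, sum_eq hd hNM hMP h2 h.1 h'.1, h'.2]; ring⟩

/-- A linear map that induces an isomorphism of the quotient complexes preserves the Euler
characteristic. -/
lemma HasEulerChar.of_iso {X' : Type*} [AddCommGroup X'] [Module K X'] {d' : X' →ₗ[K] X'}
    {M' N' : SubCx d'} (φ : X →ₗ[K] X')
    (hφd : ∀ k, ∀ x ∈ M.carr k, φ (d x) = d' (φ x))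
    (hM : ∀ k, ∀ x ∈ M.carr k, φ x ∈ M'.carr k)
    (hN : ∀ k, ∀ x ∈ M.carr k, φ x ∈ N'.carr k ↔ x ∈ N.carr k)
    (hM' : ∀ k, ∀ y ∈ M'.carr k, ∃ x ∈ M.carr k, y - φ x ∈ N'.carr k) {e : ℤ}
    (h : HasEulerChar M N e) : HasEulerChar M' N' e := by
  have hcyc : ∀ p, ∀ x ∈ cyc M N p, φ x ∈ cyc M' N' p := fun p x hx =>
    mem_cyc.2 ⟨hM _ _ hx.1, by
      rw [← hφd _ _ hx.1]
      exact (hN _ _ (M.d_mem hx.1)).2 hx.2⟩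
  have hbdy : ∀ p, ∀ x ∈ cyc M N p, x ∈ bdy M N p → φ x ∈ bdy M' N' p := by
    intro p x hx h
    obtain ⟨m, hm, h⟩ := mem_bdy.1 h
    refine mem_bdy.2 ⟨φ m, hM _ _ hm, ?_⟩
    rw [← hφd _ _ hm, ← map_sub]
    exact (hN _ _ (sub_mem hx.1 (M.d_mem hm))).2 h
  have hbij : ∀ p, Function.Bijective (subquotMap φ (hcyc p) (hbdy p)) := by
    refine fun p => ⟨subquotMap_injective _ _ _ fun x hx h => ?_,
      subquotMap_surjective _ _ _ fun y hy => ?_⟩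
    · obtain ⟨m', hm', h⟩ := mem_bdy.1 h
      obtain ⟨m, hm, hmm⟩ := hM' _ _ hm'
      refine mem_bdy.2 ⟨m, hm, (hN _ _ (sub_mem hx.1 (M.d_mem hm))).1 ?_⟩
      rw [map_sub, hφd _ _ hm]
      have := add_mem h (N'.d_mem hmm)
      rwa [map_sub, sub_add_sub_cancel] at this
    · obtain ⟨x, hx, h⟩ := hM' _ _ hy.1
      refine ⟨x, mem_cyc.2 ⟨hx, ?_⟩, mem_bdy.2 ⟨0, zero_mem _, by simpa using h⟩⟩
      rw [← hN _ _ (M.d_mem hx), hφd _ _ hx]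
      have := sub_mem (mem_cyc.1 hy).2 (N'.d_mem h)
      rwa [map_sub, sub_sub_cancel] at this
  have hiso p := LinearEquiv.ofBijective _ (hbij p)
  refine ⟨fun p => ?_, ?_⟩
  · have := h.1 p
    exact .equiv (hiso p)
  · rw [← h.2]
    exact Finset.sum_congr rfl fun p _ => by rw [(hiso p).finrank_eq]

lemma subquot_finite_and_finrank {A B C : Submodule K X} (hCB : C ≤ B) (hBA : B ≤ A)
    (h : Module.Finite K (Subquot A C)) : Module.Finite K (Subquot A B) ∧
      Module.Finite K (Subquot B C) ∧ Module.finrank K (Subquot A C) =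
        Module.finrank K (Subquot B C) + Module.finrank K (Subquot A B) := by
  have hi := subquotMap_injective (A := B) (B := C) (A' := A) (B' := C) LinearMap.id
    (fun x hx => hBA hx) (fun x _ hx => hx) (fun x _ hx => hx)
  have hs := subquotMap_surjective (A := A) (B := C) (A' := A) (B' := B) LinearMap.id
    (fun x hx => hx) (fun x _ hx => hCB hx) (fun y hy => ⟨y, hy, by simp⟩)
  have he := subquotMap_exact (A := B) (B := C) (A' := A) (B' := C) (A'' := A) (B'' := B)
    LinearMap.id LinearMap.id (fun x hx => hBA hx) (fun x _ hx => hx) (fun x hx => hx)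
    (fun x _ hx => hCB hx) (fun x hx => hx) (fun y hy h => ⟨y, h, by simp⟩)
  refine ⟨.of_surjective _ hs, .of_injective _ hi, ?_⟩
  rw [finrank_eq_add_of_exact he, LinearMap.finrank_range_of_inj hi,
    LinearMap.range_eq_top.2 hs, finrank_top]

/-- If the terms of the complex `M / N` are finite dimensional, its Euler characteristic is the
alternating sum of their dimensions. -/
lemma hasEulerChar_of_finite (hd : ∀ x, d (d x) = 0) (hNM : N ≤ M)
    (h : ∀ k, Module.Finite K (Subquot (M.carr k) (N.carr k))) : HasEulerChar M N
      (∑ p ∈ Finset.range 4,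
        (-1) ^ p * (Module.finrank K (Subquot (M.carr (p + 1)) (N.carr (p + 1))) : ℤ)) := by
  have hNb p : N.carr (p + 1) ≤ bdy M N p := le_sup_left
  have hbz p : bdy M N p ≤ cyc M N p := by
    intro x hx
    obtain ⟨m, hm, hx⟩ := mem_bdy.1 hx
    refine ⟨by simpa using add_mem (hNM _ hx) (M.d_mem hm), ?_⟩
    have := N.d_mem hx
    rwa [map_sub, hd, sub_zero] at this
  have hz p : cyc M N p ≤ M.carr (p + 1) := inf_le_left
  have s1 p := subquot_finite_and_finrank ((hNb p).trans (hbz p)) (hz p) (h (p + 1))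
  have s2 p := subquot_finite_and_finrank (hNb p) (hbz p) (s1 p).2.1
  -- The differential identifies the cochains modulo the cocycles with the coboundaries of the next
  -- degree.
  have hiso p : Module.finrank K (Subquot (M.carr (p + 1)) (cyc M N p)) =
      Module.finrank K (Subquot (bdy M N (p + 1)) (N.carr (p + 2))) := by
    refine (LinearEquiv.ofBijective (subquotMap (A := M.carr (p + 1)) (B := cyc M N p)
      (A' := bdy M N (p + 1)) (B' := N.carr (p + 2)) d
      (fun x hx => mem_bdy.2 ⟨x, hx, by simp⟩) (fun x _ hx => hx.2))
      ⟨subquotMap_injective _ _ _ fun x hx h => ⟨hx, h⟩,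
        subquotMap_surjective _ _ _ fun y hy => mem_bdy.1 hy⟩).finrank_eq
  have h0 : Module.finrank K (Subquot (bdy M N 0) (N.carr 1)) = 0 := by
    have : Subsingleton (Subquot (bdy M N 0) (N.carr 1)) := by
      refine subsingleton_subquot fun x hx => ?_
      obtain ⟨m, hm, h⟩ := mem_bdy.1 hx
      rw [M.zero, Submodule.mem_bot] at hm
      simpa [hm] using h
    exact Module.finrank_zero_of_subsingleton
  have h4 : Module.finrank K (Subquot (bdy M N 4) (N.carr 5)) = 0 := by
    have : Subsingleton (Subquot (bdy M N 4) (N.carr 5)) := by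
      refine subsingleton_subquot fun x hx => ?_
      have := (hz 4) (hbz 4 hx)
      rw [M.bdd _ le_rfl, Submodule.mem_bot] at this
      rw [this]
      exact zero_mem _
    exact Module.finrank_zero_of_subsingleton
  refine ⟨fun p => (s2 p).1, ?_⟩
  have e p := (s1 p).2.2
  have e' p := (s2 p).2.2
  have i0 := hiso 0
  have i1 := hiso 1
  have i2 := hiso 2
  have i3 := hiso 3
  simp only [Nat.reduceAdd] at i0 i1 i2 i3
  simp only [Finset.sum_range_succ, Finset.sum_range_zero, e, e', i0, i1, i2, i3, h0, h4]
  simp only [zero_add, Nat.reduceAdd]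
  push_cast
  ring

end Complex

/-! ### Čech complexes of Laurent polynomials -/

/-- The sign with which the face `T.erase t` occurs in the Čech differential: it is given by the
position of `t` in `T`. -/
def sgn (T : Finset ChartIdx) (t : ChartIdx) : ℂ := (-1) ^ (T.filter (· < t)).card

lemma sgn_mul_self (T : Finset ChartIdx) (t : ChartIdx) : sgn T t * sgn T t = 1 := by
  rw [sgn, ← mul_pow]; simp

lemma sgn_erase_of_lt {T : Finset ChartIdx} {s t : ChartIdx} (hst : s < t) :
    sgn (T.erase t) s = sgn T s := by
  rw [sgn, sgn]
  congr 2
  ext u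
  simp only [Finset.mem_filter, Finset.mem_erase]
  exact ⟨fun h => ⟨h.1.2, h.2⟩, fun h => ⟨⟨(h.2.trans hst).ne, h.1⟩, h.2⟩⟩

lemma sgn_erase_of_gt {T : Finset ChartIdx} {s t : ChartIdx} (hs : s ∈ T) (hst : s < t) :
    sgn (T.erase s) t = -sgn T t := by
  have h : (T.filter (· < t)).card = ((T.erase s).filter (· < t)).card + 1 := by
    rw [Finset.filter_erase, Finset.card_erase_add_one]
    exact Finset.mem_filter.2 ⟨hs, hst⟩
  rw [sgn, sgn, h, pow_succ]
  simp

lemma sgn_mul_sgn {T : Finset ChartIdx} {s t : ChartIdx} (hs : s ∈ T) (ht : t ∈ T) (hst : s ≠ t) :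
    sgn T t * sgn (T.erase t) s = -(sgn T s * sgn (T.erase s) t) := by
  rcases lt_or_gt_of_ne hst with h | h
  · rw [sgn_erase_of_lt h, sgn_erase_of_gt hs h]; ring
  · rw [sgn_erase_of_lt h, sgn_erase_of_gt ht h]; ring

/-- Čech cochains of all degrees with values in Laurent polynomials, as functions of the set of
charts that are intersected. -/
abbrev Cochain : Type := Finset ChartIdx → Laurent

/-- The Čech differential. -/
def cochD : Cochain →ₗ[ℂ] Cochain where
  toFun c T := ∑ t ∈ T, sgn T t • c (T.erase t)
  map_add' c c' := by
    funext T
    simp [smul_add, Finset.sum_add_distrib]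
  map_smul' r c := by
    funext T
    simp [Finset.smul_sum, smul_comm r]

lemma cochD_apply (c : Cochain) (T : Finset ChartIdx) :
    cochD c T = ∑ t ∈ T, sgn T t • c (T.erase t) := rfl

lemma coeff_cochD (c : Cochain) (T : Finset ChartIdx) (e : ℤ × ℤ) :
    (cochD c T).coeff e = ∑ t ∈ T, sgn T t * (c (T.erase t)).coeff e := by
  rw [cochD_apply, AddMonoidAlgebra.coeff_sum, Finsupp.finsetSum_apply]
  rfl

lemma cochD_cochD (c : Cochain) : cochD (cochD c) = 0 := by
  funext T
  rw [cochD_apply, Pi.zero_apply]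
  -- The double sum over pairs of distinct elements of `T` is antisymmetric.
  set F : ChartIdx → ChartIdx → Laurent := fun t s =>
    if s ≠ t then (sgn T t * sgn (T.erase t) s) • c ((T.erase t).erase s) else 0
  have h1 : ∀ t ∈ T, sgn T t • cochD c (T.erase t) = ∑ s ∈ T, F t s := by
    intro t ht
    rw [cochD_apply, Finset.smul_sum, ← Finset.filter_ne', Finset.sum_filter]
    refine Finset.sum_congr rfl fun s _ => ?_
    simp only [F, smul_smul, Finset.filter_ne']
  have h2 : ∀ t ∈ T, ∀ s ∈ T, F t s = - F s t := by
    intro t ht s hs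
    by_cases h : s = t
    · simp [F, h]
    · simp only [F, if_pos (show s ≠ t from h), if_pos (show t ≠ s from Ne.symm h)]
      rw [sgn_mul_sgn hs ht h, neg_smul, Finset.erase_right_comm]
  rw [Finset.sum_congr rfl h1]
  have h3 : ∑ t ∈ T, ∑ s ∈ T, F t s = - ∑ t ∈ T, ∑ s ∈ T, F t s := by
    conv_lhs => rw [Finset.sum_comm]
    rw [← Finset.sum_neg_distrib]
    refine Finset.sum_congr rfl fun t ht => ?_
    rw [← Finset.sum_neg_distrib]
    exact Finset.sum_congr rfl fun s hs => h2 s hs t ht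
  have h4 : (2 : ℂ) • ∑ t ∈ T, ∑ s ∈ T, F t s = 0 := by
    rw [two_smul]
    nth_rewrite 1 [h3]
    exact neg_add_cancel _
  exact (smul_eq_zero.1 h4).resolve_left two_ne_zero

/-- An increasing family of spaces of Laurent polynomials, indexed by the intersections of the
standard charts. -/
structure Sys where
  /-- The space that belongs to the intersection of the charts of `T`. -/
  carr : Finset ChartIdx → Submodule ℂ Laurent
  mono : ∀ {T T'}, T.Nonempty → T ⊆ T' → carr T ≤ carr T'

/-- The cochains of a system on intersections of `k` charts. -/
def Sys.cochains (M : Sys) (k : ℕ) : Submodule ℂ Cochain where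
  carrier := {c | (∀ T, T.card = k → T.Nonempty → c T ∈ M.carr T) ∧
      (∀ T, ¬ (T.card = k ∧ T.Nonempty) → c T = 0)}
  add_mem' := by
    rintro c c' ⟨hc, hc0⟩ ⟨hc', hc0'⟩
    exact ⟨fun T h h' => add_mem (hc T h h') (hc' T h h'), fun T h => by
      rw [Pi.add_apply, hc0 T h, hc0' T h, add_zero]⟩
  zero_mem' := ⟨fun T _ _ => zero_mem _, fun _ _ => rfl⟩
  smul_mem' := by
    rintro r c ⟨hc, hc0⟩
    exact ⟨fun T h h' => Submodule.smul_mem _ r (hc T h h'), fun T h => by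
      rw [Pi.smul_apply, hc0 T h, smul_zero]⟩

/-- The Čech complex of a system. -/
def Sys.cx (M : Sys) : SubCx cochD where
  carr := M.cochains
  d_mem := by
    rintro k c ⟨hc, hc'⟩
    refine ⟨fun T h h' => Submodule.sum_mem _ fun t ht => Submodule.smul_mem _ _ ?_,
      fun T h => Finset.sum_eq_zero fun t ht => ?_⟩
    · have hcard := Finset.card_erase_add_one ht
      rcases (T.erase t).eq_empty_or_nonempty with h0 | h0
      · rw [hc' _ (fun h => h.2.ne_empty h0)]
        exact zero_mem _
      · exact M.mono h0 (Finset.erase_subset _ _) (hc _ (by omega) h0)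
    · have hcard := Finset.card_erase_add_one ht
      rw [hc' _ (fun h' => h ⟨by omega, t, ht⟩), smul_zero]
  zero := by
    rw [eq_bot_iff]
    rintro c ⟨-, hc⟩
    funext T
    exact hc T fun h => by have := h.2.card_pos; omega
  bdd k hk := by
    rw [eq_bot_iff]
    rintro c ⟨-, hc⟩
    funext T
    have h4 : T.card ≤ 4 := by
      have := Finset.card_le_univ T
      simpa using this
    exact hc T fun h => by omega

lemma Sys.mem_cx {M : Sys} {k : ℕ} {c : Cochain} : c ∈ M.cx.carr k ↔
    (∀ T, T.card = k → T.Nonempty → c T ∈ M.carr T) ∧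
      (∀ T, ¬ (T.card = k ∧ T.Nonempty) → c T = 0) := Iff.rfl

instance : PartialOrder Sys where
  le M N := ∀ T, M.carr T ≤ N.carr T
  le_refl M k := le_rfl
  le_trans M N P h h' k := (h k).trans (h' k)
  le_antisymm M N h h' := by
    cases M; cases N; congr; funext k; exact le_antisymm (h k) (h' k)

lemma Sys.cx_mono {M N : Sys} (h : M ≤ N) : M.cx ≤ N.cx := by
  intro k c hc
  rw [mem_cx] at hc ⊢
  exact ⟨fun T h1 h2 => h T (hc.1 T h1 h2), hc.2⟩

/-- The cohomology of the quotient of two systems is finite dimensional, with Euler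
characteristic `e`. -/
abbrev Sys.Chi (M N : Sys) (e : ℤ) : Prop := HasEulerChar M.cx N.cx e

lemma nonempty_of_card_eq {k : ℕ} (hk : 0 < k) (T : {T : Finset ChartIdx // T.card = k}) :
    (T : Finset ChartIdx).Nonempty :=
  Finset.card_pos.1 (by rw [T.2]; exact hk)

/-- The components of a cochain, modulo a subsystem. -/
def Sys.components (M N : Sys) {k : ℕ} (hk : 0 < k) : M.cochains k →ₗ[ℂ]
    ∀ T : {T : Finset ChartIdx // T.card = k}, Subquot (M.carr T) (N.carr T) :=
  LinearMap.pi fun T => Submodule.mkQ _ ∘ₗ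
    LinearMap.codRestrict (M.carr T) (LinearMap.proj (T : Finset ChartIdx) ∘ₗ
      (M.cochains k).subtype) (fun c => c.2.1 T T.2 (nonempty_of_card_eq hk T))

lemma Sys.components_eq_zero {M N : Sys} {k : ℕ} (hk : 0 < k) (c : M.cochains k) :
    M.components N hk c = 0 ↔ (c : Cochain) ∈ N.cochains k := by
  rw [funext_iff]
  constructor
  · intro h
    exact ⟨fun T hT _ => (subquot_mk_eq_zero (B := N.carr T) _).1 (h ⟨T, hT⟩), c.2.2⟩
  · intro h T
    exact (subquot_mk_eq_zero _).2 (h.1 T T.2 (nonempty_of_card_eq hk T))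

open Classical in
lemma Sys.components_surjective {M N : Sys} {k : ℕ} (hk : 0 < k) :
    Function.Surjective (M.components N hk) := by
  intro y
  choose z hz using fun T => Submodule.Quotient.mk_surjective _ (y T)
  refine ⟨⟨fun T => if h : T.card = k then z ⟨T, h⟩ else 0, fun T h _ => ?_, fun T h => ?_⟩, ?_⟩
  · simp only [dif_pos h]
    exact (z ⟨T, h⟩).2
  · refine dif_neg fun h' => ?_
    exact h ⟨h', nonempty_of_card_eq hk ⟨T, h'⟩⟩
  · funext T
    rw [← hz T]
    change Submodule.Quotient.mk _ = _
    congr 1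
    ext1
    change (if h : (T : Finset ChartIdx).card = k then (z ⟨T, h⟩ : Laurent) else 0) = _
    rw [dif_pos T.2]

/-- The terms of the quotient of Čech complexes. -/
def Sys.subquotEquiv {M N : Sys} (k : ℕ) (hk : 0 < k) :
    Subquot (M.cx.carr k) (N.cx.carr k) ≃ₗ[ℂ]
      ∀ T : {T : Finset ChartIdx // T.card = k}, Subquot (M.carr T) (N.carr T) :=
  subquotEquivPi (K := ℂ) (X := Cochain)
    (Z := fun T : {T : Finset ChartIdx // T.card = k} => Subquot (M.carr T) (N.carr T))
    (M.components N hk) (components_eq_zero hk) (components_surjective hk)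

/-- The Euler characteristic of a finite dimensional quotient of systems. -/
lemma Sys.chi_of_finite {M N : Sys} (hNM : N ≤ M)
    (h : ∀ T, T.Nonempty → Module.Finite ℂ (Subquot (M.carr T) (N.carr T))) :
    M.Chi N (∑ T ∈ Finset.univ.filter Finset.Nonempty,
      (-1) ^ (T.card + 1) * (Module.finrank ℂ (Subquot (M.carr T) (N.carr T)) : ℤ)) := by
  have hfin : ∀ k, 0 < k → ∀ T : {T : Finset ChartIdx // T.card = k},
      Module.Finite ℂ (Subquot (M.carr T) (N.carr T)) := fun k hk T =>
    h T (Finset.card_pos.1 (by rw [T.2]; exact hk))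
  have key := hasEulerChar_of_finite cochD_cochD (cx_mono hNM) (fun k => by
    rcases Nat.eq_zero_or_pos k with rfl | hk
    · rw [M.cx.zero]
      have : Subsingleton (Subquot (⊥ : Submodule ℂ Cochain) (N.cx.carr 0)) :=
        subsingleton_subquot bot_le
      infer_instance
    · have := hfin k hk
      exact .equiv (subquotEquiv k hk).symm)
  convert key using 1
  have hdeg : ∀ p, (-1 : ℤ) ^ p * (Module.finrank ℂ
      (Subquot (M.cx.carr (p + 1)) (N.cx.carr (p + 1))) : ℤ) =
      ∑ T ∈ Finset.univ.filter (fun T : Finset ChartIdx => T.card = p + 1),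
        (-1) ^ (T.card + 1) * (Module.finrank ℂ (Subquot (M.carr T) (N.carr T)) : ℤ) := by
    intro p
    have := hfin (p + 1) p.succ_pos
    have hfree : ∀ T : {T : Finset ChartIdx // T.card = p + 1},
        Module.Free ℂ (Subquot (M.carr T) (N.carr T)) := fun T => .of_divisionRing _ _
    rw [(subquotEquiv (p + 1) p.succ_pos).finrank_eq, Module.finrank_pi_fintype]
    push_cast
    rw [Finset.mul_sum]
    rw [Finset.sum_subtype (p := fun T => T.card = p + 1) (Finset.univ.filter
      (fun T : Finset ChartIdx => T.card = p + 1)) (fun T => by simp)]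
    refine Finset.sum_congr rfl fun T _ => ?_
    rw [T.2]
    ring
  rw [Finset.sum_congr rfl fun p _ => hdeg p]
  have hmap : ∀ T ∈ (Finset.univ.filter Finset.Nonempty : Finset (Finset ChartIdx)),
      T.card - 1 ∈ Finset.range 4 := by
    intro T _
    have := Finset.card_le_univ T
    have h4 : Fintype.card ChartIdx = 4 := by simp
    rw [Finset.mem_range]
    omega
  rw [← Finset.sum_fiberwise_of_maps_to hmap]
  refine Finset.sum_congr rfl fun p _ => Finset.sum_congr ?_ fun _ _ => rfl
  ext T
  simp only [Finset.mem_filter, Finset.mem_univ, true_and, ← Finset.card_pos]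
  omega

/-! ### Monomial systems -/

/-- The system of Laurent polynomials with prescribed exponents. -/
def monSys (S : Finset ChartIdx → Set (ℤ × ℤ)) (hS : ∀ {T T'}, T.Nonempty → T ⊆ T' → S T ⊆ S T') :
    Sys where
  carr T := supp (S T)
  mono h h' := supp_mono (hS h h')

section Toggle

variable {S S' : Finset ChartIdx → Set (ℤ × ℤ)} (a : ℤ × ℤ → ChartIdx)

/-- The contracting homotopy of a quotient of monomial systems: the component with exponent `e`
of a cochain is moved from `T ∪ {a e}` to `T`. -/
def toggle (S S' : Finset ChartIdx → Set (ℤ × ℤ)) (a : ℤ × ℤ → ChartIdx) (c : Cochain) :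
    Cochain :=
  fun T => ∑ b ∈ Finset.univ.filter (· ∉ T), sgn (insert b T) b •
    part {e | T.Nonempty ∧ a e = b ∧ e ∈ S T ∧ e ∉ S' T} (c (insert b T))

open Classical in
lemma coeff_toggle (c : Cochain) (T : Finset ChartIdx) (e : ℤ × ℤ) :
    (toggle S S' a c T).coeff e = if T.Nonempty ∧ a e ∉ T ∧ e ∈ S T ∧ e ∉ S' T then
      sgn (insert (a e) T) (a e) * (c (insert (a e) T)).coeff e else 0 := by
  rw [toggle, AddMonoidAlgebra.coeff_sum, Finsupp.finsetSum_apply]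
  have h : ∀ b ∈ Finset.univ.filter (· ∉ T), (AddMonoidAlgebra.coeff (sgn (insert b T) b •
      part {e | T.Nonempty ∧ a e = b ∧ e ∈ S T ∧ e ∉ S' T} (c (insert b T)))) e =
      if b = a e then (if T.Nonempty ∧ a e ∉ T ∧ e ∈ S T ∧ e ∉ S' T then
      sgn (insert (a e) T) (a e) * (c (insert (a e) T)).coeff e else 0) else 0 := by
    intro b hb
    rw [AddMonoidAlgebra.coeff_smul_apply, coeff_part]
    have hb' : b ∉ T := by simpa using hb
    by_cases h : b = a e
    · subst h
      simp only [Set.mem_ofPred_eq, true_and, hb', if_true, not_false_eq_true, smul_eq_mul,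
        mul_ite, mul_zero]
    · simp [h, Ne.symm h]
  rw [Finset.sum_congr rfl h, Finset.sum_ite_eq']
  split_ifs <;> simp_all

/-- A quotient of monomial systems has no cohomology if its exponents are not affected by
adding and removing a chart that depends on the exponent only. -/
lemma chi_zero_of_toggle (hS : ∀ {T T'}, T.Nonempty → T ⊆ T' → S T ⊆ S T')
    (hS' : ∀ {T T'}, T.Nonempty → T ⊆ T' → S' T ⊆ S' T')
    (h1 : ∀ T e, a e ∉ T → e ∈ S (insert (a e) T) → e ∉ S' (insert (a e) T) →
      T.Nonempty ∧ e ∈ S T)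
    (h2 : ∀ T e, T.Nonempty → a e ∉ T → e ∈ S T → e ∉ S' T → e ∉ S' (insert (a e) T)) :
    (monSys S hS).Chi (monSys S' hS') 0 := by
  classical
  have key : ∀ p, Subsingleton (RelH (monSys S hS).cx (monSys S' hS').cx p) := by
    intro p
    refine subsingleton_subquot fun z hz => ?_
    obtain ⟨⟨hz1, hz2⟩, hz3, -⟩ := mem_cyc.1 hz
    -- The cochain `toggle S S' a z` is a primitive of the cocycle `z` modulo the subcomplex. This
    -- is checked for each exponent `e`, according to whether `T` contains `a e`.
    refine mem_bdy.2 ⟨toggle S S' a z, ⟨fun T hT hT0 e he => ?_, fun T hT => ?_⟩, ?_, ?_⟩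
    · rw [coeff_toggle, if_neg]
      exact fun h => he h.2.2.1
    · ext e
      rw [coeff_toggle]
      split_ifs with h
      · have hc := Finset.card_insert_of_notMem h.2.1
        rw [hz2 _ (fun h' => hT ⟨by omega, h.1⟩)]
        simp
      · rfl
    · intro T hT hT0 e he
      rw [Pi.sub_apply, AddMonoidAlgebra.coeff_sub, Finsupp.sub_apply, sub_eq_zero]
      rw [coeff_cochD]
      have hzS : ∀ T, e ∉ S T → (z T).coeff e = 0 := by
        intro T h
        by_cases hT : T.card = p + 1 ∧ T.Nonempty
        · exact hz1 T hT.1 hT.2 e h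
        · rw [hz2 T hT]
          rfl
      by_cases ha : a e ∈ T
      · rw [Finset.sum_eq_single (a e), coeff_toggle, Finset.insert_erase ha]
        · by_cases hSe : e ∈ S T
          · have h := h1 (T.erase (a e)) e (Finset.notMem_erase _ _)
            rw [Finset.insert_erase ha] at h
            obtain ⟨h3, h4⟩ := h hSe he
            rw [if_pos ⟨h3, Finset.notMem_erase _ _, h4,
              fun h' => he (hS' h3 (Finset.erase_subset _ _) h')⟩, ← mul_assoc, sgn_mul_self,
              one_mul]
          · rw [hzS T hSe]
            simp
        · intro t _ ht
          rw [coeff_toggle, if_neg (fun h => h.2.1 (Finset.mem_erase.2 ⟨ht.symm, ha⟩)), mul_zero]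
        · exact fun h => (h ha).elim
      by_cases hSe : e ∈ S T
      swap
      · rw [hzS T hSe, eq_comm]
        refine Finset.sum_eq_zero fun t _ => ?_
        rw [coeff_toggle, if_neg (fun h => hSe (hS h.1 (Finset.erase_subset _ _) h.2.2.1)),
          mul_zero]
      -- The component of `d z` on `T' = T ∪ {a e}` expresses `z T` by the faces of `T'` that
      -- contain `a e`, and these are the components of `z` from which the toggle is formed.
      set T' := insert (a e) T with hT'
      have he' := h2 T e hT0 ha hSe he
      have hcard : T'.card = p + 2 := by rw [hT', Finset.card_insert_of_notMem ha, hT]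
      have hdz := hz3 T' hcard (Finset.insert_nonempty _ _) e he'
      rw [coeff_cochD, hT', Finset.sum_insert ha, ← hT', Finset.erase_insert ha] at hdz
      have hterm : ∀ t ∈ T, sgn T t * (toggle S S' a z (T.erase t)).coeff e =
          - sgn T' (a e) * (sgn T' t * (z (T'.erase t)).coeff e) := by
        intro t ht
        have hta : a e ≠ t := fun h => ha (h ▸ ht)
        have hins : insert (a e) (T.erase t) = T'.erase t := by
          rw [hT', Finset.erase_insert_of_ne hta]
        have htog : (toggle S S' a z (T.erase t)).coeff e =
            sgn (T'.erase t) (a e) * (z (T'.erase t)).coeff e := by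
          rw [coeff_toggle, hins]
          split_ifs with h
          · rfl
          · by_cases hz' : e ∈ S (T'.erase t)
            · exfalso
              have hsub : T'.erase t ⊆ T' := Finset.erase_subset _ _
              have hne : (T'.erase t).Nonempty :=
                ⟨a e, by rw [← hins]; exact Finset.mem_insert_self _ _⟩
              have ha' : a e ∉ T.erase t := fun h => ha (Finset.mem_of_mem_erase h)
              have h5 := h1 (T.erase t) e ha' (by rwa [hins])
                (by rw [hins]; exact fun h' => he' (hS' hne hsub h'))
              exact h ⟨h5.1, ha', h5.2, fun h' => he (hS' h5.1 (Finset.erase_subset _ _) h')⟩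
            · rw [hzS _ hz', mul_zero]
        rw [htog]
        have hs := sgn_mul_sgn (T := T') (Finset.mem_insert_self _ _)
          (Finset.mem_insert_of_mem ht) hta
        rw [hT', Finset.erase_insert ha, ← hT'] at hs
        have h3 := sgn_mul_self T' t
        have h4 := sgn_mul_self (T'.erase t) (a e)
        have h5 := sgn_mul_self T t
        have h6 := sgn_mul_self T' (a e)
        linear_combination ((z (T'.erase t)).coeff e) * ((-sgn T' (a e) * sgn T' t) * h4 -
          sgn T t * sgn (T'.erase t) (a e) * h6 + sgn T' (a e) * sgn (T'.erase t) (a e) * hs)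
      rw [Finset.sum_congr rfl hterm, ← Finset.mul_sum]
      have h6 := sgn_mul_self T' (a e)
      linear_combination (-(z T).coeff e) * h6 + sgn T' (a e) * hdz
    · intro T hT
      rw [Pi.sub_apply, hz2 T hT, zero_sub, neg_eq_zero]
      refine Finset.sum_eq_zero fun t ht => ?_
      have hcard := Finset.card_erase_add_one ht
      have : toggle S S' a z (T.erase t) = 0 := by
        ext e
        rw [coeff_toggle]
        split_ifs with h
        · have hc := Finset.card_insert_of_notMem h.2.1
          rw [hz2 _ (fun h' => hT ⟨by omega, t, ht⟩)]
          simp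
        · rfl
      rw [this, smul_zero]
  exact ⟨fun p => have := key p; inferInstance, Finset.sum_eq_zero fun p _ => by
    have := key p
    rw [Module.finrank_zero_of_subsingleton]
    simp⟩

end Toggle

/-! ### The Euler characteristics of the line bundles -/

/-- Exponents of the sections of `𝒪(m, n)` over the intersection of the charts of `T`. -/
def twistCone (m n : ℤ) (T : Finset ChartIdx) : Set (ℤ × ℤ) :=
  {e | ∀ a ∈ T, e + tau m n a ∈ cone T}

lemma twistCone_mono (m n : ℤ) {T T' : Finset ChartIdx} (hT : T.Nonempty) (h : T ⊆ T') :
    twistCone m n T ⊆ twistCone m n T' := by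
  intro e he b hb
  obtain ⟨a, ha⟩ := hT
  have := add_mem_cone (cone_mono h (he a ha)) (tau_sub_mem_cone m n hb (h ha))
  simpa using this

/-- The lines of the `2 × 2` square of charts that a set of charts has to meet in order that a
monomial is regular on their intersection. -/
structure Cond where
  /-- The set has to meet the line on which the first index is one. -/
  x1 : Bool
  /-- The set has to meet the line on which the first index is zero. -/
  x0 : Bool
  /-- The set has to meet the line on which the second index is one. -/
  z1 : Bool
  /-- The set has to meet the line on which the second index is zero. -/
  z0 : Bool

/-- The conditions that belong to an exponent. -/
def cond (m n : ℤ) (e : ℤ × ℤ) : Cond where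
  x1 := decide (e.1 < 0)
  x0 := decide (m < e.1)
  z1 := decide (e.2 < 0)
  z0 := decide (n < e.2)

/-- `T` meets the required lines. -/
def Cond.Holds (C : Cond) (T : Finset ChartIdx) : Bool :=
  (!C.x1 || decide (∃ a ∈ T, a.fst = 1)) && (!C.x0 || decide (∃ a ∈ T, a.fst = 0)) &&
  (!C.z1 || decide (∃ a ∈ T, a.snd = 1)) && (!C.z0 || decide (∃ a ∈ T, a.snd = 0))

/-- Exactly one of two parallel lines has to be met. The exponents for which this is the case do not
contribute to the cohomology. -/
def Cond.Mixed (C : Cond) : Bool := (C.x1 ^^ C.x0) || (C.z1 ^^ C.z0)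

/-- The subsystem that is removed first in the computation of the cohomology of `𝒪(m, n)`:
if one of the `x`-lines and both `z`-lines have to be met, then a certain chart is required
to be in the set, and similarly with `x` and `z` exchanged. -/
def Cond.Sub (C : Cond) (T : Finset ChartIdx) : Bool :=
  C.Holds T && C.Mixed &&
    (!((C.x1 ^^ C.x0) && (C.z1 && C.z0)) || decide (toLex (if C.x1 then 1 else 0, 0) ∈ T)) &&
    (!((C.z1 ^^ C.z0) && (C.x1 && C.x0)) || decide (toLex (0, if C.z1 then 1 else 0) ∈ T))

/-- The chart that contracts the subsystem. -/
def Cond.chartSub (C : Cond) : ChartIdx :=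
  if C.x1 ^^ C.x0 then
    toLex (if C.x1 then 0 else 1, if C.z1 && !C.z0 then 0 else if C.z0 && !C.z1 then 1 else 0)
  else toLex (0, if C.z1 then 0 else 1)

/-- The chart that contracts the mixed exponents modulo the subsystem. -/
def Cond.chartQuot (C : Cond) : ChartIdx :=
  if C.x1 ^^ C.x0 then toLex (if C.x1 then 0 else 1, 1)
  else toLex (1, if C.z1 then 0 else 1)

lemma Cond.sub_of_sub_insert : ∀ (x1 x0 z1 z0 : Bool) (T : Finset ChartIdx),
    let C : Cond := ⟨x1, x0, z1, z0⟩
    C.chartSub ∉ T → C.Sub (insert C.chartSub T) = true → T.Nonempty ∧ C.Sub T = true := by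
  decide

lemma Cond.holds_of_holds_insert : ∀ (x1 x0 z1 z0 : Bool) (T : Finset ChartIdx),
    let C : Cond := ⟨x1, x0, z1, z0⟩
    C.chartQuot ∉ T → (C.Holds (insert C.chartQuot T) && C.Mixed &&
      !C.Sub (insert C.chartQuot T)) = true → T.Nonempty ∧ C.Holds T = true := by
  decide

lemma Cond.not_sub_insert : ∀ (x1 x0 z1 z0 : Bool) (T : Finset ChartIdx),
    let C : Cond := ⟨x1, x0, z1, z0⟩
    T.Nonempty → C.chartQuot ∉ T → (C.Holds T && C.Mixed && !C.Sub T) = true →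
      C.Sub (insert C.chartQuot T) = false := by
  decide

lemma Cond.sub_insert : ∀ (x1 x0 z1 z0 : Bool) (T : Finset ChartIdx) (a : ChartIdx),
    let C : Cond := ⟨x1, x0, z1, z0⟩
    C.Sub T = true → C.Sub (insert a T) = true := by
  decide

/-- The contribution of an exponent that is not mixed to the Euler characteristic. -/
lemma Cond.sum_holds : ∀ (x z : Bool),
    ∑ T ∈ Finset.univ.filter Finset.Nonempty,
      (if Cond.Holds ⟨x, x, z, z⟩ T then (-1 : ℤ) ^ (T.card + 1) else 0) =
      (if x then -1 else 1) * (if z then -1 else 1) := by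
  decide

lemma mem_twistCone_of_holds {m n : ℤ} {e : ℤ × ℤ} {T : Finset ChartIdx}
    (h : (cond m n e).Holds T = true) : e ∈ twistCone m n T := by
  simp only [Cond.Holds, cond, Bool.and_eq_true, Bool.or_eq_true, Bool.not_eq_true',
    decide_eq_true_eq, decide_eq_false_iff_not] at h
  obtain ⟨⟨⟨h1, h0⟩, k1⟩, k0⟩ := h
  intro a ha
  refine ⟨fun h => ?_, fun h => ?_, fun h => ?_, fun h => ?_⟩
  · rcases h1 with h1 | ⟨b, hb, hb'⟩
    · simp [tau, h a ha]; omega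
    · rw [h b hb] at hb'; simp at hb'
  · rcases h0 with h1 | ⟨b, hb, hb'⟩
    · simp [tau, h a ha]; omega
    · rw [h b hb] at hb'; simp at hb'
  · rcases k1 with h1 | ⟨b, hb, hb'⟩
    · simp [tau, h a ha]; omega
    · rw [h b hb] at hb'; simp at hb'
  · rcases k0 with h1 | ⟨b, hb, hb'⟩
    · simp [tau, h a ha]; omega
    · rw [h b hb] at hb'; simp at hb'

lemma holds_of_mem_twistCone {m n : ℤ} {e : ℤ × ℤ} {T : Finset ChartIdx} (hT : T.Nonempty)
    (h : e ∈ twistCone m n T) : (cond m n e).Holds T = true := by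
  have hf : ∀ i : Fin 2, i ≠ 1 → i = 0 := by decide
  have hf' : ∀ i : Fin 2, i ≠ 0 → i = 1 := by decide
  obtain ⟨a, ha⟩ := hT
  obtain ⟨h1, h0, k1, k0⟩ := h a ha
  simp only [Cond.Holds, cond, Bool.and_eq_true, Bool.or_eq_true, Bool.not_eq_true',
    decide_eq_true_eq, decide_eq_false_iff_not]
  refine ⟨⟨⟨?_, ?_⟩, ?_⟩, ?_⟩ <;> rw [or_iff_not_imp_right] <;> intro h <;> push Not at h
  · have h' : ∀ b ∈ T, b.fst = 0 := fun b hb => hf _ (h b hb)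
    have := h1 h'
    simp [tau, h' a ha] at this; omega
  · have h' : ∀ b ∈ T, b.fst = 1 := fun b hb => hf' _ (h b hb)
    have := h0 h'
    simp [tau, h' a ha] at this; omega
  · have h' : ∀ b ∈ T, b.snd = 0 := fun b hb => hf _ (h b hb)
    have := k1 h'
    simp [tau, h' a ha] at this; omega
  · have h' : ∀ b ∈ T, b.snd = 1 := fun b hb => hf' _ (h b hb)
    have := k0 h'
    simp [tau, h' a ha] at this; omega

lemma Cond.Sub.holds {C : Cond} {T : Finset ChartIdx} (h : C.Sub T = true) :
    C.Holds T = true ∧ C.Mixed = true := by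
  simp only [Cond.Sub, Bool.and_eq_true] at h
  exact h.1.1

lemma Cond.Sub.mono {C : Cond} {T T' : Finset ChartIdx} (h : C.Sub T = true) (hT : T ⊆ T') :
    C.Sub T' = true := by
  have key : ∀ U : Finset ChartIdx, C.Sub (U ∪ T) = true := by
    intro U
    induction U using Finset.induction_on with
    | empty => rwa [Finset.empty_union]
    | insert a U _ ih =>
      rw [Finset.insert_union]
      exact Cond.sub_insert _ _ _ _ (U ∪ T) a ih
  rw [← Finset.union_eq_left.2 hT]
  exact key T'

/-- The monomials with exponents in `S \ S'` form a basis of `supp S / supp S'`. -/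
lemma finite_subquot_supp {S S' : Set (ℤ × ℤ)} {F : Finset (ℤ × ℤ)}
    (hF : ∀ e, e ∈ F ↔ e ∈ S ∧ e ∉ S') : Module.Finite ℂ (Subquot (supp S) (supp S')) ∧
      Module.finrank ℂ (Subquot (supp S) (supp S')) = F.card := by
  have E : Subquot (supp S) (supp S') ≃ₗ[ℂ] (F → ℂ) := subquotEquivPi (K := ℂ)
    (Z := fun _ : F => ℂ)
    { toFun := fun c e => (c : Laurent).coeff e
      map_add' := fun _ _ => rfl
      map_smul' := fun _ _ => rfl }
    (fun c => by
      rw [funext_iff]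
      constructor
      · intro h e he
        by_cases heS : e ∈ S
        · exact h ⟨e, (hF e).2 ⟨heS, he⟩⟩
        · exact c.2 e heS
      · intro h e
        exact h e ((hF e).1 e.2).2)
    (fun y => by
      refine ⟨⟨∑ e : F, AddMonoidAlgebra.single (e : ℤ × ℤ) (y e), fun e he => ?_⟩, ?_⟩
      · rw [AddMonoidAlgebra.coeff_sum, Finsupp.finsetSum_apply]
        refine Finset.sum_eq_zero fun e' _ => ?_
        rw [AddMonoidAlgebra.coeff_single, Finsupp.single_apply, if_neg]
        rintro rfl
        exact he ((hF _).1 e'.2).1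
      · funext e
        change AddMonoidAlgebra.coeff (∑ e : F, AddMonoidAlgebra.single (e : ℤ × ℤ) (y e)) e = y e
        rw [AddMonoidAlgebra.coeff_sum, Finsupp.finsetSum_apply, Finset.sum_eq_single e]
        · rw [AddMonoidAlgebra.coeff_single, Finsupp.single_eq_same]
        · intro e' _ h
          rw [AddMonoidAlgebra.coeff_single, Finsupp.single_apply, if_neg]
          exact fun h' => h (Subtype.ext h')
        · simp)
  refine ⟨.equiv E.symm, ?_⟩
  rw [E.finrank_eq]
  simp

/-- The system of sections of `𝒪(m, n)`. -/
def lineSys (m n : ℤ) : Sys := monSys (twistCone m n) (twistCone_mono m n)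

/-- The zero system. -/
def zeroSys : Sys := monSys (fun _ => ∅) fun _ _ => le_rfl

lemma zeroSys_le (M : Sys) : zeroSys ≤ M := fun T g hg => by
  have : g = 0 := by
    ext e
    exact hg e (Set.notMem_empty e)
  rw [this]
  exact zero_mem _

/-- The values of one coordinate of an exponent for which either both of the two parallel lines have
to be met or none. -/
def interval (m : ℤ) : Finset ℤ := Finset.Icc 0 m ∪ Finset.Ioo m 0

lemma mem_interval {m x : ℤ} : x ∈ interval m ↔ (x < 0 ↔ m < x) := by
  simp only [interval, Finset.mem_union, Finset.mem_Icc, Finset.mem_Ioo]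
  omega

lemma sum_interval (m : ℤ) : ∑ x ∈ interval m, (if x < 0 then (-1 : ℤ) else 1) = m + 1 := by
  rcases le_or_gt 0 m with h | h
  · have : interval m = Finset.Icc 0 m := by
      rw [interval, Finset.Ioo_eq_empty (by omega), Finset.union_empty]
    rw [this, Finset.sum_congr rfl fun x hx => if_neg (by simp at hx; omega)]
    simp; omega
  · have : interval m = Finset.Ioo m 0 := by
      rw [interval, Finset.Icc_eq_empty (by omega), Finset.empty_union]
    rw [this, Finset.sum_congr rfl fun x hx => if_pos (by simp at hx; omega)]
    simp; omega

/-- The Euler characteristic of `𝒪(m, n)` is `(m + 1) (n + 1)`. -/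
lemma chi_lineSys (m n : ℤ) : (lineSys m n).Chi zeroSys ((m + 1) * (n + 1)) := by
  -- The mixed exponents form an acyclic subsystem `N2`: it has a subsystem `N1` such that `N1` and
  -- `N2 / N1` are both contractible by toggling a chart. The remaining exponents form a box.
  set N2 : Sys := monSys (fun T => {e | e ∈ twistCone m n T ∧ (cond m n e).Mixed = true})
    (fun hT h e he => ⟨twistCone_mono m n hT h he.1, he.2⟩) with hN2
  set N1 : Sys := monSys (fun T => {e | (cond m n e).Sub T = true})
    (fun hT h e he => Cond.Sub.mono he h) with hN1
  have le12 : N1 ≤ N2 := fun T => supp_mono fun e he =>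
    ⟨mem_twistCone_of_holds (Cond.Sub.holds he).1, (Cond.Sub.holds he).2⟩
  have le2 : N2 ≤ lineSys m n := fun T => supp_mono fun e he => he.1
  have hchi1 : N1.Chi zeroSys 0 := chi_zero_of_toggle (fun e => (cond m n e).chartSub) _
    (fun _ _ => le_rfl)
    (fun T e ha h _ => Cond.sub_of_sub_insert _ _ _ _ T ha h)
    (fun _ _ _ _ _ _ => Set.notMem_empty _)
  have hchi2 : N2.Chi N1 0 := by
    refine chi_zero_of_toggle (fun e => (cond m n e).chartQuot) _ _ (fun T e ha h h' => ?_)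
      (fun T e hT ha h h' => ?_)
    · obtain ⟨h1, h2⟩ := Cond.holds_of_holds_insert _ _ _ _ T ha (by
        change ((cond m n e).Holds (insert (cond m n e).chartQuot T) && (cond m n e).Mixed &&
          !(cond m n e).Sub (insert (cond m n e).chartQuot T)) = true
        rw [holds_of_mem_twistCone (Finset.insert_nonempty _ _) h.1, h.2,
          Bool.eq_false_iff.2 h']
        rfl)
      exact ⟨h1, mem_twistCone_of_holds h2, h.2⟩
    · have := Cond.not_sub_insert _ _ _ _ T hT ha (by
        change ((cond m n e).Holds _ && (cond m n e).Mixed && !(cond m n e).Sub _) = true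
        rw [holds_of_mem_twistCone hT h.1, h.2, Bool.eq_false_iff.2 h']
        rfl)
      exact Bool.eq_false_iff.1 this
  have hbox : ∀ T : Finset ChartIdx, T.Nonempty → ∀ e,
      e ∈ (interval m ×ˢ interval n).filter (fun e => (cond m n e).Holds T = true) ↔
      e ∈ twistCone m n T ∧ e ∉ {e | e ∈ twistCone m n T ∧ (cond m n e).Mixed = true} := by
    intro T hT e
    rw [Finset.mem_filter, Finset.mem_product, mem_interval, mem_interval]
    have hmix : (cond m n e).Mixed = true ↔ ¬ ((e.1 < 0 ↔ m < e.1) ∧ (e.2 < 0 ↔ n < e.2)) := by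
      simp only [Cond.Mixed, cond]
      by_cases h1 : e.1 < 0 <;> by_cases h2 : m < e.1 <;> by_cases h3 : e.2 < 0 <;>
        by_cases h4 : n < e.2 <;> simp [h1, h2, h3, h4]
    constructor
    · rintro ⟨h1, h2⟩
      exact ⟨mem_twistCone_of_holds h2, fun h => hmix.1 h.2 h1⟩
    · rintro ⟨h1, h2⟩
      refine ⟨?_, holds_of_mem_twistCone hT h1⟩
      by_contra h
      exact h2 ⟨h1, hmix.2 h⟩
  have hchi3 := Sys.chi_of_finite le2 (fun T hT => (finite_subquot_supp (hbox T hT)).1)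
  have hsum : ∑ T ∈ Finset.univ.filter Finset.Nonempty, (-1 : ℤ) ^ (T.card + 1) *
      (Module.finrank ℂ (Subquot ((lineSys m n).carr T) (N2.carr T)) : ℤ) = (m + 1) * (n + 1) := by
    have h1 : ∀ T ∈ Finset.univ.filter Finset.Nonempty, (-1 : ℤ) ^ (T.card + 1) *
        (Module.finrank ℂ (Subquot ((lineSys m n).carr T) (N2.carr T)) : ℤ) =
        ∑ e ∈ interval m ×ˢ interval n,
          if (cond m n e).Holds T then (-1 : ℤ) ^ (T.card + 1) else 0 := by
      intro T hT
      have h := (finite_subquot_supp (hbox T (Finset.mem_filter.1 hT).2)).2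
      refine (congrArg (fun k : ℕ => (-1 : ℤ) ^ (T.card + 1) * (k : ℤ)) h).trans ?_
      rw [← Finset.sum_filter, Finset.sum_const, nsmul_eq_mul, mul_comm]
    rw [Finset.sum_congr rfl h1, Finset.sum_comm, ← sum_interval m, ← sum_interval n,
      Finset.sum_mul_sum, Finset.sum_product]
    refine Finset.sum_congr rfl fun x hx => Finset.sum_congr rfl fun z hz => ?_
    rw [mem_interval] at hx hz
    have hc : cond m n (x, z) = ⟨decide (x < 0), decide (x < 0), decide (z < 0),
        decide (z < 0)⟩ := by
      simp only [cond, hx, hz]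
    rw [hc, Cond.sum_holds]
    simp
  rw [hsum] at hchi3
  have h := ((hchi1.add cochD_cochD (Sys.cx_mono (zeroSys_le _)) (Sys.cx_mono le12) hchi2).add
    cochD_cochD (Sys.cx_mono (zeroSys_le _)) (Sys.cx_mono le2) hchi3)
  simpa using h

/-! ### Ideal systems: twists and divisors -/

namespace IdealSystem

/-- Sections of the twist of an ideal system by `𝒪(m, n)`. -/
def twist (J : IdealSystem) (m n : ℤ) : Sys where
  carr T :=
    { carrier := {g | ∀ a ∈ T, mon (tau m n a) * g ∈ J.J T}
      add_mem' := fun hg hh a ha => by rw [mul_add]; exact add_mem (hg a ha) (hh a ha)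
      zero_mem' := fun a _ => by rw [mul_zero]; exact zero_mem _
      smul_mem' := fun c g hg a ha => by
        rw [mul_smul_comm]; exact Submodule.smul_mem _ _ (hg a ha) }
  mono := by
    rintro T T' ⟨a, ha⟩ h g hg b hb
    have h1 := J.mul_mem (g := mon (tau m n b - tau m n a)) ⟨b, hb⟩
      (mon_mem_supp (tau_sub_mem_cone m n hb (h ha))) (J.mono ⟨a, ha⟩ h (hg a ha))
    rwa [← mul_assoc, ← mon_add, sub_add_cancel] at h1

lemma mem_twist {J : IdealSystem} {m n : ℤ} {T : Finset ChartIdx} {g : Laurent} :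
    g ∈ (J.twist m n).carr T ↔ ∀ a ∈ T, mon (tau m n a) * g ∈ J.J T := Iff.rfl

lemma mem_twist_iff {J : IdealSystem} {m n : ℤ} {T : Finset ChartIdx} {a : ChartIdx} (ha : a ∈ T)
    {g : Laurent} : g ∈ (J.twist m n).carr T ↔ mon (tau m n a) * g ∈ J.J T := by
  refine ⟨fun h => h a ha, fun h b hb => ?_⟩
  have h1 := J.mul_mem (g := mon (tau m n b - tau m n a)) ⟨b, hb⟩
    (mon_mem_supp (tau_sub_mem_cone m n hb ha)) h
  rwa [← mul_assoc, ← mon_add, sub_add_cancel] at h1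

/-- The unit ideal. -/
def unit : IdealSystem where
  J := regular
  le_regular _ := le_rfl
  mul_mem _ hg hh := mul_mem_regular hg hh
  mono _ h := supp_mono (cone_mono h)
  loc ha hg := exists_mem_cone_neg_mem_cone ha hg

lemma twist_unit (m n : ℤ) : unit.twist m n = lineSys m n := by
  have h : (unit.twist m n).carr = (lineSys m n).carr := by
    funext T
    ext g
    change (∀ a ∈ T, mon (tau m n a) * g ∈ supp (cone T)) ↔ g ∈ supp (twistCone m n T)
    constructor
    · intro h
      refine mem_supp_iff_support.2 fun e he a ha => ?_
      exact mem_supp_iff_support.1 (mon_mul_mem_supp.1 (h a ha)) e he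
    · intro h a ha
      refine mon_mul_mem_supp.2 (mem_supp_iff_support.2 fun e he => ?_)
      exact mem_supp_iff_support.1 h e he a ha
  generalize unit.twist m n = A at h
  generalize lineSys m n = B at h
  cases A; cases B; congr

/-- `h` is a non-zero global section of `𝒪(s, r)` that divides the ideal system. On the chart `a` it
is given by the function `mon (tau s r a) * h`. -/
structure Divides (h : Laurent) (s r : ℤ) (J : IdealSystem) : Prop where
  ne_zero : h ≠ 0
  regular : ∀ a, mon (tau s r a) * h ∈ regular {a}
  exists_eq : ∀ a, ∀ g ∈ J.J {a}, ∃ q ∈ BiProj.regular {a}, g = mon (tau s r a) * h * q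

/-- A divisor of the ideals of the single charts divides the ideals of their intersections too. -/
lemma Divides.exists_eq' {h : Laurent} {s r : ℤ} {J : IdealSystem} (H : Divides h s r J)
    {T : Finset ChartIdx} {a : ChartIdx} (ha : a ∈ T) {g : Laurent} (hg : g ∈ J.J T) :
    ∃ q ∈ BiProj.regular T, g = mon (tau s r a) * h * q := by
  obtain ⟨u, hu, hu', hug⟩ := J.loc ha hg
  obtain ⟨q, hq, h1⟩ := H.exists_eq a _ hug
  refine ⟨mon (-u) * q, mul_mem_regular (mon_mem_supp hu')
    (supp_mono (cone_mono (Finset.singleton_subset_iff.2 ha)) hq), ?_⟩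
  have h2 := congrArg (fun x => mon (-u) * x) h1
  simp only [← mul_assoc, mon_neg_mul_mon, one_mul] at h2
  rw [h2]
  ring

/-- The elements whose product with `h` belongs to an ideal system. -/
def colon (J : IdealSystem) (h : Laurent) (s r : ℤ) (T : Finset ChartIdx) : Submodule ℂ Laurent :=
  ((J.twist s r).carr T).comap (LinearMap.mulLeft ℂ h)

lemma mem_colon {J : IdealSystem} {h : Laurent} {s r : ℤ}
    {T : Finset ChartIdx} {a : ChartIdx} (ha : a ∈ T) {q : Laurent} :
    q ∈ J.colon h s r T ↔ mon (tau s r a) * h * q ∈ J.J T := by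
  rw [mul_assoc, ← mem_twist_iff ha]
  rfl

/-- The quotient of an ideal system by a divisor. -/
def Divides.quot {h : Laurent} {s r : ℤ} {J : IdealSystem} (H : Divides h s r J) :
    IdealSystem where
  J := J.colon h s r
  le_regular := by
    rintro T ⟨a, ha⟩ q hq
    obtain ⟨q', hq', h1⟩ := H.exists_eq' ha ((mem_colon ha).1 hq)
    have h2 : q = q' := mul_left_cancel₀ (mul_ne_zero (mon_ne_zero _) H.ne_zero) h1
    rwa [h2]
  mul_mem := by
    rintro T g q ⟨a, ha⟩ hg hq
    rw [mem_colon ha, mul_left_comm]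
    exact J.mul_mem ⟨a, ha⟩ hg ((mem_colon ha).1 hq)
  mono hT h _ hg := (J.twist s r).mono hT h hg
  loc := by
    intro T a q ha hq
    obtain ⟨u, hu, hu', h1⟩ := J.loc ha ((mem_colon ha).1 hq)
    refine ⟨u, hu, hu', ?_⟩
    rwa [mem_colon (Finset.mem_singleton_self a), mul_left_comm]

lemma Divides.mem_quot {h : Laurent} {s r : ℤ} {J : IdealSystem} (H : Divides h s r J)
    {T : Finset ChartIdx} {a : ChartIdx} (ha : a ∈ T) {q : Laurent} :
    q ∈ H.quot.J T ↔ mon (tau s r a) * h * q ∈ J.J T := mem_colon ha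

/-- Multiplication by a divisor identifies the twists of the quotient with those of the ideal
system. -/
lemma Divides.chi {h : Laurent} {s r : ℤ} {J : IdealSystem} (H : Divides h s r J) {m n e : ℤ}
    (hchi : (H.quot.twist m n).Chi zeroSys e) : (J.twist (m + s) (n + r)).Chi zeroSys e := by
  have hz : ∀ {T : Finset ChartIdx} {g : Laurent}, g ∈ zeroSys.carr T ↔ g = 0 := by
    intro T g
    refine ⟨fun hg => ?_, fun hg => hg ▸ zero_mem _⟩
    ext e
    exact hg e (Set.notMem_empty e)
  have hmem : ∀ {T : Finset ChartIdx} {a : ChartIdx}, a ∈ T → ∀ {q : Laurent},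
      q ∈ (H.quot.twist m n).carr T ↔ h * q ∈ (J.twist (m + s) (n + r)).carr T := by
    intro T a ha q
    rw [mem_twist_iff ha, mem_twist_iff ha, H.mem_quot ha, tau_add, mon_add]
    ring_nf
  refine hchi.of_iso (LinearMap.compLeft (LinearMap.mulLeft ℂ h) _) (fun k c _ => ?_)
    (fun k c hc => ?_) (fun k c hc => ?_) (fun k c hc => ?_)
  · funext T
    change h * cochD c T = cochD (fun T => h * c T) T
    rw [cochD_apply, cochD_apply, Finset.mul_sum]
    exact Finset.sum_congr rfl fun t _ => mul_smul_comm _ _ _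
  · refine ⟨fun T hT hT0 => ?_, fun T hT => ?_⟩
    · obtain ⟨a, ha⟩ := hT0
      exact (hmem ha).1 (hc.1 T hT ⟨a, ha⟩)
    · change h * c T = 0
      rw [hc.2 T hT, mul_zero]
  · have hiff : ∀ {c : Cochain}, c ∈ zeroSys.cx.carr k ↔ c = 0 := by
      intro c
      refine ⟨fun hc => ?_, fun hc => hc ▸ zero_mem _⟩
      funext T
      by_cases hT : T.card = k ∧ T.Nonempty
      · exact hz.1 (hc.1 T hT.1 hT.2)
      · exact hc.2 T hT
    rw [hiff, hiff, funext_iff, funext_iff]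
    refine forall_congr' fun T => ?_
    change h * c T = 0 ↔ c T = 0
    simp [H.ne_zero]
  · have h1 : ∀ T, ∃ q, h * q = c T := by
      intro T
      by_cases hT : T.card = k ∧ T.Nonempty
      · obtain ⟨a, ha⟩ := hT.2
        obtain ⟨q, hq, h2⟩ := H.exists_eq' ha (hc.1 T hT.1 ⟨a, ha⟩ a ha)
        refine ⟨mon (-(tau m n a)) * q, ?_⟩
        rw [tau_add, mon_add] at h2
        have h4 := mon_neg_mul_mon (tau m n a)
        have h5 := mon_neg_mul_mon (tau s r a)
        linear_combination (-mon (-(tau m n a)) * mon (-(tau s r a))) * h2 +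
          (c T * mon (-(tau s r a)) * mon (tau s r a)) * h4 +
          (c T - h * mon (-(tau m n a)) * q) * h5
      · exact ⟨0, by rw [hc.2 T hT, mul_zero]⟩
    choose q hq using h1
    refine ⟨q, ⟨fun T hT hT0 => ?_, fun T hT => ?_⟩, ?_⟩
    · obtain ⟨a, ha⟩ := hT0
      rw [hmem ha, hq]
      exact hc.1 T hT ⟨a, ha⟩
    · have := hq T
      rw [hc.2 T hT] at this
      exact (mul_eq_zero.1 this).resolve_left H.ne_zero
    · have : c - LinearMap.compLeft (LinearMap.mulLeft ℂ h) _ q = 0 := by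
        funext T
        exact sub_eq_zero.2 (hq T).symm
      rw [this]
      exact zero_mem _

/-- The ideal system generated by a section of `𝒪(s, r)`. -/
def principal (h : Laurent) (s r : ℤ) (H : ∀ a, mon (tau s r a) * h ∈ regular {a}) :
    IdealSystem where
  J T :=
    { carrier := {g | ∀ a ∈ T, ∃ q ∈ regular T, g = mon (tau s r a) * h * q}
      add_mem' := by
        intro g g' hg hg' a ha
        obtain ⟨q, hq, h1⟩ := hg a ha
        obtain ⟨q', hq', h2⟩ := hg' a ha
        exact ⟨q + q', add_mem hq hq', by rw [h1, h2, mul_add]⟩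
      zero_mem' := fun a _ => ⟨0, zero_mem _, by rw [mul_zero]⟩
      smul_mem' := by
        intro c g hg a ha
        obtain ⟨q, hq, h1⟩ := hg a ha
        exact ⟨c • q, Submodule.smul_mem _ _ hq, by rw [h1, mul_smul_comm]⟩ }
  le_regular := by
    rintro T ⟨a, ha⟩ g hg
    obtain ⟨q, hq, rfl⟩ := hg a ha
    exact mul_mem_regular (supp_mono (cone_mono (Finset.singleton_subset_iff.2 ha)) (H a)) hq
  mul_mem := by
    intro T g g' _ hg hg' a ha
    obtain ⟨q, hq, rfl⟩ := hg' a ha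
    exact ⟨g * q, mul_mem_regular hg hq, by ring⟩
  mono := by
    rintro T T' ⟨a, ha⟩ h' g hg b hb
    obtain ⟨q, hq, rfl⟩ := hg a ha
    refine ⟨mon (tau s r a - tau s r b) * q, mul_mem_regular
      (mon_mem_supp (tau_sub_mem_cone s r (h' ha) hb)) (supp_mono (cone_mono h') hq), ?_⟩
    have : mon (tau s r a) = mon (tau s r b) * mon (tau s r a - tau s r b) := by
      rw [← mon_add, add_sub_cancel]
    rw [this]
    ring
  loc := by
    intro T a g ha hg
    obtain ⟨q, hq, rfl⟩ := hg a ha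
    obtain ⟨u, hu, hu', h1⟩ := exists_mem_cone_neg_mem_cone ha hq
    refine ⟨u, hu, hu', fun b hb => ?_⟩
    rw [Finset.mem_singleton] at hb
    subst hb
    exact ⟨_, h1, by ring⟩

lemma mem_principal {h : Laurent} {s r : ℤ} {H : ∀ a, mon (tau s r a) * h ∈ regular {a}}
    {T : Finset ChartIdx} {a : ChartIdx} (ha : a ∈ T) {g : Laurent} :
    g ∈ (principal h s r H).J T ↔ ∃ q ∈ regular T, g = mon (tau s r a) * h * q := by
  refine ⟨fun hg => hg a ha, ?_⟩
  rintro ⟨q, hq, rfl⟩ b hb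
  refine ⟨mon (tau s r a - tau s r b) * q, mul_mem_regular
      (mon_mem_supp (tau_sub_mem_cone s r ha hb)) hq, ?_⟩
  have : mon (tau s r a) = mon (tau s r b) * mon (tau s r a - tau s r b) := by
    rw [← mon_add, add_sub_cancel]
  rw [this]
  ring

/-- The Euler characteristic of the ideal sheaf of a curve. -/
lemma chi_principal {h : Laurent} {s r : ℤ} (h0 : h ≠ 0)
    (H : ∀ a, mon (tau s r a) * h ∈ regular {a}) (m n : ℤ) :
    ((principal h s r H).twist m n).Chi zeroSys ((m - s + 1) * (n - r + 1)) := by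
  have hd : Divides h s r (principal h s r H) :=
    ⟨h0, H, fun a g hg => hg a (Finset.mem_singleton_self a)⟩
  have hq : ∀ m n, hd.quot.twist m n = unit.twist m n := by
    intro m n
    have h : (hd.quot.twist m n).carr = (unit.twist m n).carr := by
      funext T
      rcases T.eq_empty_or_nonempty with rfl | ⟨a, ha⟩
      · ext g
        simp [mem_twist]
      · ext g
        rw [mem_twist_iff ha, mem_twist_iff ha, hd.mem_quot ha, mem_principal ha]
        constructor
        · rintro ⟨q, hq, h1⟩
          rwa [mul_left_cancel₀ (mul_ne_zero (mon_ne_zero _) h0) h1]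
        · intro h
          exact ⟨_, h, rfl⟩
    generalize hd.quot.twist m n = A at h
    generalize unit.twist m n = B at h
    cases A; cases B; congr
  have h1 := chi_lineSys (m - s) (n - r)
  rw [← twist_unit, ← hq] at h1
  have h2 := hd.chi h1
  rwa [sub_add_cancel, sub_add_cancel] at h2

/-- If an ideal system has finite colength, its Euler characteristic differs from that of `𝒪(m, n)`
by a constant: on a set of charts, twisting is multiplication by a monomial, which does not affect
the colength. -/
lemma chi_of_finite {J : IdealSystem}
    (h : ∀ T, T.Nonempty → Module.Finite ℂ (Subquot (regular T) (J.J T))) (m n : ℤ) :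
    (J.twist m n).Chi zeroSys ((m + 1) * (n + 1) - ∑ T ∈ Finset.univ.filter Finset.Nonempty,
      (-1) ^ (T.card + 1) * (Module.finrank ℂ (Subquot (regular T) (J.J T)) : ℤ)) := by
  have hle : J.twist m n ≤ lineSys m n := by
    rw [← twist_unit]
    intro T g hg a ha
    exact J.le_regular ⟨a, ha⟩ (hg a ha)
  have E : ∀ T : Finset ChartIdx, T.Nonempty →
      Nonempty (Subquot ((lineSys m n).carr T) ((J.twist m n).carr T) ≃ₗ[ℂ]
        Subquot (regular T) (J.J T)) := by
    rintro T ⟨a, ha⟩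
    rw [← twist_unit]
    refine ⟨LinearEquiv.ofBijective (subquotMap (A := (unit.twist m n).carr T)
      (B := (J.twist m n).carr T) (A' := regular T) (B' := J.J T)
      (LinearMap.mulLeft ℂ (mon (tau m n a)))
      (fun g hg => hg a ha) (fun g _ hg => hg a ha)) ⟨subquotMap_injective _ _ _ fun g _ hg =>
        (mem_twist_iff ha).2 hg, subquotMap_surjective _ _ _ fun g hg => ?_⟩⟩
    have h1 : mon (tau m n a) * (mon (-(tau m n a)) * g) = g := by
      rw [← mul_assoc, mon_mul_mon_neg, one_mul]
    refine ⟨mon (-(tau m n a)) * g, (mem_twist_iff ha).2 (by rw [h1]; exact hg), ?_⟩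
    rw [LinearMap.mulLeft_apply, h1, sub_self]
    exact zero_mem _
  have h1 := Sys.chi_of_finite hle fun T hT => by
    have := h T hT
    exact .equiv (E T hT).some.symm
  have h2 := (chi_lineSys m n).sub_left cochD_cochD (Sys.cx_mono (zeroSys_le _))
    (Sys.cx_mono hle) h1
  convert h2 using 2
  refine Finset.sum_congr rfl fun T hT => ?_
  rw [(E T (Finset.mem_filter.1 hT).2).some.finrank_eq]

end IdealSystem

/-! ### Zero-dimensional ideals in polynomial rings in two variables -/

/-- A prime ideal of `ℂ[X, Z]` whose elements have no common prime divisor is maximal: otherwise it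
would be part of a chain of prime ideals of length three. -/
lemma isMaximal_of_forall_prime_not_dvd {P : Ideal (MvPolynomial (Fin 2) ℂ)} (hP : P.IsPrime)
    (h : ∀ p, Prime p → ∃ g ∈ P, ¬ p ∣ g) : P.IsMaximal := by
  by_contra hmax
  obtain ⟨M, hM, hPM⟩ := P.exists_le_maximal hP.ne_top
  have hne : P ≠ ⊥ := by
    obtain ⟨g, hg, hg'⟩ := h _ (MvPolynomial.X_prime (i := 0))
    rintro rfl
    rw [Ideal.mem_bot] at hg
    exact hg' (hg ▸ dvd_zero _)
  obtain ⟨p, hpP, hp⟩ := hP.exists_mem_prime_of_ne_bot hne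
  have hspan : (Ideal.span {p}).IsPrime := (Ideal.span_singleton_prime hp.ne_zero).2 hp
  have h1 : (⊥ : Ideal (MvPolynomial (Fin 2) ℂ)) < Ideal.span {p} := by
    rw [bot_lt_iff_ne_bot, Ne, Ideal.span_singleton_eq_bot]
    exact hp.ne_zero
  have h2 : Ideal.span {p} < P := by
    refine lt_of_le_of_ne ((Ideal.span_singleton_le_iff_mem _).2 hpP) ?_
    rintro rfl
    obtain ⟨g, hg, hg'⟩ := h p hp
    exact hg' (Ideal.mem_span_singleton.1 hg)
  have h3 : P < M := lt_of_le_of_ne hPM fun e => hmax (e ▸ hM)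
  let l : LTSeries (PrimeSpectrum (MvPolynomial (Fin 2) ℂ)) :=
    { length := 3
      toFun := ![⟨⊥, Ideal.isPrime_bot⟩, ⟨_, hspan⟩, ⟨P, hP⟩, ⟨M, hM.isPrime⟩]
      step := by
        intro i
        fin_cases i
        · exact h1
        · exact h2
        · exact h3 }
  have h4 : (3 : WithBot ℕ∞) ≤ ringKrullDim (MvPolynomial (Fin 2) ℂ) :=
    Order.LTSeries.length_le_krullDim l
  rw [MvPolynomial.ringKrullDim_of_isNoetherianRing, ringKrullDim_eq_zero_of_field, Nat.card_fin,
    zero_add] at h4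
  exact absurd h4 (by decide)

/-- The quotient of `ℂ[X, Z]` by an ideal whose elements have no common prime divisor is finite
dimensional: the prime ideals that contain it are maximal. -/
lemma finite_quotient_of_forall_prime_not_dvd {I : Ideal (MvPolynomial (Fin 2) ℂ)}
    (h : ∀ p, Prime p → ∃ g ∈ I, ¬ p ∣ g) : Module.Finite ℂ (MvPolynomial (Fin 2) ℂ ⧸ I) := by
  rw [Module.finite_iff_krullDimLE_zero, Ring.krullDimLE_zero_iff]
  intro Q hQ
  have hle : I ≤ Q.comap (Ideal.Quotient.mk I) := fun g hg => by
    rw [Ideal.mem_comap, Ideal.Quotient.eq_zero_iff_mem.2 hg]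
    exact zero_mem _
  have hP : (Q.comap (Ideal.Quotient.mk I)).IsPrime := Ideal.comap_isPrime _ _
  have hmax := isMaximal_of_forall_prime_not_dvd hP fun p hp =>
    let ⟨g, hg, hg'⟩ := h p hp
    ⟨g, hle hg, hg'⟩
  have := Ideal.map_eq_top_or_isMaximal_of_surjective (Ideal.Quotient.mk I)
    Ideal.Quotient.mk_surjective hmax
  rw [Ideal.map_comap_of_surjective (Ideal.Quotient.mk I) Ideal.Quotient.mk_surjective] at this
  exact this.resolve_left hQ.ne_top

/-! ### The polynomial ring of a chart -/

/-- The sign of the exponents of the coordinate of a chart of `ℙ¹`. -/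
def dir (i : Fin 2) : ℤ := 1 - 2 * (i : ℕ)

lemma dir_mul_self (i : Fin 2) : dir i * dir i = 1 := by fin_cases i <;> rfl

/-- The exponent of a monomial of a chart. -/
def chartExp (a : ChartIdx) (m : Fin 2 →₀ ℕ) : ℤ × ℤ := (dir a.fst * m 0, dir a.snd * m 1)

/-- The polynomial ring of a chart as a ring of Laurent polynomials. -/
def chartLaurent (a : ChartIdx) : MvPolynomial (Fin 2) ℂ →ₐ[ℂ] Laurent :=
  MvPolynomial.aeval ![mon (dir a.fst, 0), mon (0, dir a.snd)]

lemma chartLaurent_monomial (a : ChartIdx) (m : Fin 2 →₀ ℕ) (c : ℂ) :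
    chartLaurent a (MvPolynomial.monomial m c) = AddMonoidAlgebra.single (chartExp a m) c := by
  rw [chartLaurent, MvPolynomial.aeval_monomial, Finsupp.prod_fintype _ _ (by simp),
    Fin.prod_univ_two]
  simp only [Matrix.cons_val_zero, Matrix.cons_val_one, AddMonoidAlgebra.single_pow, one_pow,
    AddMonoidAlgebra.single_mul_single, Algebra.algebraMap_eq_smul_one, AddMonoidAlgebra.one_def,
    AddMonoidAlgebra.smul_single, smul_mul_assoc]
  simp [chartExp, mul_comm]

lemma chartExp_injective (a : ChartIdx) : Function.Injective (chartExp a) := by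
  intro m m' h
  have hne : ∀ i, dir i ≠ 0 := by decide
  rw [chartExp, chartExp, Prod.mk.injEq, mul_right_inj' (hne _), mul_right_inj' (hne _)] at h
  ext i
  fin_cases i
  · exact_mod_cast h.1
  · exact_mod_cast h.2

lemma coeff_chartLaurent (a : ChartIdx) (p : MvPolynomial (Fin 2) ℂ) (m : Fin 2 →₀ ℕ) :
    (chartLaurent a p).coeff (chartExp a m) = p.coeff m := by
  induction p using MvPolynomial.induction_on' with
  | monomial m' c =>
    rw [chartLaurent_monomial, AddMonoidAlgebra.coeff_single, Finsupp.single_apply,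
      MvPolynomial.coeff_monomial]
    simp only [(chartExp_injective a).eq_iff]
  | add p q hp hq =>
    rw [map_add, AddMonoidAlgebra.coeff_add, Finsupp.add_apply, hp, hq, MvPolynomial.coeff_add]

lemma chartLaurent_injective (a : ChartIdx) : Function.Injective (chartLaurent a) := by
  intro p q h
  ext m
  rw [← coeff_chartLaurent a, h, coeff_chartLaurent]

lemma mem_cone_singleton_iff {a : ChartIdx} {e : ℤ × ℤ} :
    e ∈ cone {a} ↔ ∃ m, chartExp a m = e := by
  rw [mem_cone_singleton]
  have h0 : ∀ i : Fin 2, i = 0 ∨ i = 1 := by decide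
  constructor
  · rintro ⟨h1, h2, h3, h4⟩
    have key : ∀ (i : Fin 2) (x : ℤ), (i = 0 → 0 ≤ x) → (i = 1 → x ≤ 0) →
        dir i * ((dir i * x).toNat : ℤ) = x := by
      intro i x h1 h2
      rcases h0 i with rfl | rfl
      · have := h1 rfl; simp [dir]; omega
      · have := h2 rfl; simp [dir]; omega
    refine ⟨Finsupp.equivFunOnFinite.symm ![(dir a.fst * e.1).toNat, (dir a.snd * e.2).toNat], ?_⟩
    ext
    · exact key _ _ h1 h2
    · exact key _ _ h3 h4
  · rintro ⟨m, rfl⟩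
    refine ⟨fun h => ?_, fun h => ?_, fun h => ?_, fun h => ?_⟩ <;> simp [chartExp, h, dir]

lemma chartLaurent_mem (a : ChartIdx) (p : MvPolynomial (Fin 2) ℂ) :
    chartLaurent a p ∈ regular {a} := by
  induction p using MvPolynomial.induction_on' with
  | monomial m' c =>
    rw [chartLaurent_monomial, ← mul_one c, ← smul_eq_mul, ← AddMonoidAlgebra.smul_single]
    exact Submodule.smul_mem _ _ (mon_mem_supp (mem_cone_singleton_iff.2 ⟨m', rfl⟩))
  | add p q hp hq =>
    rw [map_add]
    exact add_mem hp hq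

lemma exists_chartLaurent_eq {a : ChartIdx} {g : Laurent} (hg : g ∈ regular {a}) :
    ∃ p, chartLaurent a p = g := by
  rw [← AddMonoidAlgebra.sum_coeff_single g]
  rw [mem_supp_iff_support] at hg
  have h : ∀ e : g.coeff.support, ∃ m, chartExp a m = e := fun e =>
    mem_cone_singleton_iff.1 (hg e (Finsupp.mem_support_iff.1 e.2))
  choose m hm using h
  refine ⟨∑ e : g.coeff.support, MvPolynomial.monomial (m e) (g.coeff e), ?_⟩
  rw [map_sum, Finsupp.sum, ← Finset.sum_coe_sort g.coeff.support
    (fun e => AddMonoidAlgebra.single e (g.coeff e))]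
  exact Finset.sum_congr rfl fun e _ => by rw [chartLaurent_monomial, hm]

namespace IdealSystem

/-- The ideal of the polynomial ring of a chart that belongs to an ideal system. -/
def chartIdeal (J : IdealSystem) (a : ChartIdx) : Ideal (MvPolynomial (Fin 2) ℂ) where
  carrier := {p | chartLaurent a p ∈ J.J {a}}
  add_mem' hp hq := by
    rename_i p q
    change chartLaurent a (p + q) ∈ J.J {a}
    rw [map_add]
    exact add_mem hp hq
  zero_mem' := by
    change chartLaurent a 0 ∈ J.J {a}
    rw [map_zero]
    exact zero_mem _
  smul_mem' p q hq := by
    change chartLaurent a (p * q) ∈ J.J {a}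
    rw [map_mul]
    exact J.mul_mem (Finset.singleton_nonempty a) (chartLaurent_mem a p) hq

/-- If the elements of an ideal system over a chart have no common prime divisor, then its colength
is finite. -/
lemma finite_of_forall_prime {J : IdealSystem} {a : ChartIdx}
    (h : ∀ p, Prime p → ∃ g ∈ J.chartIdeal a, ¬ p ∣ g) :
    Module.Finite ℂ (Subquot (regular {a}) (J.J {a})) := by
  have := finite_quotient_of_forall_prime_not_dvd h
  let φ : MvPolynomial (Fin 2) ℂ →ₗ[ℂ] Subquot (regular {a}) (J.J {a}) :=
    Submodule.mkQ _ ∘ₗ LinearMap.codRestrict _ (chartLaurent a).toLinearMap (chartLaurent_mem a)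
  have hφ : ∀ p ∈ (J.chartIdeal a).restrictScalars ℂ, φ p = 0 := fun p hp =>
    (subquot_mk_eq_zero _).2 hp
  have hs : Function.Surjective φ := by
    intro y
    obtain ⟨g, rfl⟩ := Submodule.Quotient.mk_surjective _ y
    obtain ⟨p, hp⟩ := exists_chartLaurent_eq g.2
    refine ⟨p, ?_⟩
    change Submodule.Quotient.mk _ = _
    congr 1
    exact Subtype.ext hp
  have : Module.Finite ℂ (MvPolynomial (Fin 2) ℂ ⧸ (J.chartIdeal a).restrictScalars ℂ) := this
  refine .of_surjective (((J.chartIdeal a).restrictScalars ℂ).liftQ φ hφ) fun y => ?_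
  obtain ⟨p, hp⟩ := hs y
  exact ⟨Submodule.Quotient.mk p, hp⟩

end IdealSystem

/-! ### Quotients of finite length -/

namespace IdealSystem

variable {J : IdealSystem}

lemma mono_singleton {T : Finset ChartIdx} {a : ChartIdx} (ha : a ∈ T) : J.J {a} ≤ J.J T :=
  J.mono (Finset.singleton_nonempty a) (Finset.singleton_subset_iff.2 ha)

lemma regular_mono {T T' : Finset ChartIdx} (h : T ⊆ T') : regular T ≤ regular T' :=
  supp_mono (cone_mono h)

/-- In a quotient of finite length the images of the powers of a monomial `mon u` become stationary,
so that `mon u` has an inverse up to torsion by its powers. -/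
lemma exists_inverse {a : ChartIdx} (hfin : Module.Finite ℂ (Subquot (regular {a}) (J.J {a})))
    {u : ℤ × ℤ} (hu : u ∈ cone {a}) :
    ∃ (k : ℕ) (w : Laurent), w ∈ regular {a} ∧ mon (k • u) * (1 - mon u * w) ∈ J.J {a} := by
  let φ : Module.End ℂ (Subquot (regular {a}) (J.J {a})) :=
    subquotMap (LinearMap.mulLeft ℂ (mon u)) (fun g hg => mul_mem_regular (mon_mem_supp hu) hg)
      (fun g _ hg => J.mul_mem (Finset.singleton_nonempty a) (mon_mem_supp hu) hg)
  have hpow : ∀ (k : ℕ) (g : Laurent) (hg : g ∈ regular {a}),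
      (φ ^ k) (Submodule.Quotient.mk ⟨g, hg⟩) = Submodule.Quotient.mk ⟨mon (k • u) * g,
        mul_mem_regular (mon_mem_supp (nsmul_mem_cone hu k)) hg⟩ := by
    intro k g hg
    induction k with
    | zero =>
      simp only [zero_smul, mon_zero, one_mul, pow_zero]
      rfl
    | succ k ih =>
      rw [pow_succ', Module.End.mul_apply, ih]
      change Submodule.Quotient.mk _ = _
      congr 1
      ext1
      change mon u * (mon (k • u) * g) = mon ((k + 1) • u) * g
      rw [← mul_assoc, ← mon_add, succ_nsmul']
  obtain ⟨k, hk⟩ := IsArtinian.monotone_stabilizes (R := ℂ) (M := Subquot (regular {a}) (J.J {a}))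
    ⟨fun k => OrderDual.toDual (LinearMap.range (φ ^ k)), fun i j hij => by
      obtain ⟨c, rfl⟩ := Nat.exists_eq_add_of_le hij
      rintro _ ⟨x, rfl⟩
      exact ⟨(φ ^ c) x, by rw [pow_add]; rfl⟩⟩
  have h1 : (φ ^ k) (Submodule.Quotient.mk ⟨1, one_mem_regular {a}⟩) ∈
      LinearMap.range (φ ^ (k + 1)) := by
    have := hk (k + 1) k.le_succ
    have h2 : LinearMap.range (φ ^ k) = LinearMap.range (φ ^ (k + 1)) := this
    rw [← h2]
    exact ⟨_, rfl⟩
  obtain ⟨y, hy⟩ := h1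
  obtain ⟨⟨w, hw⟩, rfl⟩ := Submodule.Quotient.mk_surjective _ y
  rw [hpow, hpow, eq_comm, ← sub_eq_zero, ← Submodule.Quotient.mk_sub, subquot_mk_eq_zero] at hy
  refine ⟨k, w, hw, ?_⟩
  have h3 : mon (k • u) * 1 - mon ((k + 1) • u) * w = mon (k • u) * (1 - mon u * w) := by
    rw [succ_nsmul, mon_add]
    ring
  rw [← h3]
  exact hy

/-- A monomial that is invertible on an intersection of charts has an inverse modulo `J` that is
already regular on the chart. -/
lemma exists_inverse' {a : ChartIdx} (hfin : Module.Finite ℂ (Subquot (regular {a}) (J.J {a})))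
    {u : ℤ × ℤ} (hu : u ∈ cone {a}) {T : Finset ChartIdx} (ha : a ∈ T) (hu' : -u ∈ cone T) :
    ∃ w ∈ regular {a}, 1 - mon u * w ∈ J.J T := by
  obtain ⟨k, w, hw, h⟩ := exists_inverse hfin hu
  refine ⟨w, hw, ?_⟩
  have h1 := J.mul_mem ⟨a, ha⟩ (mon_mem_supp (nsmul_mem_cone hu' k)) (mono_singleton ha h)
  rwa [← mul_assoc, smul_neg, mon_neg_mul_mon, one_mul] at h1

/-- A quotient of finite length has no more sections on a smaller open set. -/
lemma exists_sub_mem {a : ChartIdx} (hfin : Module.Finite ℂ (Subquot (regular {a}) (J.J {a})))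
    {T : Finset ChartIdx} (ha : a ∈ T) {g : Laurent} (hg : g ∈ regular T) :
    ∃ q ∈ regular {a}, g - q ∈ J.J T := by
  obtain ⟨u, hu, hu', h⟩ := exists_mem_cone_neg_mem_cone ha hg
  obtain ⟨w, hw, hw'⟩ := exists_inverse' hfin hu ha hu'
  refine ⟨w * (mon u * g), mul_mem_regular hw h, ?_⟩
  have := J.mul_mem ⟨a, ha⟩ hg hw'
  convert this using 1
  ring

/-- The restriction to a smaller open set, on quotients of finite length. -/
lemma restrict_finite {a : ChartIdx} (hfin : Module.Finite ℂ (Subquot (regular {a}) (J.J {a})))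
    {T : Finset ChartIdx} (ha : a ∈ T) :
    Module.Finite ℂ (Subquot (regular T) (J.J T)) ∧
      Module.finrank ℂ (Subquot (regular {a}) (J.J {a})) =
        Module.finrank ℂ (Subquot (J.J T ⊓ regular {a} : Submodule ℂ Laurent) (J.J {a})) +
        Module.finrank ℂ (Subquot (regular T) (J.J T)) := by
  have hle : J.J {a} ≤ J.J T ⊓ regular {a} :=
    le_inf (mono_singleton ha) (J.le_regular (Finset.singleton_nonempty a))
  obtain ⟨h1, h2, h3⟩ := subquot_finite_and_finrank hle inf_le_right hfin
  have E : Subquot (regular {a}) (J.J T ⊓ regular {a} : Submodule ℂ Laurent) ≃ₗ[ℂ]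
      Subquot (regular T) (J.J T) := LinearEquiv.ofBijective
    (subquotMap (A := regular {a}) (B := J.J T ⊓ regular {a}) LinearMap.id
      (fun g hg => regular_mono (Finset.singleton_subset_iff.2 ha) hg) (fun g _ hg => hg.1))
    ⟨subquotMap_injective _ _ _ fun g hg hg' => ⟨hg', hg⟩,
      subquotMap_surjective _ _ _ fun g hg => exists_sub_mem hfin ha hg⟩
  exact ⟨.equiv E, by rw [h3, E.finrank_eq]⟩

/-- The colength of an ideal system over the intersection of the charts of `T`. -/
def colength (J : IdealSystem) (T : Finset ChartIdx) : ℕ :=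
  Module.finrank ℂ (Subquot (regular T) (J.J T))

/-- The Euler characteristic of the quotient of the structure sheaf by an ideal of finite
colength. -/
def length (J : IdealSystem) : ℤ :=
  ∑ T ∈ Finset.univ.filter Finset.Nonempty, (-1) ^ (T.card + 1) * (J.colength T : ℤ)

/-- An ideal system depends only on the ring of functions on the intersection of charts. -/
lemma eq_of_cone_eq {T T' : Finset ChartIdx} (hT : T.Nonempty) (h : T ⊆ T')
    (hc : cone T = cone T') : J.J T = J.J T' := by
  refine le_antisymm (J.mono hT h) fun g hg => ?_
  obtain ⟨a, ha⟩ := hT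
  obtain ⟨u, hu, hu', h1⟩ := J.loc (h ha) hg
  have h2 := J.mul_mem ⟨a, ha⟩ (mon_mem_supp (by rwa [hc])) (mono_singleton ha h1)
  rwa [← mul_assoc, mon_neg_mul_mon, one_mul] at h2

/-- If `T` meets both lines in both directions, the intersection of its charts is that of all
charts. -/
lemma colength_eq_univ {T : Finset ChartIdx} (h : (∃ a ∈ T, a.fst = 0) ∧ (∃ a ∈ T, a.fst = 1) ∧
    (∃ a ∈ T, a.snd = 0) ∧ ∃ a ∈ T, a.snd = 1) : J.colength T = J.colength Finset.univ := by
  have hc : cone T = cone Finset.univ := by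
    have key : ∀ T : Finset ChartIdx, ((∃ a ∈ T, a.fst = 0) ∧ (∃ a ∈ T, a.fst = 1) ∧
        (∃ a ∈ T, a.snd = 0) ∧ ∃ a ∈ T, a.snd = 1) → cone T = Set.univ := by
      rintro T ⟨⟨a, ha, ha'⟩, ⟨b, hb, hb'⟩, ⟨c, hc, hc'⟩, ⟨d, hd, hd'⟩⟩
      rw [Set.eq_univ_iff_forall]
      refine fun e => ⟨fun h => ?_, fun h => ?_, fun h => ?_, fun h => ?_⟩
      · simp [h b hb] at hb'
      · simp [h a ha] at ha'
      · simp [h d hd] at hd'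
      · simp [h c hc] at hc'
    rw [key T h, key]
    exact ⟨⟨toLex (0, 0), by simp, rfl⟩, ⟨toLex (1, 0), by simp, rfl⟩, ⟨toLex (0, 0), by simp, rfl⟩,
      ⟨toLex (0, 1), by simp, rfl⟩⟩
  obtain ⟨⟨a, ha, -⟩, -⟩ := h
  rw [colength, colength, regular, hc, eq_of_cone_eq ⟨a, ha⟩ (Finset.subset_univ T) hc]

/-- The length is an alternating sum over the four charts, the four intersections of adjacent charts
and the intersection of all charts. The terms are arranged around the chart `(i, j)`. -/
lemma length_eq (J : IdealSystem) (i j : Fin 2) : J.length =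
    J.colength {toLex (i, j)} + J.colength {toLex (i + 1, j)} + J.colength {toLex (i, j + 1)} +
    J.colength {toLex (i + 1, j + 1)} - J.colength {toLex (i + 1, j), toLex (i, j)} -
    J.colength {toLex (i + 1, j + 1), toLex (i, j + 1)} -
    J.colength {toLex (i, j + 1), toLex (i, j)} -
    J.colength {toLex (i + 1, j), toLex (i + 1, j + 1)} + J.colength Finset.univ := by
  have huniv : (Finset.univ.filter Finset.Nonempty : Finset (Finset ChartIdx)) =
    {{toLex (0, 0)}, {toLex (0, 1)}, {toLex (1, 0)}, {toLex (1, 1)},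
      {toLex (0, 0), toLex (0, 1)}, {toLex (0, 0), toLex (1, 0)}, {toLex (0, 1), toLex (1, 1)},
      {toLex (1, 0), toLex (1, 1)}, {toLex (0, 0), toLex (1, 1)}, {toLex (0, 1), toLex (1, 0)},
      {toLex (0, 0), toLex (0, 1), toLex (1, 0)}, {toLex (0, 0), toLex (0, 1), toLex (1, 1)},
      {toLex (0, 0), toLex (1, 0), toLex (1, 1)}, {toLex (0, 1), toLex (1, 0), toLex (1, 1)},
      Finset.univ} := by decide
  have h1 : J.colength {toLex (0, 0), toLex (1, 1)} = J.colength Finset.univ :=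
    colength_eq_univ (by decide)
  have h2 : J.colength {toLex (0, 1), toLex (1, 0)} = J.colength Finset.univ :=
    colength_eq_univ (by decide)
  have h3 : J.colength {toLex (0, 0), toLex (0, 1), toLex (1, 0)} = J.colength Finset.univ :=
    colength_eq_univ (by decide)
  have h4 : J.colength {toLex (0, 0), toLex (0, 1), toLex (1, 1)} = J.colength Finset.univ :=
    colength_eq_univ (by decide)
  have h5 : J.colength {toLex (0, 0), toLex (1, 0), toLex (1, 1)} = J.colength Finset.univ :=
    colength_eq_univ (by decide)
  have h6 : J.colength {toLex (0, 1), toLex (1, 0), toLex (1, 1)} = J.colength Finset.univ :=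
    colength_eq_univ (by decide)
  rw [length, huniv]
  repeat rw [Finset.sum_insert (by decide)]
  rw [Finset.sum_singleton, h1, h2, h3, h4, h5, h6]
  have c1 : ∀ a : ChartIdx, (-1 : ℤ) ^ (Finset.card {a} + 1) = 1 := by simp
  have c2 : ∀ a b : ChartIdx, a ≠ b → (-1 : ℤ) ^ (Finset.card {a, b} + 1) = -1 := by
    intro a b h
    rw [Finset.card_pair h]; norm_num
  have c3 : ∀ a b c : ChartIdx, a ≠ b ∧ a ≠ c ∧ b ≠ c →
      (-1 : ℤ) ^ (Finset.card {a, b, c} + 1) = 1 := by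
    intro a b c h
    rw [Finset.card_eq_three.2 ⟨a, b, c, h.1, h.2.1, h.2.2, rfl⟩]; norm_num
  have c4 : (-1 : ℤ) ^ ((Finset.univ : Finset ChartIdx).card + 1) = -1 := by decide
  simp only [c1, c4]
  rw [c2 _ _ (by decide), c2 _ _ (by decide), c2 _ _ (by decide), c2 _ _ (by decide),
    c2 _ _ (by decide), c2 _ _ (by decide), c3 _ _ _ (by decide), c3 _ _ _ (by decide),
    c3 _ _ _ (by decide), c3 _ _ _ (by decide)]
  have p1 := Finset.pair_comm (toLex (0, 0) : ChartIdx) (toLex (0, 1))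
  have p2 := Finset.pair_comm (toLex (0, 0) : ChartIdx) (toLex (1, 0))
  have p3 := Finset.pair_comm (toLex (0, 1) : ChartIdx) (toLex (1, 1))
  have p4 := Finset.pair_comm (toLex (1, 0) : ChartIdx) (toLex (1, 1))
  have e0 : (0 : Fin 2) + 1 = 1 := rfl
  have e1 : (1 : Fin 2) + 1 = 0 := rfl
  have hi : ∀ i : Fin 2, i = 0 ∨ i = 1 := by decide
  rcases hi i with rfl | rfl <;> rcases hi j with rfl | rfl <;>
  simp only [e0, e1, p1, p2, p3, p4] <;>
  ring

/-- The Euler characteristic of a quotient of finite length is at least the number of its sections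
over each chart. By `length_eq`, the difference is a sum of dimensions of kernels of restriction
maps, except for one that is subtracted and is compensated by one of the others. -/
lemma colength_le_length (hfin : ∀ a, Module.Finite ℂ (Subquot (regular {a}) (J.J {a})))
    (a : ChartIdx) : (J.colength {a} : ℤ) ≤ J.length := by
  obtain ⟨i, j, rfl⟩ : ∃ i j, a = toLex (i, j) := ⟨a.fst, a.snd, rfl⟩
  rw [length_eq J i j]
  set a : ChartIdx := toLex (i, j)
  set b : ChartIdx := toLex (i + 1, j)
  set c : ChartIdx := toLex (i, j + 1)
  set e : ChartIdx := toLex (i + 1, j + 1)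
  have h1 := (restrict_finite (hfin c) (T := {c, a}) (by simp)).2
  have h2 := (restrict_finite (hfin e) (T := {e, c}) (by simp)).2
  have h3 := (restrict_finite (hfin b) (T := {b, a}) (by simp)).2
  have hbe := (restrict_finite (hfin b) (T := {b, e}) (by simp)).1
  have hle : J.J {b, e} ≤ J.J Finset.univ := J.mono ⟨b, by simp⟩ (Finset.subset_univ _)
  have hreg : J.J {b, e} ≤ regular {b, e} := J.le_regular ⟨b, by simp⟩
  obtain ⟨-, h4fin, h4⟩ := subquot_finite_and_finrank (le_inf hle hreg)
    (inf_le_right : J.J Finset.univ ⊓ regular {b, e} ≤ regular {b, e}) hbe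
  have E : Subquot (regular {b, e}) (J.J Finset.univ ⊓ regular {b, e} : Submodule ℂ Laurent) ≃ₗ[ℂ]
      Subquot (regular Finset.univ) (J.J Finset.univ) := LinearEquiv.ofBijective
    (subquotMap (A := regular {b, e}) (B := J.J Finset.univ ⊓ regular {b, e}) LinearMap.id
      (fun g hg => regular_mono (Finset.subset_univ _) hg) (fun g _ hg => hg.1))
    ⟨subquotMap_injective _ _ _ fun g hg hg' => ⟨hg', hg⟩,
      subquotMap_surjective _ _ _ fun g hg => by
        obtain ⟨q, hq, h⟩ := exists_sub_mem (hfin b) (Finset.mem_univ b) hg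
        exact ⟨q, regular_mono (by simp) hq, h⟩⟩
  rw [E.finrank_eq] at h4
  -- Restriction maps the sections supported off the chart `a` onto such sections over `{b, e}`.
  have hker : Module.finrank ℂ (Subquot (J.J Finset.univ ⊓ regular {b, e} : Submodule ℂ Laurent)
      (J.J {b, e})) ≤
      Module.finrank ℂ (Subquot (J.J {b, a} ⊓ regular {b} : Submodule ℂ Laurent) (J.J {b})) := by
    have hfin' : Module.Finite ℂ
        (Subquot (J.J {b, a} ⊓ regular {b} : Submodule ℂ Laurent) (J.J {b})) :=
      (subquot_finite_and_finrank (le_inf (mono_singleton (by simp))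
        (J.le_regular (Finset.singleton_nonempty b))) inf_le_right (hfin b)).2.1
    refine LinearMap.finrank_le_finrank_of_surjective (f := subquotMap LinearMap.id
      (fun g hg => ⟨J.mono ⟨b, by simp⟩ (Finset.subset_univ _) hg.1,
        regular_mono (by simp) hg.2⟩) (fun g _ hg => mono_singleton (by simp) hg))
      (subquotMap_surjective _ _ _ ?_)
    rintro y ⟨hy, hy'⟩
    obtain ⟨y', hy1, hy2⟩ := exists_sub_mem (hfin b) (T := {b, e}) (by simp) hy'
    have hy3 : y' ∈ J.J Finset.univ := by
      have := sub_mem hy (hle hy2)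
      rwa [sub_sub_cancel] at this
    obtain ⟨u, hu, -, h⟩ := J.loc (Finset.mem_univ b) hy3
    rw [mem_cone_singleton] at hu
    have hbf : b.fst = i + 1 := rfl
    have hbs : b.snd = j := rfl
    have haf : a.fst = i := rfl
    have has : a.snd = j := rfl
    have hef : e.fst = i + 1 := rfl
    have hes : e.snd = j + 1 := rfl
    have hne : ∀ i : Fin 2, i = 0 → i + 1 = 0 → False := by decide
    have hne' : ∀ i : Fin 2, i = 1 → i + 1 = 1 → False := by decide
    have hx : (u.1, 0) ∈ cone {b} := mem_cone_singleton.2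
      ⟨hu.1, hu.2.1, fun _ => le_rfl, fun _ => le_rfl⟩
    have hz : ((0, u.2) : ℤ × ℤ) ∈ cone {b} := mem_cone_singleton.2
      ⟨fun _ => le_rfl, fun _ => le_rfl, hu.2.2⟩
    have hx' : -((u.1, 0) : ℤ × ℤ) ∈ cone {b, a} :=
      ⟨fun h => (hne _ (h a (by simp)) (h b (by simp))).elim,
        fun h => (hne' _ (h a (by simp)) (h b (by simp))).elim, fun _ => by simp, fun _ => by simp⟩
    have hz' : -((0, u.2) : ℤ × ℤ) ∈ cone {b, e} :=
      ⟨fun _ => by simp, fun _ => by simp, fun h => (hne _ (h b (by simp)) (h e (by simp))).elim,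
        fun h => (hne' _ (h b (by simp)) (h e (by simp))).elim⟩
    obtain ⟨w, hw, hw'⟩ := exists_inverse' (hfin b) hz (T := {b, e}) (by simp) hz'
    refine ⟨mon (0, u.2) * w * y', ⟨?_, mul_mem_regular (mul_mem_regular (mon_mem_supp hz) hw) hy1⟩,
      ?_⟩
    · have h5 := mono_singleton (T := {b, a}) (by simp)
        (J.mul_mem (Finset.singleton_nonempty b) hw h)
      have h6 := J.mul_mem ⟨b, by simp⟩ (mon_mem_supp hx') h5
      have h7 : mon u = mon (u.1, 0) * mon (0, u.2) := by
        rw [← mon_add]; simp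
      have h8 := mon_neg_mul_mon (u.1, 0)
      have h9 : mon (-((u.1, 0) : ℤ × ℤ)) * (w * (mon u * y')) = mon (0, u.2) * w * y' := by
        rw [h7]
        linear_combination (w * mon (0, u.2) * y') * h8
      rw [h9] at h6
      exact h6
    · have h5 := J.mul_mem ⟨b, by simp⟩ (regular_mono (by simp) hy1) hw'
      convert add_mem hy2 h5 using 1
      rw [LinearMap.id_apply]
      ring
  simp only [colength]
  omega

end IdealSystem

/-! ### Common divisors and Hilbert polynomials of ideals -/

lemma mem_cone_singleton' {a : ChartIdx} {e : ℤ × ℤ} :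
    e ∈ cone {a} ↔ 0 ≤ dir a.fst * e.1 ∧ 0 ≤ dir a.snd * e.2 := by
  have key : ∀ (i : Fin 2) (x : ℤ), ((i = 0 → 0 ≤ x) ∧ (i = 1 → x ≤ 0)) ↔ 0 ≤ dir i * x := by
    intro i x
    fin_cases i <;> simp [dir]
  rw [mem_cone_singleton, ← and_assoc, key, key]

lemma dir_of_ne {i j : Fin 2} (h : i ≠ j) : dir j = -dir i := by
  revert i j; decide

lemma sub_of_ne {i j : Fin 2} (h : i ≠ j) : (((j : ℕ) : ℤ) - ((i : ℕ) : ℤ)) = dir i := by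
  revert i j; decide

lemma tau_zero (a : ChartIdx) : tau 0 0 a = 0 := by simp [tau]

/-- The bidegree of a non-zero global section of `𝒪(s, r)` is non-negative. -/
lemma nonneg_of_regular {h : Laurent} {s r : ℤ} (h0 : h ≠ 0)
    (H : ∀ a, mon (tau s r a) * h ∈ regular {a}) : 0 ≤ s ∧ 0 ≤ r := by
  obtain ⟨e, he⟩ : ∃ e, h.coeff e ≠ 0 := by
    by_contra hc
    push Not at hc
    exact h0 (by ext e; exact hc e)
  have h1 := mem_supp_iff_support.1 (mon_mul_mem_supp.1 (H (toLex (0, 0)))) e he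
  have h2 := mem_supp_iff_support.1 (mon_mul_mem_supp.1 (H (toLex (1, 1)))) e he
  have h1' := mem_cone_singleton'.1 h1
  have h2' := mem_cone_singleton'.1 h2
  simp [tau, dir, ChartIdx.fst, ChartIdx.snd] at h1' h2'
  omega

/-- A global function is constant. -/
lemma exists_eq_const {h : Laurent} (H : ∀ a, mon (tau 0 0 a) * h ∈ regular {a}) :
    ∃ c : ℂ, h = AddMonoidAlgebra.single 0 c := by
  refine ⟨h.coeff 0, ?_⟩
  ext e
  rw [AddMonoidAlgebra.coeff_single, Finsupp.single_apply]
  split_ifs with he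
  · rw [he]
  · by_contra hc
    apply he
    have h1 := mem_supp_iff_support.1 (mon_mul_mem_supp.1 (H (toLex (0, 0)))) e hc
    have h2 := mem_supp_iff_support.1 (mon_mul_mem_supp.1 (H (toLex (1, 1)))) e hc
    have h1' := mem_cone_singleton'.1 h1
    have h2' := mem_cone_singleton'.1 h2
    simp [tau, dir, ChartIdx.fst, ChartIdx.snd] at h1' h2'
    ext <;> simp <;> omega

namespace IdealSystem

/-- A divisor of the quotient by a divisor yields a divisor whose bidegree is the sum. -/
lemma Divides.mul {h h' : Laurent} {s r s' r' : ℤ} {J : IdealSystem} (H : Divides h s r J)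
    (H' : Divides h' s' r' H.quot) : Divides (h * h') (s + s') (r + r') J where
  ne_zero := mul_ne_zero H.ne_zero H'.ne_zero
  regular a := by
    have := mul_mem_regular (H.regular a) (H'.regular a)
    rw [tau_add, mon_add]
    convert this using 1
    ring
  exists_eq a g hg := by
    obtain ⟨q, hq, rfl⟩ := H.exists_eq a g hg
    obtain ⟨q', hq', rfl⟩ := H'.exists_eq a q ((H.mem_quot (Finset.mem_singleton_self a)).2 hg)
    refine ⟨q', hq', ?_⟩
    rw [tau_add, mon_add]
    ring

/-- A common prime divisor of an ideal system over one chart extends to all charts: its zero locus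
in the chart is closed up to a curve, whose bidegree is formed by the degrees of the prime
polynomial in the two coordinates of the chart. -/
lemma exists_divides_of_dvd {J : IdealSystem} {a : ChartIdx} {p : MvPolynomial (Fin 2) ℂ}
    (hp : Prime p) (hdvd : ∀ g ∈ J.chartIdeal a, p ∣ g) :
    ∃ (h : Laurent) (s r : ℤ), Divides h s r J ∧ 0 < s + r := by
  set P := chartLaurent a p with hPdef
  have hP0 : P ≠ 0 := fun h => hp.ne_zero (chartLaurent_injective a (by rw [map_zero, ← h]))
  have hPreg : P ∈ regular {a} := chartLaurent_mem a p
  have hsupp : P.coeff.support.Nonempty := by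
    rw [Finset.nonempty_iff_ne_empty, Ne, Finsupp.support_eq_empty]
    exact fun h => hP0 (by ext e; rw [h]; rfl)
  obtain ⟨e₁, he₁, hmax₁⟩ := Finset.exists_max_image P.coeff.support
    (fun e => dir a.fst * e.1) hsupp
  obtain ⟨e₂, he₂, hmax₂⟩ := Finset.exists_max_image P.coeff.support
    (fun e => dir a.snd * e.2) hsupp
  -- The degrees of `p` in the two coordinates of the chart.
  set σ := dir a.fst * e₁.1
  set ρ := dir a.snd * e₂.2
  have hcone := mem_supp_iff_support.1 hPreg
  have hσ : 0 ≤ σ := (mem_cone_singleton'.1 (hcone e₁ (Finsupp.mem_support_iff.1 he₁))).1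
  have hρ : 0 ≤ ρ := (mem_cone_singleton'.1 (hcone e₂ (Finsupp.mem_support_iff.1 he₂))).2
  refine ⟨mon (-(tau σ ρ a)) * P, σ, ρ, ⟨mul_ne_zero (mon_ne_zero _) hP0, fun b => ?_,
    fun b g hg => ?_⟩, ?_⟩
  · rw [← mul_assoc, ← mon_add, mon_mul_mem_supp, mem_supp_iff_support]
    intro e he
    have h1 := mem_cone_singleton'.1 (hcone e he)
    have h2 := hmax₁ e (Finsupp.mem_support_iff.2 he)
    have h3 := hmax₂ e (Finsupp.mem_support_iff.2 he)
    change _ ∈ cone {b}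
    rw [mem_cone_singleton']
    constructor
    · by_cases hab : a.fst = b.fst
      · simp [tau, ← hab]
        exact h1.1
      · have hd := dir_of_ne hab
        have hs := sub_of_ne hab
        have : (e + (tau σ ρ b + -tau σ ρ a)).1 = e.1 - σ * dir a.fst := by
          simp [tau, ← hs]; ring
        rw [this, hd]
        have h4 := dir_mul_self a.fst
        have : -dir a.fst * (e.1 - σ * dir a.fst) = σ - dir a.fst * e.1 := by
          linear_combination σ * h4
        rw [this]
        exact sub_nonneg.2 h2
    · by_cases hab : a.snd = b.snd
      · simp [tau, ← hab]
        exact h1.2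
      · have hd := dir_of_ne hab
        have hs := sub_of_ne hab
        have : (e + (tau σ ρ b + -tau σ ρ a)).2 = e.2 - ρ * dir a.snd := by
          simp [tau, ← hs]; ring
        rw [this, hd]
        have h4 := dir_mul_self a.snd
        have : -dir a.snd * (e.2 - ρ * dir a.snd) = ρ - dir a.snd * e.2 := by
          linear_combination ρ * h4
        rw [this]
        exact sub_nonneg.2 h3
  -- On another chart `b`, the quotient of `g` by the section is regular on the intersection of the
  -- two charts. That its exponents belong to the cone of `b` follows by comparison of the lowest
  -- terms in each direction in which the charts differ.
  · have hgb := J.le_regular (Finset.singleton_nonempty b) hg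
    obtain ⟨u, hu, hu', hug⟩ := J.loc (T := {a, b}) (a := a) (by simp)
      (mono_singleton (by simp) hg)
    obtain ⟨g', hg'⟩ := exists_chartLaurent_eq (J.le_regular (Finset.singleton_nonempty a) hug)
    obtain ⟨q', rfl⟩ := hdvd g' (by change chartLaurent a g' ∈ J.J {a}; rwa [hg'])
    rw [map_mul, ← hPdef] at hg'
    set q := mon (-u) * chartLaurent a q'
    have hq : q ∈ BiProj.regular {a, b} := mul_mem_regular (mon_mem_supp hu')
      (regular_mono (by simp) (chartLaurent_mem a q'))
    have hgq : P * q = g := by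
      have := congrArg (fun x => mon (-u) * x) hg'
      simp only [← mul_assoc, mon_neg_mul_mon, one_mul] at this
      rw [← this]
      ring
    refine ⟨mon (tau σ ρ a - tau σ ρ b) * q, ?_, ?_⟩
    swap
    · rw [← hgq]
      have h1 := mon_mul_mon_neg (tau σ ρ a)
      have h2 := mon_mul_mon_neg (tau σ ρ b)
      rw [sub_eq_add_neg, mon_add]
      linear_combination (-P * q * mon (tau σ ρ a) * mon (-tau σ ρ a)) * h2 - P * q * h1
    rw [mon_mul_mem_supp, mem_supp_iff_support]
    intro e he
    have hqe := mem_supp_iff_support.1 hq e he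
    change _ ∈ cone {b}
    rw [mem_cone_singleton']
    have hgb' := mem_supp_iff_support.1 hgb
    constructor
    · by_cases hab : a.fst = b.fst
      · simp [tau, ← hab]
        have hall : ∀ c ∈ ({a, b} : Finset ChartIdx), c.fst = a.fst := by
          simp [hab]
        have h0 : ∀ i : Fin 2, i = 0 ∨ i = 1 := by decide
        rcases h0 a.fst with h | h
        · have := hqe.1 (fun c hc => by rw [hall c hc, h])
          simpa [h, dir] using this
        · have := hqe.2.1 (fun c hc => by rw [hall c hc, h])
          simpa [h, dir] using this
      · have hd := dir_of_ne hab
        have hs := sub_of_ne hab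
        have h4 := dir_mul_self a.fst
        let l : ℤ × ℤ →+ ℤ := (AddMonoidHom.mulLeft (-dir a.fst)).comp (AddMonoidHom.fst ℤ ℤ)
        have key : q ∈ supp {e | σ ≤ l e} := by
          refine mem_supp_of_mul_mem_supp (l := l) (c := -σ) (p := P)
            (mem_supp_iff_support.2 fun e he => ?_) ⟨e₁, Finsupp.mem_support_iff.1 he₁, ?_⟩
            (mem_supp_iff_support.2 fun e he => ?_)
          · have := hmax₁ e (Finsupp.mem_support_iff.2 he)
            change -σ ≤ -dir a.fst * e.1
            linarith
          · change -dir a.fst * e₁.1 = -σ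
            simp [σ]
          · rw [hgq] at he
            have := (mem_cone_singleton'.1 (hgb' e he)).1
            rw [hd] at this
            change -σ + σ ≤ -dir a.fst * e.1
            linarith
        have h5 : σ ≤ -dir a.fst * e.1 := mem_supp_iff_support.1 key e he
        have : (e + (tau σ ρ a - tau σ ρ b)).1 = e.1 + σ * dir a.fst := by
          simp [tau, ← hs]; ring
        rw [this, hd]
        have : -dir a.fst * (e.1 + σ * dir a.fst) = -dir a.fst * e.1 - σ := by
          linear_combination -σ * h4
        rw [this]
        exact sub_nonneg.2 h5
    · by_cases hab : a.snd = b.snd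
      · simp [tau, ← hab]
        have hall : ∀ c ∈ ({a, b} : Finset ChartIdx), c.snd = a.snd := by
          simp [hab]
        have h0 : ∀ i : Fin 2, i = 0 ∨ i = 1 := by decide
        rcases h0 a.snd with h | h
        · have := hqe.2.2.1 (fun c hc => by rw [hall c hc, h])
          simpa [h, dir] using this
        · have := hqe.2.2.2 (fun c hc => by rw [hall c hc, h])
          simpa [h, dir] using this
      · have hd := dir_of_ne hab
        have hs := sub_of_ne hab
        have h4 := dir_mul_self a.snd
        let l : ℤ × ℤ →+ ℤ := (AddMonoidHom.mulLeft (-dir a.snd)).comp (AddMonoidHom.snd ℤ ℤ)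
        have key : q ∈ supp {e | ρ ≤ l e} := by
          refine mem_supp_of_mul_mem_supp (l := l) (c := -ρ) (p := P)
            (mem_supp_iff_support.2 fun e he => ?_) ⟨e₂, Finsupp.mem_support_iff.1 he₂, ?_⟩
            (mem_supp_iff_support.2 fun e he => ?_)
          · have := hmax₂ e (Finsupp.mem_support_iff.2 he)
            change -ρ ≤ -dir a.snd * e.2
            linarith
          · change -dir a.snd * e₂.2 = -ρ
            simp [ρ]
          · rw [hgq] at he
            have := (mem_cone_singleton'.1 (hgb' e he)).2
            rw [hd] at this
            change -ρ + ρ ≤ -dir a.snd * e.2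
            linarith
        have h5 : ρ ≤ -dir a.snd * e.2 := mem_supp_iff_support.1 key e he
        have : (e + (tau σ ρ a - tau σ ρ b)).2 = e.2 + ρ * dir a.snd := by
          simp [tau, ← hs]; ring
        rw [this, hd]
        have : -dir a.snd * (e.2 + ρ * dir a.snd) = -dir a.snd * e.2 - ρ := by
          linear_combination -ρ * h4
        rw [this]
        exact sub_nonneg.2 h5
  -- If both degrees vanished, `p` would be constant.
  · by_contra hneg
    have hσ0 : σ = 0 := by omega
    have hρ0 : ρ = 0 := by omega
    apply hp.not_isUnit
    have hC : p = MvPolynomial.C (p.coeff 0) := by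
      ext m
      rw [MvPolynomial.coeff_C]
      split_ifs with hm
      · rw [hm]
      · by_contra hc
        apply hm
        have h1 : chartExp a m ∈ P.coeff.support := by
          rw [Finsupp.mem_support_iff, hPdef, coeff_chartLaurent]
          exact hc
        have h2 := hmax₁ _ h1
        have h3 := hmax₂ _ h1
        have h4 : dir a.fst * (dir a.fst * m 0) ≤ σ := h2
        have h5 : dir a.snd * (dir a.snd * m 1) ≤ ρ := h3
        rw [← mul_assoc, dir_mul_self, one_mul, hσ0] at h4
        rw [← mul_assoc, dir_mul_self, one_mul, hρ0] at h5
        ext i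
        fin_cases i
        · change 0 = m 0
          omega
        · change 0 = m 1
          omega
    rw [hC] at hp ⊢
    refine (Ne.isUnit ?_).map MvPolynomial.C
    intro h
    rw [h, MvPolynomial.C_0] at hp
    exact hp.ne_zero rfl

/-- An ideal system that contains the equation of a curve has a greatest common divisor, and the
quotient by it has finite colength. A divisor of greatest total degree does it; the total degree of
a divisor is bounded by that of the curve. -/
lemma exists_divides_finite {J : IdealSystem} {f : Laurent} {s r : ℤ} (hf : f ≠ 0)
    (hJ : ∀ a, mon (tau s r a) * f ∈ J.J {a}) :
    ∃ (h : Laurent) (s' r' : ℤ) (H : Divides h s' r' J),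
      ∀ a, Module.Finite ℂ (Subquot (regular {a}) (H.quot.J {a})) := by
  obtain ⟨N, ⟨h, s', r', H, hN⟩, hmax⟩ := Int.exists_greatest_of_bdd
    (P := fun N => ∃ (h : Laurent) (s' r' : ℤ), Divides h s' r' J ∧ s' + r' = N)
    ⟨s + r, by
      rintro _ ⟨h, s', r', H, rfl⟩
      have hdiv : ∀ a, ∃ q ∈ BiProj.regular {a},
          mon (tau s r a) * f = mon (tau s' r' a) * h * q := fun a => H.exists_eq a _ (hJ a)
      obtain ⟨f', hf', h0⟩ := hdiv (toLex (0, 0))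
      have ht : ∀ m n, tau m n (toLex (0, 0)) = 0 := fun m n => by
        simp [tau, ChartIdx.fst, ChartIdx.snd]
      rw [ht, ht, mon_zero, one_mul, one_mul] at h0
      have hreg : ∀ a, mon (tau (s - s') (r - r') a) * f' ∈ BiProj.regular {a} := by
        intro a
        obtain ⟨q, hq, h1⟩ := hdiv a
        convert hq using 1
        have h2 : tau s r a = tau s' r' a + tau (s - s') (r - r') a := by
          rw [← tau_add]; simp
        rw [h0, h2, mon_add] at h1
        refine mul_left_cancel₀ (mul_ne_zero (mon_ne_zero (tau s' r' a)) H.ne_zero) ?_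
        rw [← h1]
        ring
      have := nonneg_of_regular (by rintro rfl; exact hf (by rw [h0, mul_zero])) hreg
      omega⟩
    ⟨0, 1, 0, 0, ⟨one_ne_zero,
      fun a => by rw [tau_zero, mon_zero, one_mul]; exact one_mem_regular _,
      fun a g hg => ⟨g, J.le_regular (Finset.singleton_nonempty a) hg, by
        rw [tau_zero, mon_zero, one_mul, one_mul]⟩⟩, rfl⟩
  refine ⟨h, s', r', H, fun a => finite_of_forall_prime fun p hp => ?_⟩
  by_contra hc
  push Not at hc
  obtain ⟨h', σ, ρ, H', hpos⟩ := exists_divides_of_dvd hp hc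
  have := hmax _ ⟨_, _, _, H.mul H', rfl⟩
  omega

/-- The Hilbert polynomial of a non-zero subsheaf of the structure sheaf of a curve, and the
comparison of the slopes. If the greatest common divisor of `J` has bidegree `(s', r')` and the
quotient by it has length `ℓ`, then `R = r - r'`, `S = s - s'`, and the difference of the two sides
of the inequality is `R S (r' + s') + R s'² + S r'² + ℓ (r + s)`. -/
theorem exists_hilbert {J : IdealSystem} {f : Laurent} {s r : ℕ} (hsr : 0 < s + r) (hf : f ≠ 0)
    (hreg : ∀ a, mon (tau s r a) * f ∈ regular {a}) (hJ : ∀ a, mon (tau s r a) * f ∈ J.J {a})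
    (hne : ∃ T, T.Nonempty ∧ ∃ g ∈ J.J T, g ∉ (principal f s r hreg).J T) :
    ∃ R S t : ℤ, (∀ m n, (J.twist m n).Chi ((principal f s r hreg).twist m n)
      (R * m + S * n + t)) ∧ 0 < R + S ∧ t * (r + s) ≤ (r + s - r * s) * (R + S) ∧
      (0 < r → 0 < s → (∃ a, J.J {a} ≠ regular {a}) →
        t * (r + s) < (r + s - r * s) * (R + S)) := by
  obtain ⟨h, s', r', H, hfin⟩ := exists_divides_finite hf hJ
  have hdiv : ∀ a, ∃ q ∈ BiProj.regular {a},
      mon (tau s r a) * f = mon (tau s' r' a) * h * q := fun a => H.exists_eq a _ (hJ a)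
  obtain ⟨f', hf', h0⟩ := hdiv (toLex (0, 0))
  have ht : ∀ m n, tau m n (toLex (0, 0)) = 0 := fun m n => by
    simp [tau, ChartIdx.fst, ChartIdx.snd]
  rw [ht, ht, mon_zero, one_mul, one_mul] at h0
  have hf'reg : ∀ a, mon (tau (s - s') (r - r') a) * f' ∈ BiProj.regular {a} := by
    intro a
    obtain ⟨q, hq, h1⟩ := hdiv a
    convert hq using 1
    have h2 : tau s r a = tau s' r' a + tau (s - s') (r - r') a := by
      rw [← tau_add]; simp
    rw [h0, h2, mon_add] at h1
    refine mul_left_cancel₀ (mul_ne_zero (mon_ne_zero (tau s' r' a)) H.ne_zero) ?_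
    rw [← h1]
    ring
  have hf'0 : f' ≠ 0 := by rintro rfl; exact hf (by rw [h0, mul_zero])
  have hSR := nonneg_of_regular hf'0 hf'reg
  have hsr' := nonneg_of_regular H.ne_zero H.regular
  have hlen := H.quot.colength_le_length hfin
  have hlen0 : 0 ≤ H.quot.length := (Int.natCast_nonneg _).trans (hlen (toLex (0, 0)))
  obtain ⟨S, hS⟩ : ∃ S, S = (s : ℤ) - s' := ⟨_, rfl⟩
  obtain ⟨R, hR⟩ : ∃ R, R = (r : ℤ) - r' := ⟨_, rfl⟩
  rw [← hS, ← hR] at hSR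
  -- If `R = S = 0`, the greatest common divisor is the equation of the curve, and the subsheaf is
  -- zero.
  have hpos : 0 < R + S := by
    by_contra hneg
    have hR0 : R = 0 := by omega
    have hS0 : S = 0 := by omega
    rw [← hS, ← hR, hR0, hS0] at hf'reg
    obtain ⟨c, rfl⟩ := exists_eq_const hf'reg
    have hc : c ≠ 0 := by rintro rfl; exact hf'0 (by simp)
    obtain ⟨T, ⟨a, ha⟩, g, hg, hg'⟩ := hne
    apply hg'
    rw [mem_principal ha]
    obtain ⟨q, hq, h1⟩ := H.exists_eq' ha hg
    refine ⟨c⁻¹ • q, Submodule.smul_mem _ _ hq, ?_⟩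
    have hss : s' = s := by omega
    have hrr : r' = r := by omega
    have h3 : (AddMonoidAlgebra.single 0 c : Laurent) = c • 1 := by
      rw [AddMonoidAlgebra.one_def, AddMonoidAlgebra.smul_single, smul_eq_mul, mul_one]
    rw [h1, h0, hss, hrr, h3]
    simp only [mul_smul_comm, smul_mul_assoc, mul_one, smul_smul, inv_mul_cancel₀ hc, one_smul]
  refine ⟨R, S, R * (1 - s') + S * (1 - r') - R * S - H.quot.length, fun m n => ?_, hpos, ?_, ?_⟩
  · have h1 := H.chi (chi_of_finite (fun T hT => by
      obtain ⟨a, ha⟩ := hT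
      exact (restrict_finite (hfin a) ha).1) (m - s') (n - r'))
    rw [sub_add_cancel, sub_add_cancel] at h1
    have h2 := chi_principal hf hreg m n
    have hle : (principal f s r hreg).twist m n ≤ J.twist m n := by
      intro T g hg a ha
      obtain ⟨q, hq, h3⟩ := (mem_principal ha).1 (hg a ha)
      rw [h3, mul_comm]
      exact J.mul_mem ⟨a, ha⟩ hq (mono_singleton ha (hJ a))
    have h3 := h1.sub_right cochD_cochD (Sys.cx_mono (zeroSys_le _)) (Sys.cx_mono hle) h2
    convert h3 using 1
    change _ = (m - s' + 1) * (n - r' + 1) - H.quot.length - _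
    rw [hR, hS]
    ring
  · have : ((r : ℤ) + s - r * s) * (R + S) - (R * (1 - s') + S * (1 - r') - R * S - H.quot.length) *
      (r + s) = R * S * (r' + s') + R * s' ^ 2 + S * r' ^ 2 + H.quot.length * (r + s) := by
      rw [hR, hS]; ring
    have h1 : 0 ≤ R * S * (r' + s') := mul_nonneg (mul_nonneg hSR.2 hSR.1) (by omega)
    have h2 : 0 ≤ R * s' ^ 2 := mul_nonneg hSR.2 (sq_nonneg _)
    have h3 : 0 ≤ S * r' ^ 2 := mul_nonneg hSR.1 (sq_nonneg _)
    have h4 : 0 ≤ H.quot.length * (r + s) := mul_nonneg hlen0 (by positivity)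
    linarith
  · intro hr hs hJ'
    have : ((r : ℤ) + s - r * s) * (R + S) - (R * (1 - s') + S * (1 - r') - R * S - H.quot.length) *
      (r + s) = R * S * (r' + s') + R * s' ^ 2 + S * r' ^ 2 + H.quot.length * (r + s) := by
      rw [hR, hS]; ring
    have h1 : 0 ≤ R * S * (r' + s') := mul_nonneg (mul_nonneg hSR.2 hSR.1) (by omega)
    have h2 : 0 ≤ R * s' ^ 2 := mul_nonneg hSR.2 (sq_nonneg _)
    have h3 : 0 ≤ S * r' ^ 2 := mul_nonneg hSR.1 (sq_nonneg _)
    have h4 : 0 ≤ H.quot.length * (r + s) := mul_nonneg hlen0 (by positivity)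
    by_contra hlt
    have e1 : R * S * (r' + s') = 0 := by linarith
    have e2 : R * s' ^ 2 = 0 := by linarith
    have e3 : S * r' ^ 2 = 0 := by linarith
    have e4 : H.quot.length * (r + s) = 0 := by linarith
    -- In the case of equality, the greatest common divisor is a constant and the colength is zero.
    have hl0 : H.quot.length = 0 := (mul_eq_zero.1 e4).resolve_right (by omega)
    have hs'0 : s' = 0 := by
      rcases mul_eq_zero.1 e2 with h | h
      · rcases mul_eq_zero.1 e3 with h' | h'
        · omega
        · have : r' = 0 := by simpa using h'
          omega
      · simpa using h
    have hr'0 : r' = 0 := by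
      rcases mul_eq_zero.1 e3 with h | h
      · omega
      · simpa using h
    obtain ⟨a, ha⟩ := hJ'
    apply ha
    refine le_antisymm (J.le_regular (Finset.singleton_nonempty a)) fun g hg => ?_
    have hcol : H.quot.colength {a} = 0 := by have := hlen a; omega
    have hfa := hfin a
    have hsub : Subsingleton (Subquot (BiProj.regular {a}) (H.quot.J {a})) :=
      Module.finrank_zero_iff.1 hcol
    have hall : ∀ q ∈ BiProj.regular {a}, q ∈ H.quot.J {a} := fun q hq =>
      (subquot_mk_eq_zero ⟨q, hq⟩).1 (Subsingleton.elim _ _)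
    have hHreg := H.regular
    rw [hs'0, hr'0] at hHreg
    obtain ⟨c, rfl⟩ := exists_eq_const hHreg
    have hc : c ≠ 0 := by rintro rfl; exact H.ne_zero (by simp)
    have h5 := (H.mem_quot (Finset.mem_singleton_self a)).1 (hall _ (Submodule.smul_mem _ c⁻¹ hg))
    rw [hs'0, hr'0, tau_zero, mon_zero, one_mul] at h5
    have h3 : (AddMonoidAlgebra.single 0 c : Laurent) = c • 1 := by
      rw [AddMonoidAlgebra.one_def, AddMonoidAlgebra.smul_single, smul_eq_mul, mul_one]
    rw [h3, smul_mul_assoc, one_mul, smul_smul, mul_inv_cancel₀ hc, one_smul] at h5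
    exact h5

end IdealSystem

/-! ### The coordinate rings of the charts -/

section

open HomogeneousLocalization

/-- `ℂ[t] → (ℂ[x₀, x₁]_{x_i})₀`, `t ↦ x_k / x_i` with `k ≠ i`. -/
def awayPoly (i : Fin 2) :
    Polynomial ℂ →+* Away grading (MvPolynomial.X i : MvPolynomial (Fin 2) ℂ) :=
  Polynomial.eval₂RingHom ((fromZeroRingHom grading _).comp (algebraMap ℂ (grading 0)))
    (Away.mk grading (f := MvPolynomial.X i) (d := 1)
      ((MvPolynomial.mem_homogeneousSubmodule 1 _).2 (MvPolynomial.isHomogeneous_X ℂ i))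
      1 (MvPolynomial.X (i + 1))
      ((MvPolynomial.mem_homogeneousSubmodule _ _).2 (MvPolynomial.isHomogeneous_X ℂ (i + 1))))

lemma val_mk_mul {i : Fin 2} (n : ℕ) (p : MvPolynomial (Fin 2) ℂ) (hp) :
    (Away.mk grading (f := MvPolynomial.X i) (d := 1)
      ((MvPolynomial.mem_homogeneousSubmodule 1 _).2 (MvPolynomial.isHomogeneous_X ℂ i))
      n p hp).val * algebraMap _ _ (MvPolynomial.X i : MvPolynomial (Fin 2) ℂ) ^ n =
    algebraMap _ _ p := by
  rw [Away.val_mk, Localization.mk_eq_mk', ← map_pow]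
  exact IsLocalization.mk'_spec _ _ _

lemma val_awayPoly_C (i : Fin 2) (c : ℂ) : (awayPoly i (Polynomial.C c)).val =
    algebraMap _ _ (MvPolynomial.C c : MvPolynomial (Fin 2) ℂ) := by
  simp only [awayPoly, Polynomial.coe_eval₂RingHom, Polynomial.eval₂_C, RingHom.comp_apply]
  rw [← Localization.mk_one_eq_algebraMap]
  rfl

lemma val_awayPoly_X (i : Fin 2) : (awayPoly i Polynomial.X).val *
    algebraMap _ _ (MvPolynomial.X i : MvPolynomial (Fin 2) ℂ) =
    algebraMap _ _ (MvPolynomial.X (i + 1) : MvPolynomial (Fin 2) ℂ) := by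
  have := val_mk_mul (i := i) 1 (MvPolynomial.X (i + 1))
    ((MvPolynomial.mem_homogeneousSubmodule _ _).2 (MvPolynomial.isHomogeneous_X ℂ (i + 1)))
  rw [pow_one] at this
  rw [← this]
  simp only [awayPoly, Polynomial.coe_eval₂RingHom, Polynomial.eval₂_X]

/-- Evaluation at `x_i = 1`, a left inverse of `awayPoly`. -/
def awayEval (i : Fin 2) :
    Localization.Away (MvPolynomial.X i : MvPolynomial (Fin 2) ℂ) →+* Polynomial ℂ :=
  IsLocalization.Away.lift (MvPolynomial.X i : MvPolynomial (Fin 2) ℂ)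
    (g := (MvPolynomial.eval₂Hom Polynomial.C (fun k => if k = i then 1 else Polynomial.X)))
    (by simp)

lemma awayEval_awayPoly (i : Fin 2) (p : Polynomial ℂ) : awayEval i (awayPoly i p).val = p := by
  have : ((awayEval i).comp (algebraMap (Away grading (MvPolynomial.X i))
      (Localization.Away (MvPolynomial.X i : MvPolynomial (Fin 2) ℂ)))).comp (awayPoly i) =
      RingHom.id _ := by
    apply Polynomial.ringHom_ext
    · intro c
      simp [val_awayPoly_C, awayEval]
    · have := congrArg (awayEval i) (val_awayPoly_X i)
      simpa [awayEval] using this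
  exact congrArg (fun f => f p) this

lemma awayPoly_injective (i : Fin 2) : Function.Injective (awayPoly i) := fun p q h => by
  rw [← awayEval_awayPoly i p, h, awayEval_awayPoly]

lemma awayPoly_surjective (i : Fin 2) : Function.Surjective (awayPoly i) := by
  intro y
  obtain ⟨n, p, hp, rfl⟩ := Away.mk_surjective grading
    ((MvPolynomial.mem_homogeneousSubmodule 1 _).2 (MvPolynomial.isHomogeneous_X ℂ i)) y
  have hp' : p.IsHomogeneous n := by simpa using hp
  refine ⟨∑ d ∈ p.support, Polynomial.C (p.coeff d) * Polynomial.X ^ d (i + 1),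
    HomogeneousLocalization.val_injective _ ?_⟩
  have hu := (IsLocalization.Away.algebraMap_isUnit
    (S := Localization.Away (MvPolynomial.X i : MvPolynomial (Fin 2) ℂ))
    (MvPolynomial.X i : MvPolynomial (Fin 2) ℂ)).pow n
  rw [← hu.mul_left_inj, val_mk_mul]
  conv_rhs => rw [p.as_sum]
  rw [map_sum, map_sum, ← HomogeneousLocalization.algebraMap_apply, map_sum, Finset.sum_mul]
  refine Finset.sum_congr rfl fun d hd => ?_
  have hdeg : d i + d (i + 1) = n := by
    have := hp' (MvPolynomial.mem_support_iff.1 hd)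
    rw [Finsupp.weight_apply, Finsupp.sum_fintype _ _ (by simp)] at this
    fin_cases i <;> simp at this ⊢ <;> omega
  have hmon : MvPolynomial.monomial d (p.coeff d) = MvPolynomial.C (p.coeff d) *
      MvPolynomial.X i ^ d i * MvPolynomial.X (i + 1) ^ d (i + 1) := by
    rw [MvPolynomial.monomial_eq, Finsupp.prod_fintype _ _ (by simp), Fin.prod_univ_two]
    fin_cases i <;> simp <;> ring
  rw [hmon, ← hdeg, map_mul, map_mul, map_pow, map_pow, HomogeneousLocalization.algebraMap_apply,
    HomogeneousLocalization.algebraMap_apply, val_awayPoly_C, map_mul, map_mul, map_pow, map_pow,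
    ← val_awayPoly_X]
  ring

lemma X_mem_grading (i : Fin 2) : (MvPolynomial.X i : MvPolynomial (Fin 2) ℂ) ∈ grading 1 :=
  (MvPolynomial.mem_homogeneousSubmodule 1 _).2 (MvPolynomial.isHomogeneous_X ℂ i)

lemma isAffineOpen_P1chart (i : Fin 2) : IsAffineOpen (P1.chart i) :=
  Proj.isAffineOpen_basicOpen grading _ (X_mem_grading i) one_pos

/-- The isomorphism `ℂ[t] ≃ Γ(ℙ¹, {x_i ≠ 0})`. -/
def P1.chartEquiv (i : Fin 2) : Polynomial ℂ ≃+* Γ(P1, P1.chart i) :=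
  (RingEquiv.ofBijective (awayPoly i) ⟨awayPoly_injective i, awayPoly_surjective i⟩).trans
    (Proj.basicOpenIsoAway grading _ (X_mem_grading i) one_pos).commRingCatIsoToRingEquiv

lemma P1.chartEquiv_X (i : Fin 2) : P1.chartEquiv i Polynomial.X = P1.coord i (i + 1) := by
  have : P1.chartEquiv i Polynomial.X =
    (Proj.awayToSection grading (MvPolynomial.X i)).hom (awayPoly i Polynomial.X) := rfl
  rw [this]
  simp only [awayPoly, Polynomial.coe_eval₂RingHom, Polynomial.eval₂_X]
  rfl

lemma P1.ι_toSpec (i : Fin 2) : (P1.chart i).ι ≫ P1.toSpec =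
    Proj.basicOpenToSpec grading (MvPolynomial.X i) ≫
      Spec.map (CommRingCat.ofHom
        ((fromZeroRingHom grading _).comp (algebraMap ℂ (grading 0)))) := by
  rw [CommRingCat.ofHom_comp, Spec.map_comp, ← Category.assoc, P1.toSpec, ← Category.assoc,
    ← Proj.awayι_toSpecZero grading _ (X_mem_grading i) one_pos,
    ← Proj.basicOpenIsoSpec_inv_ι, ← Proj.basicOpenIsoSpec_hom _ _ (X_mem_grading i) one_pos]
  simp

lemma P1.chart_le (i : Fin 2) : P1.chart i ≤ P1.toSpec ⁻¹ᵁ ⊤ := le_top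

lemma chart_le_fst (a : ChartIdx) : chart a ≤ pr₁ ⁻¹ᵁ P1.chart a.fst := inf_le_left

lemma chart_le_snd (a : ChartIdx) : chart a ≤ pr₂ ⁻¹ᵁ P1.chart a.snd := inf_le_right

/-- Pull-back of functions along the first projection. -/
def chartFst (a : ChartIdx) : Γ(P1, P1.chart a.fst) ⟶ Γ(P1P1, chart a) :=
  pr₁.appLE (P1.chart a.fst) (chart a) (chart_le_fst a)

/-- Pull-back of functions along the second projection. -/
def chartSnd (a : ChartIdx) : Γ(P1, P1.chart a.snd) ⟶ Γ(P1P1, chart a) :=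
  pr₂.appLE (P1.chart a.snd) (chart a) (chart_le_snd a)

/-- Pull-back of functions from `Spec ℂ` to the standard charts of `ℙ¹`. -/
def P1.chartConst (i : Fin 2) : Γ(Spec (.of ℂ), ⊤) ⟶ Γ(P1, P1.chart i) :=
  P1.toSpec.appLE ⊤ (P1.chart i) (P1.chart_le i)

lemma P1.chartEquiv_C (i : Fin 2) (c : ℂ) : P1.chartEquiv i (Polynomial.C c) =
    (P1.chartConst i).hom ((Scheme.ΓSpecIso (.of ℂ)).inv.hom c) := by
  have h2 := congrArg (fun f => f.appTop ≫ (P1.chart i).topIso.hom) (P1.ι_toSpec i)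
  have h3 : (Proj.basicOpenToSpec grading (MvPolynomial.X i)).appTop = _ :=
    Proj.basicOpenToSpec_app_top grading (MvPolynomial.X i)
  simp only [Scheme.Hom.comp_appTop, Category.assoc, h3, Iso.inv_hom_id, Category.comp_id] at h2
  rw [Scheme.ΓSpecIso_naturality_assoc] at h2
  have h4 : (P1.chart i).ι.appTop ≫ (P1.chart i).topIso.hom =
      P1.presheaf.map (homOfLE le_top).op := by
    simp
    rfl
  rw [h4, ← Iso.inv_comp_eq] at h2
  have h5 := congrArg (fun f => f.hom c) h2
  have h1 : P1.chartEquiv i (Polynomial.C c) =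
    (Proj.awayToSection grading (MvPolynomial.X i)).hom (awayPoly i (Polynomial.C c)) := rfl
  rw [h1]
  simp only [awayPoly, Polynomial.coe_eval₂RingHom, Polynomial.eval₂_C]
  refine Eq.trans h5.symm ?_
  rfl

/-- The coordinate ring of a chart of `ℙ¹ × ℙ¹` is the tensor product over `ℂ` of the coordinate
rings of its two factors. -/
lemma isPushout_chart (a : ChartIdx) :
    IsPushout (P1.chartConst a.fst) (P1.chartConst a.snd) (chartFst a) (chartSnd a) :=
  (isIso_pushoutSection_iff (IsPullback.of_hasPullback P1.toSpec P1.toSpec)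
    (US := ⊤) (UT := P1.chart a.snd) (UX := P1.chart a.fst) (UY := chart a) le_top le_top rfl).1
    (isIso_pushoutSection_of_isAffineOpen _ _ _ _ (isAffineOpen_top _) (isAffineOpen_P1chart _)
      (isAffineOpen_P1chart _))

/-- The coordinate map `ℂ[X, Z] → Γ(ℙ¹ × ℙ¹, chart a)`. -/
def chartHom (a : ChartIdx) : MvPolynomial (Fin 2) ℂ →+* Γ(P1P1, chart a) :=
  MvPolynomial.eval₂Hom (scalar (chart a)) ![xCoord a (a.fst + 1), zCoord a (a.snd + 1)]

lemma scalar_eq_fst (a : ChartIdx) (c : ℂ) : scalar (chart a) c =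
    (chartFst a).hom
      (P1.chartEquiv a.fst (Polynomial.C c)) := by
  have h : P1.chartConst a.fst ≫ chartFst a =
      P1P1.toSpec.appLE ⊤ (chart a) (le_top : chart a ≤ P1P1.toSpec ⁻¹ᵁ ⊤) :=
    Scheme.Hom.appLE_comp_appLE _ _ _ _ _ _ _
  rw [P1.chartEquiv_C, ← RingHom.comp_apply, ← CommRingCat.hom_comp, h]
  rfl

lemma scalar_eq_snd (a : ChartIdx) (c : ℂ) : scalar (chart a) c =
    (chartSnd a).hom
      (P1.chartEquiv a.snd (Polynomial.C c)) := by
  rw [scalar_eq_fst, P1.chartEquiv_C, P1.chartEquiv_C]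
  have := congrArg (fun f => f.hom ((Scheme.ΓSpecIso (.of ℂ)).inv.hom c)) (isPushout_chart a).w
  exact this

lemma xCoord_eq (a : ChartIdx) : xCoord a (a.fst + 1) =
    (chartFst a).hom
      (P1.chartEquiv a.fst Polynomial.X) := by
  rw [P1.chartEquiv_X]; rfl

lemma zCoord_eq (a : ChartIdx) : zCoord a (a.snd + 1) =
    (chartSnd a).hom
      (P1.chartEquiv a.snd Polynomial.X) := by
  rw [P1.chartEquiv_X]; rfl

/-- The inverse of `chartHom`, from the universal property of the tensor product. -/
def chartInv (a : ChartIdx) : Γ(P1P1, chart a) →+* MvPolynomial (Fin 2) ℂ :=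
  ((isPushout_chart a).desc
    (CommRingCat.ofHom (R := Γ(P1, P1.chart a.fst))
      ((Polynomial.eval₂RingHom MvPolynomial.C (MvPolynomial.X 0)).comp
        ((P1.chartEquiv a.fst).symm : Γ(P1, P1.chart a.fst) →+* Polynomial ℂ)))
    (CommRingCat.ofHom (R := Γ(P1, P1.chart a.snd))
      ((Polynomial.eval₂RingHom MvPolynomial.C (MvPolynomial.X 1)).comp
        ((P1.chartEquiv a.snd).symm : Γ(P1, P1.chart a.snd) →+* Polynomial ℂ))) (by
    rw [← cancel_epi (Scheme.ΓSpecIso (.of ℂ)).inv]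
    ext c
    have h1 := P1.chartEquiv_C a.fst c
    have h2 := P1.chartEquiv_C a.snd c
    simp only [CommRingCat.hom_comp, RingHom.comp_apply, CommRingCat.hom_ofHom]
    rw [← h1, ← h2]
    simp)).hom

lemma chartInv_fst (a : ChartIdx) (p : Polynomial ℂ) :
    chartInv a ((chartFst a).hom (P1.chartEquiv a.fst p)) =
      Polynomial.eval₂RingHom MvPolynomial.C (MvPolynomial.X 0) p := by
  rw [chartInv, ← RingHom.comp_apply, ← CommRingCat.hom_comp, IsPushout.inl_desc]
  simp

lemma chartInv_snd (a : ChartIdx) (p : Polynomial ℂ) :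
    chartInv a ((chartSnd a).hom (P1.chartEquiv a.snd p)) =
      Polynomial.eval₂RingHom MvPolynomial.C (MvPolynomial.X 1) p := by
  rw [chartInv, ← RingHom.comp_apply, ← CommRingCat.hom_comp, IsPushout.inr_desc]
  simp

lemma chartInv_comp_chartHom (a : ChartIdx) :
    (chartInv a).comp (chartHom a) = RingHom.id _ := by
  apply MvPolynomial.ringHom_ext
  · intro c
    simp [chartHom, scalar_eq_fst, chartInv_fst]
  · intro k
    fin_cases k
    · simp [chartHom, xCoord_eq, chartInv_fst]
    · simp [chartHom, zCoord_eq, chartInv_snd]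

lemma chartHom_comp_chartInv (a : ChartIdx) :
    (chartHom a).comp (chartInv a) = RingHom.id _ := by
  suffices h : CommRingCat.ofHom ((chartHom a).comp (chartInv a)) = 𝟙 _ from
    congrArg CommRingCat.Hom.hom h
  apply (isPushout_chart a).hom_ext
  · refine Eq.trans ?_ (Category.comp_id _).symm
    suffices h : ((chartHom a).comp (chartInv a)).comp
        ((chartFst a).hom.comp (P1.chartEquiv a.fst).toRingHom) =
        (chartFst a).hom.comp (P1.chartEquiv a.fst).toRingHom by
      ext y
      have := congrArg (fun f => f ((P1.chartEquiv a.fst).symm y)) h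
      simpa using this
    apply Polynomial.ringHom_ext
    · intro c
      simp [chartInv_fst, chartHom, scalar_eq_fst]
    · simp [chartInv_fst, chartHom, xCoord_eq]
  · refine Eq.trans ?_ (Category.comp_id _).symm
    suffices h : ((chartHom a).comp (chartInv a)).comp
        ((chartSnd a).hom.comp (P1.chartEquiv a.snd).toRingHom) =
        (chartSnd a).hom.comp (P1.chartEquiv a.snd).toRingHom by
      ext y
      have := congrArg (fun f => f ((P1.chartEquiv a.snd).symm y)) h
      simpa using this
    apply Polynomial.ringHom_ext
    · intro c
      simp [chartInv_snd, chartHom, scalar_eq_snd]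
    · simp [chartInv_snd, chartHom, zCoord_eq]

/-- The coordinate ring of each standard chart is a polynomial ring in two variables. -/
def chartEquiv (a : ChartIdx) : MvPolynomial (Fin 2) ℂ ≃+* Γ(P1P1, chart a) :=
  RingEquiv.ofRingHom (chartHom a) (chartInv a) (chartHom_comp_chartInv a)
    (chartInv_comp_chartHom a)

/-! ### Intersections of charts -/

lemma P1.coord_self (i : Fin 2) : P1.coord i i = 1 := by
  rw [P1.coord]
  convert map_one (Proj.awayToSection grading (MvPolynomial.X i)).hom
  apply HomogeneousLocalization.val_injective
  have hu := (IsLocalization.Away.algebraMap_isUnit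
    (S := Localization.Away (MvPolynomial.X i : MvPolynomial (Fin 2) ℂ))
    (MvPolynomial.X i : MvPolynomial (Fin 2) ℂ)).pow 1
  rw [← hu.mul_left_inj, val_mk_mul, val_one]
  simp

/-- The coordinate `x_k / x_i` is invertible exactly where `x_k` does not vanish. -/
lemma P1.basicOpen_coord (i k : Fin 2) :
    P1.basicOpen (P1.coord i k) = P1.chart i ⊓ P1.chart k := by
  have h1 := Proj.awayι_preimage_basicOpen grading (X_mem_grading i) one_pos (X_mem_grading k)
    one_pos
  rw [← Proj.basicOpenIsoSpec_inv_ι] at h1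
  have h2 := congrArg
    (fun U => (Proj.basicOpenIsoSpec grading _ (X_mem_grading i) one_pos).hom ⁻¹ᵁ U) h1
  simp only [← Scheme.Hom.comp_preimage, Iso.hom_inv_id_assoc] at h2
  rw [Proj.basicOpenIsoSpec_hom, Proj.basicOpenToSpec] at h2
  have h4 := h2.trans ((congrArg (fun U => (P1.chart i).toSpecΓ ⁻¹ᵁ U)
    (SpecMap_preimage_basicOpen (Proj.awayToSection grading (MvPolynomial.X i)) _)).trans
    (Scheme.Opens.toSpecΓ_preimage_basicOpen (P1.chart i) _))
  have h3 := congrArg (fun U => (P1.chart i).ι ''ᵁ U) h4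
  simp only [Scheme.Hom.image_preimage_eq_opensRange_inf, Scheme.Opens.opensRange_ι] at h3
  rw [h3]
  symm
  refine Eq.trans ?_ (inf_eq_right.2 (P1.basicOpen_le _))
  congr 2
  rw [P1.coord]
  have : Away.mk grading (f := MvPolynomial.X i) (d := 1) (X_mem_grading i) 1 (MvPolynomial.X k)
      ((MvPolynomial.mem_homogeneousSubmodule _ _).2 (MvPolynomial.isHomogeneous_X ℂ k)) =
      Away.isLocalizationElem (X_mem_grading i) (X_mem_grading k) := by
    simp [Away.isLocalizationElem]
  rw [this]

lemma P1.coord_mul_coord (i k : Fin 2) :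
    (P1.presheaf.map (homOfLE (inf_le_left : P1.chart i ⊓ P1.chart k ≤ P1.chart i)).op).hom
      (P1.coord i k) *
    (P1.presheaf.map (homOfLE (inf_le_right : P1.chart i ⊓ P1.chart k ≤ P1.chart k)).op).hom
      (P1.coord k i) = 1 := by
  have h1 := Proj.awayMap_awayToSection grading (f := MvPolynomial.X i) (X_mem_grading k) rfl
  have h2 := Proj.awayMap_awayToSection grading (f := MvPolynomial.X k) (X_mem_grading i)
    (mul_comm (MvPolynomial.X i) (MvPolynomial.X k))
  have e1 := congrArg (fun f => f.hom (Away.mk grading (f := MvPolynomial.X i) (d := 1)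
    (X_mem_grading i) 1 (MvPolynomial.X k)
    ((MvPolynomial.mem_homogeneousSubmodule _ _).2 (MvPolynomial.isHomogeneous_X ℂ k)))) h1
  have e2 := congrArg (fun f => f.hom (Away.mk grading (f := MvPolynomial.X k) (d := 1)
    (X_mem_grading k) 1 (MvPolynomial.X i)
    ((MvPolynomial.mem_homogeneousSubmodule _ _).2 (MvPolynomial.isHomogeneous_X ℂ i)))) h2
  simp only [CommRingCat.hom_comp, RingHom.comp_apply, CommRingCat.hom_ofHom] at e1 e2
  have key : awayMap grading (X_mem_grading k) rfl
      (Away.mk grading (f := MvPolynomial.X i) (d := 1) (X_mem_grading i) 1 (MvPolynomial.X k)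
      ((MvPolynomial.mem_homogeneousSubmodule _ _).2 (MvPolynomial.isHomogeneous_X ℂ k))) *
    awayMap grading (X_mem_grading i) (mul_comm (MvPolynomial.X i) (MvPolynomial.X k))
      (Away.mk grading (f := MvPolynomial.X k) (d := 1)
      (X_mem_grading k) 1 (MvPolynomial.X i)
      ((MvPolynomial.mem_homogeneousSubmodule _ _).2 (MvPolynomial.isHomogeneous_X ℂ i))) = 1 := by
    rw [awayMap_mk, awayMap_mk]
    apply HomogeneousLocalization.val_injective
    have hu := IsLocalization.Away.algebraMap_isUnit
      (S := Localization.Away (MvPolynomial.X i * MvPolynomial.X k : MvPolynomial (Fin 2) ℂ))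
      (MvPolynomial.X i * MvPolynomial.X k : MvPolynomial (Fin 2) ℂ)
    rw [val_mul, val_one, Away.val_mk, Away.val_mk, Localization.mk_mul, Localization.mk_eq_mk',
      IsLocalization.mk'_eq_iff_eq_mul, one_mul]
    congr 1
    simp
    ring
  have := congrArg (Proj.awayToSection grading
    (MvPolynomial.X i * MvPolynomial.X k : MvPolynomial (Fin 2) ℂ)).hom key
  rw [map_mul, map_one, e1, e2] at this
  have hle : P1.chart i ⊓ P1.chart k ≤
      Proj.basicOpen grading (MvPolynomial.X i * MvPolynomial.X k) :=
    (Proj.basicOpen_mul grading _ _).ge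
  have := congrArg (P1.presheaf.map (homOfLE hle).op).hom this
  rw [map_mul, map_one] at this
  rw [← this]
  congr 1

lemma P1.iSup_chart : ⨆ i, P1.chart i = ⊤ := by
  apply Proj.iSup_basicOpen_eq_top' grading (fun i : Fin 2 => MvPolynomial.X i)
    (fun i => ⟨1, X_mem_grading i⟩)
  rw [eq_top_iff]
  intro p _
  induction p using MvPolynomial.induction_on with
  | C c => exact Subalgebra.algebraMap_mem _ (algebraMap ℂ (grading 0) c)
  | add p q hp hq => exact add_mem (hp trivial) (hq trivial)
  | mul_X p i hp => exact mul_mem (hp trivial) (Algebra.subset_adjoin ⟨i, rfl⟩)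

lemma isAffineOpen_chart (a : ChartIdx) : IsAffineOpen (chart a) := by
  have : IsAffine (P1.chart a.fst) := isAffineOpen_P1chart _
  have : IsAffine (P1.chart a.snd) := isAffineOpen_P1chart _
  have : IsAffine (⊤ : (Spec (.of ℂ)).Opens) := isAffineOpen_top _
  exact .of_isIso (Scheme.Hom.isPullback_resLE (IsPullback.of_hasPullback P1.toSpec P1.toSpec)
    (US := ⊤) (UT := P1.chart a.snd) (UX := P1.chart a.fst) (UY := chart a) le_top le_top
    rfl).isoPullback.hom

lemma iSup_chart : ⨆ a, chart a = ⊤ := by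
  rw [eq_top_iff]
  intro x _
  have h1 : pr₁ x ∈ ⨆ i, P1.chart i := by rw [P1.iSup_chart]; trivial
  have h2 : pr₂ x ∈ ⨆ i, P1.chart i := by rw [P1.iSup_chart]; trivial
  rw [TopologicalSpace.Opens.mem_iSup] at h1 h2 ⊢
  obtain ⟨i, hi⟩ := h1
  obtain ⟨j, hj⟩ := h2
  exact ⟨toLex (i, j), hi, hj⟩

lemma basicOpen_xCoord (a : ChartIdx) (k : Fin 2) :
    P1P1.basicOpen (xCoord a k) = chart a ⊓ pr₁ ⁻¹ᵁ P1.chart k := by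
  have h : xCoord a k = (chartFst a).hom (P1.coord a.fst k) := rfl
  have h2 := Scheme.basicOpen_appLE pr₁ (chart a) (P1.chart a.fst) (chart_le_fst a)
    (P1.coord a.fst k)
  rw [h]
  refine h2.trans ?_
  rw [P1.basicOpen_coord, Scheme.Hom.preimage_inf, ← inf_assoc, inf_eq_left.2 (chart_le_fst a)]

lemma basicOpen_zCoord (a : ChartIdx) (l : Fin 2) :
    P1P1.basicOpen (zCoord a l) = chart a ⊓ pr₂ ⁻¹ᵁ P1.chart l := by
  have h : zCoord a l = (chartSnd a).hom (P1.coord a.snd l) := rfl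
  have h2 := Scheme.basicOpen_appLE pr₂ (chart a) (P1.chart a.snd) (chart_le_snd a)
    (P1.coord a.snd l)
  rw [h]
  refine h2.trans ?_
  rw [P1.basicOpen_coord, Scheme.Hom.preimage_inf, ← inf_assoc, inf_eq_left.2 (chart_le_snd a)]

/-- The intersection of the charts of a finite set; for the empty set it is the whole surface. -/
def interF (T : Finset ChartIdx) : P1P1.Opens := T.inf chart

lemma interF_le {T : Finset ChartIdx} {a : ChartIdx} (ha : a ∈ T) : interF T ≤ chart a :=
  Finset.inf_le ha

lemma interF_mono {T T' : Finset ChartIdx} (h : T ⊆ T') : interF T' ≤ interF T :=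
  Finset.inf_mono h

/-- A function on `chart a` whose non-vanishing locus is the intersection of `chart a` with the
charts of `T`. -/
def locElem (a : ChartIdx) (T : Finset ChartIdx) : Γ(P1P1, chart a) :=
  ∏ b ∈ T, xCoord a b.fst * zCoord a b.snd

lemma basicOpen_locElem (a : ChartIdx) (T : Finset ChartIdx) :
    P1P1.basicOpen (locElem a T) = chart a ⊓ interF T := by
  classical
  induction T using Finset.induction_on with
  | empty =>
    simp [locElem, interF]
  | insert b T hb ih =>
    rw [locElem, Finset.prod_insert hb, ← locElem, Scheme.basicOpen_mul, ih,
      Scheme.basicOpen_mul, basicOpen_xCoord, basicOpen_zCoord,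
      show interF (insert b T) = chart b ⊓ interF T from Finset.inf_insert,
      ← inf_inf_distrib_left, ← inf_inf_distrib_left]
    rfl

lemma interF_eq_basicOpen {a : ChartIdx} {T : Finset ChartIdx} (ha : a ∈ T) :
    interF T = P1P1.basicOpen (locElem a T) := by
  rw [basicOpen_locElem, inf_eq_right.2 (interF_le ha)]

lemma isAffineOpen_interF {T : Finset ChartIdx} (hT : T.Nonempty) : IsAffineOpen (interF T) := by
  obtain ⟨a, ha⟩ := hT
  rw [interF_eq_basicOpen ha]
  exact (isAffineOpen_chart a).basicOpen _

lemma inter_eq_interF {p : ℕ} (σ : CechIdx p) :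
    inter σ = interF (Finset.univ.map σ.toEmbedding) := by
  rw [inter, interF, Finset.inf_map, Finset.inf_univ_eq_iInf]
  rfl

lemma isUnit_res_of_le_basicOpen {X : Scheme.{0}} {U V : X.Opens} {g : Γ(X, U)}
    (h : V ≤ U) (hV : V ≤ X.basicOpen g) : IsUnit ((X.presheaf.map (homOfLE h).op).hom g) := by
  have h1 := (RingedSpace.isUnit_res_basicOpen X.toRingedSpace g).map
    (X.presheaf.map (homOfLE hV).op).hom
  have h2 : X.presheaf.map (homOfLE h).op =
    X.presheaf.map (homOfLE (X.basicOpen_le g)).op ≫ X.presheaf.map (homOfLE hV).op := by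
    rw [← Functor.map_comp]; rfl
  rw [h2]
  exact h1

/-- A function on a basic open subset of an affine open subset extends after multiplication by a
power of the equation. -/
lemma exists_pow_mul_eq_res {X : Scheme.{0}} {U V : X.Opens} (hU : IsAffineOpen U) {g : Γ(X, U)}
    (hV : V = X.basicOpen g) (h : V ≤ U) (y : Γ(X, V)) :
    ∃ (n : ℕ) (p : Γ(X, U)), (X.presheaf.map (homOfLE h).op).hom g ^ n * y =
      (X.presheaf.map (homOfLE h).op).hom p := by
  subst hV
  have := hU.isLocalization_basicOpen g
  obtain ⟨⟨p, ⟨_, n, rfl⟩⟩, hp⟩ := IsLocalization.surj (Submonoid.powers g) y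
  refine ⟨n, p, ?_⟩
  rw [mul_comm, ← map_pow]
  exact hp

lemma exists_pow_mul_eq_zero {X : Scheme.{0}} {U V : X.Opens} (hU : IsAffineOpen U) {g : Γ(X, U)}
    (hV : V = X.basicOpen g) (h : V ≤ U) (p : Γ(X, U))
    (hp : (X.presheaf.map (homOfLE h).op).hom p = 0) : ∃ n : ℕ, g ^ n * p = 0 := by
  subst hV
  have := hU.isLocalization_basicOpen g
  obtain ⟨⟨_, n, rfl⟩, hn⟩ :=
    (IsLocalization.map_eq_zero_iff (Submonoid.powers g) Γ(X, X.basicOpen g) p).1 hp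
  exact ⟨n, hn⟩

/-- Sections over an intersection of charts are obtained by localisation from a chart. -/
lemma exists_pow_mul_eq_resO {a : ChartIdx} {T : Finset ChartIdx} (ha : a ∈ T)
    (y : Γ(P1P1, interF T)) : ∃ (n : ℕ) (p : Γ(P1P1, chart a)),
      resO (interF_le ha) (locElem a T) ^ n * y = resO (interF_le ha) p :=
  exists_pow_mul_eq_res (isAffineOpen_chart a) (interF_eq_basicOpen ha) _ y

lemma isUnit_resO_locElem {a : ChartIdx} {T : Finset ChartIdx} (ha : a ∈ T) :
    IsUnit (resO (interF_le ha) (locElem a T)) :=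
  isUnit_res_of_le_basicOpen _ (interF_eq_basicOpen ha).le

instance (a : ChartIdx) : IsDomain Γ(P1P1, chart a) :=
  (chartEquiv a).symm.toMulEquiv.isDomain _

end

/-! ### Functions as Laurent polynomials -/

/-- The intersection of all standard charts. -/
def full : P1P1.Opens := interF Finset.univ

lemma full_le_interF (T : Finset ChartIdx) : full ≤ interF T := interF_mono (Finset.subset_univ T)

lemma full_le_chart (a : ChartIdx) : full ≤ chart a := interF_le (Finset.mem_univ a)

lemma resO_resO {U V W : P1P1.Opens} (h : U ≤ V) (h' : V ≤ W) (g : Γ(P1P1, W)) :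
    resO h (resO h' g) = resO (h.trans h') g := by
  change (P1P1.presheaf.map (homOfLE h').op ≫ P1P1.presheaf.map (homOfLE h).op).hom g = _
  rw [← Functor.map_comp]
  rfl

lemma full_le_fst (i : Fin 2) : full ≤ pr₁ ⁻¹ᵁ P1.chart i :=
  (full_le_chart (toLex (i, 0))).trans inf_le_left

lemma full_le_snd (i : Fin 2) : full ≤ pr₂ ⁻¹ᵁ P1.chart i :=
  (full_le_chart (toLex (0, i))).trans inf_le_right

/-- The function `x_k / x_i` on the intersection of all charts. -/
def fullX (i k : Fin 2) : Γ(P1P1, full) :=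
  resO (full_le_fst i) ((pr₁.app (P1.chart i)).hom (P1.coord i k))

/-- The function `z_k / z_i` on the intersection of all charts. -/
def fullZ (i k : Fin 2) : Γ(P1P1, full) :=
  resO (full_le_snd i) ((pr₂.app (P1.chart i)).hom (P1.coord i k))

lemma resO_xCoord (a : ChartIdx) (k : Fin 2) :
    resO (full_le_chart a) (xCoord a k) = fullX a.fst k := resO_resO _ _ _

lemma resO_zCoord (a : ChartIdx) (k : Fin 2) :
    resO (full_le_chart a) (zCoord a k) = fullZ a.snd k := resO_resO _ _ _

lemma fullX_self (i : Fin 2) : fullX i i = 1 := by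
  rw [fullX, P1.coord_self, map_one, map_one]

lemma fullZ_self (i : Fin 2) : fullZ i i = 1 := by
  rw [fullZ, P1.coord_self, map_one, map_one]

lemma resO_app_eq {p : P1P1 ⟶ P1} {U V : P1.Opens} (h : V ≤ U) (hU : full ≤ p ⁻¹ᵁ U)
    (hV : full ≤ p ⁻¹ᵁ V) (g : Γ(P1, U)) : resO hU ((p.app U).hom g) =
      resO hV ((p.app V).hom ((P1.presheaf.map (homOfLE h).op).hom g)) := by
  have := congrArg (fun f => f.hom g) (p.naturality (homOfLE h).op)
  change (p.app V).hom ((P1.presheaf.map (homOfLE h).op).hom g) = _ at this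
  rw [this]
  exact (resO_resO hV (p.preimage_mono h) _).symm

lemma fullX_mul (i k : Fin 2) : fullX i k * fullX k i = 1 := by
  have hle : full ≤ pr₁ ⁻¹ᵁ (P1.chart i ⊓ P1.chart k) := le_inf (full_le_fst i) (full_le_fst k)
  rw [fullX, fullX, resO_app_eq inf_le_left _ hle, resO_app_eq inf_le_right _ hle, ← map_mul,
    ← map_mul, P1.coord_mul_coord, map_one, map_one]

lemma fullZ_mul (i k : Fin 2) : fullZ i k * fullZ k i = 1 := by
  have hle : full ≤ pr₂ ⁻¹ᵁ (P1.chart i ⊓ P1.chart k) := le_inf (full_le_snd i) (full_le_snd k)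
  rw [fullZ, fullZ, resO_app_eq inf_le_left _ hle, resO_app_eq inf_le_right _ hle, ← map_mul,
    ← map_mul, P1.coord_mul_coord, map_one, map_one]

/-- The invertible function `x₁ / x₀`. -/
def unitX : Γ(P1P1, full)ˣ := ⟨fullX 0 1, fullX 1 0, fullX_mul 0 1, fullX_mul 1 0⟩

/-- The invertible function `z₁ / z₀`. -/
def unitZ : Γ(P1P1, full)ˣ := ⟨fullZ 0 1, fullZ 1 0, fullZ_mul 0 1, fullZ_mul 1 0⟩

/-- Monomials as functions on the intersection of all charts. -/
def monHom : Multiplicative (ℤ × ℤ) →* Γ(P1P1, full) :=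
  (Units.coeHom _).comp
    { toFun := fun u => unitX ^ u.toAdd.1 * unitZ ^ u.toAdd.2
      map_one' := by simp
      map_mul' := fun u v => by
        rw [toAdd_mul, Prod.fst_add, Prod.snd_add, zpow_add, zpow_add]
        exact mul_mul_mul_comm _ _ _ _ }

/-- Laurent polynomials as functions on the intersection of all charts. -/
def laurentHom : Laurent →+* Γ(P1P1, full) :=
  AddMonoidAlgebra.liftNCRingHom (scalar full) monHom fun _ _ => Commute.all _ _

lemma laurentHom_C (c : ℂ) : laurentHom (algebraMap ℂ Laurent c) = scalar full c := by
  rw [Algebra.algebraMap_eq_smul_one, AddMonoidAlgebra.one_def, AddMonoidAlgebra.smul_single]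
  refine (AddMonoidAlgebra.liftNCRingHom_single _ _ _ _ _).trans ?_
  simp

lemma laurentHom_mon (u : ℤ × ℤ) :
    laurentHom (mon u) = ((unitX ^ u.1 * unitZ ^ u.2 : Γ(P1P1, full)ˣ) : Γ(P1P1, full)) := by
  refine (AddMonoidAlgebra.liftNCRingHom_single _ _ _ _ _).trans ?_
  rw [map_one, one_mul]
  rfl

lemma laurentHom_X (i k : Fin 2) :
    laurentHom (mon ((k : ℕ) - (i : ℕ), 0)) = fullX i k := by
  rw [laurentHom_mon]
  fin_cases i <;> fin_cases k <;> simp [fullX_self, unitX]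

lemma laurentHom_Z (i k : Fin 2) :
    laurentHom (mon (0, (k : ℕ) - (i : ℕ))) = fullZ i k := by
  rw [laurentHom_mon]
  fin_cases i <;> fin_cases k <;> simp [fullZ_self, unitZ]

lemma dir_eq (i : Fin 2) : dir i = (((i + 1 : Fin 2) : ℕ) : ℤ) - (i : ℕ) := by
  fin_cases i <;> rfl

lemma laurentHom_chartLaurent (a : ChartIdx) (p : MvPolynomial (Fin 2) ℂ) :
    laurentHom (chartLaurent a p) = resO (full_le_chart a) (chartHom a p) := by
  suffices h : laurentHom.comp (chartLaurent a : MvPolynomial (Fin 2) ℂ →+* Laurent) =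
      (resO (full_le_chart a)).comp (chartHom a) from congrArg (fun f => f p) h
  apply MvPolynomial.ringHom_ext
  · intro c
    simp only [RingHom.comp_apply, RingHom.coe_coe, chartHom, MvPolynomial.coe_eval₂Hom,
      MvPolynomial.eval₂_C, resO_scalar]
    rw [← laurentHom_C]
    congr 1
    exact (chartLaurent a).commutes c
  · intro k
    have h : (chartLaurent a : MvPolynomial (Fin 2) ℂ →+* Laurent) (MvPolynomial.X k) =
        (![mon (dir a.fst, 0), mon (0, dir a.snd)] : Fin 2 → Laurent) k :=
      MvPolynomial.aeval_X _ _
    rw [RingHom.comp_apply, h]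
    simp only [RingHom.comp_apply, chartHom, MvPolynomial.coe_eval₂Hom, MvPolynomial.eval₂_X]
    fin_cases k
    · exact (by rw [dir_eq, laurentHom_X, resO_xCoord] : laurentHom (mon (dir a.fst, 0)) =
        resO (full_le_chart a) (xCoord a (a.fst + 1)))
    · exact (by rw [dir_eq, laurentHom_Z, resO_zCoord] : laurentHom (mon (0, dir a.snd)) =
        resO (full_le_chart a) (zCoord a (a.snd + 1)))

/-- The exponent of `locElem`. -/
def locExp (a : ChartIdx) (T : Finset ChartIdx) : ℤ × ℤ :=
  ∑ b ∈ T, (((b.fst : ℕ) : ℤ) - (a.fst : ℕ), ((b.snd : ℕ) : ℤ) - (a.snd : ℕ))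

lemma laurentHom_locExp (a : ChartIdx) (T : Finset ChartIdx) :
    laurentHom (mon (locExp a T)) = resO (full_le_chart a) (locElem a T) := by
  classical
  induction T using Finset.induction_on with
  | empty =>
    rw [locExp, locElem, Finset.sum_empty, Finset.prod_empty, mon_zero, map_one, map_one]
  | insert b T hb ih =>
    rw [locExp, locElem, Finset.prod_insert hb, Finset.sum_insert hb, ← locExp, ← locElem,
      mon_add, map_mul, map_mul, ih, map_mul, resO_xCoord, resO_zCoord, ← laurentHom_X,
      ← laurentHom_Z, ← map_mul, ← mon_add]
    congr 3
    simp

lemma xCoord_self (a : ChartIdx) : xCoord a a.fst = 1 := by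
  rw [xCoord, P1.coord_self]
  exact (congrArg _ (map_one _)).trans (map_one _)

lemma zCoord_self (a : ChartIdx) : zCoord a a.snd = 1 := by
  rw [zCoord, P1.coord_self]
  exact (congrArg _ (map_one _)).trans (map_one _)

lemma eq_or_eq_add_one (i k : Fin 2) : k = i ∨ k = i + 1 := by
  revert i k
  decide

lemma xCoord_ne_zero (a : ChartIdx) (k : Fin 2) : xCoord a k ≠ 0 := by
  rcases eq_or_eq_add_one a.fst k with rfl | rfl
  · rw [xCoord_self]
    exact one_ne_zero
  · have h : xCoord a (a.fst + 1) = chartEquiv a (MvPolynomial.X 0) :=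
      (MvPolynomial.eval₂_X (scalar (chart a)) ![xCoord a (a.fst + 1), zCoord a (a.snd + 1)]
        0).symm
    rw [h, map_ne_zero_iff _ (chartEquiv a).injective]
    exact MvPolynomial.X_ne_zero _

lemma zCoord_ne_zero (a : ChartIdx) (k : Fin 2) : zCoord a k ≠ 0 := by
  rcases eq_or_eq_add_one a.snd k with rfl | rfl
  · rw [zCoord_self]
    exact one_ne_zero
  · have h : zCoord a (a.snd + 1) = chartEquiv a (MvPolynomial.X 1) :=
      (MvPolynomial.eval₂_X (scalar (chart a)) ![xCoord a (a.fst + 1), zCoord a (a.snd + 1)]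
        1).symm
    rw [h, map_ne_zero_iff _ (chartEquiv a).injective]
    exact MvPolynomial.X_ne_zero _

lemma locElem_ne_zero (a : ChartIdx) (T : Finset ChartIdx) : locElem a T ≠ 0 :=
  Finset.prod_ne_zero_iff.2 fun _ _ => mul_ne_zero (xCoord_ne_zero a _) (zCoord_ne_zero a _)

lemma resO_chart_injective (a : ChartIdx) : Function.Injective (resO (full_le_chart a)) := by
  rw [injective_iff_map_eq_zero]
  intro p hp
  obtain ⟨n, hn⟩ := exists_pow_mul_eq_zero (isAffineOpen_chart a)
    (interF_eq_basicOpen (Finset.mem_univ a)) (full_le_chart a) p hp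
  exact (mul_eq_zero.1 hn).resolve_left (pow_ne_zero _ (locElem_ne_zero _ _))

lemma resO_interF_injective {T : Finset ChartIdx} (hT : T.Nonempty) :
    Function.Injective (resO (full_le_interF T)) := by
  rw [injective_iff_map_eq_zero]
  intro y hy
  obtain ⟨a, ha⟩ := hT
  obtain ⟨n, p, h⟩ := exists_pow_mul_eq_resO ha y
  have h1 := congrArg (resO (full_le_interF T)) h
  rw [map_mul, hy, mul_zero, resO_resO] at h1
  rw [← map_zero (resO (full_le_chart a))] at h1
  rw [← resO_chart_injective a h1, map_zero] at h
  exact (((isUnit_resO_locElem ha).pow n).mul_right_eq_zero).1 h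

lemma laurentHom_injective : Function.Injective laurentHom := by
  rw [injective_iff_map_eq_zero]
  intro g hg
  have hreg : g ∈ regular Finset.univ := by
    intro e he
    refine absurd ⟨fun h => ?_, fun h => ?_, fun h => ?_, fun h => ?_⟩ he
    · exact absurd (h (toLex (1, 1)) (Finset.mem_univ _)) (by decide)
    · exact absurd (h (toLex (0, 0)) (Finset.mem_univ _)) (by decide)
    · exact absurd (h (toLex (1, 1)) (Finset.mem_univ _)) (by decide)
    · exact absurd (h (toLex (0, 0)) (Finset.mem_univ _)) (by decide)
  obtain ⟨u, -, -, hu⟩ := exists_mem_cone_neg_mem_cone (Finset.mem_univ (toLex (0, 0))) hreg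
  obtain ⟨p, hp⟩ := exists_chartLaurent_eq hu
  have h1 := laurentHom_chartLaurent (toLex (0, 0)) p
  rw [hp, map_mul, hg, mul_zero] at h1
  rw [← map_zero (resO (full_le_chart (toLex (0, 0))))] at h1
  have h2 : p = 0 := (chartEquiv (toLex (0, 0))).injective
    ((resO_chart_injective _ h1).symm.trans (map_zero _).symm)
  rw [h2, map_zero] at hp
  exact (mul_eq_zero.1 hp.symm).resolve_left (mon_ne_zero u)

lemma exists_chartHom_eq {a : ChartIdx} (y : Γ(P1P1, chart a)) : ∃ p, chartHom a p = y :=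
  (chartEquiv a).surjective y

lemma mon_nsmul (n : ℕ) (u : ℤ × ℤ) : mon (n • u) = mon u ^ n := by
  rw [AddMonoidAlgebra.single_pow, one_pow]

/-- A function on an intersection of charts is the quotient of a polynomial in the coordinates of
one of the charts by a monomial. -/
lemma exists_laurentHom_eq {a : ChartIdx} {T : Finset ChartIdx} (ha : a ∈ T)
    (y : Γ(P1P1, interF T)) : ∃ (n : ℕ) (p : MvPolynomial (Fin 2) ℂ),
      laurentHom (mon (-(n • locExp a T)) * chartLaurent a p) = resO (full_le_interF T) y := by
  obtain ⟨n, q, h⟩ := exists_pow_mul_eq_resO ha y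
  obtain ⟨p, rfl⟩ := exists_chartHom_eq q
  refine ⟨n, p, ?_⟩
  have h1 := congrArg (resO (full_le_interF T)) h
  rw [map_mul, map_pow, resO_resO, resO_resO, ← laurentHom_chartLaurent, ← laurentHom_locExp,
    ← map_pow, ← mon_nsmul] at h1
  rw [map_mul, ← h1, ← mul_assoc, ← map_mul, mon_neg_mul_mon, map_one, one_mul]

/-- Functions on the intersection of all charts are Laurent polynomials. -/
def laurentEquiv : Laurent ≃+* Γ(P1P1, full) :=
  RingEquiv.ofBijective laurentHom ⟨laurentHom_injective, fun y => by
    obtain ⟨n, p, h⟩ := exists_laurentHom_eq (Finset.mem_univ (toLex (0, 0))) y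
    refine ⟨_, h.trans ?_⟩
    change (P1P1.presheaf.map (𝟙 _)).hom y = y
    rw [CategoryTheory.Functor.map_id]
    rfl⟩

/-- A function on an open subset that contains the intersection of all charts, as a Laurent
polynomial. -/
def lau {V : P1P1.Opens} (hV : full ≤ V) : Γ(P1P1, V) →+* Laurent :=
  (laurentEquiv.symm : Γ(P1P1, full) →+* Laurent).comp (resO hV)

lemma lau_eq_iff {V : P1P1.Opens} (hV : full ≤ V) {g : Γ(P1P1, V)} {l : Laurent} :
    lau hV g = l ↔ resO hV g = laurentHom l :=
  laurentEquiv.symm_apply_eq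

lemma lau_resO {V W : P1P1.Opens} (hV : full ≤ V) (h : V ≤ W) (g : Γ(P1P1, W)) :
    lau hV (resO h g) = lau (hV.trans h) g := by
  rw [lau, lau, RingHom.comp_apply, RingHom.comp_apply, resO_resO]

lemma lau_scalar {V : P1P1.Opens} (hV : full ≤ V) (c : ℂ) :
    lau hV (scalar V c) = algebraMap ℂ Laurent c := by
  rw [lau_eq_iff, laurentHom_C, resO_scalar]

lemma lau_chartHom (a : ChartIdx) (p : MvPolynomial (Fin 2) ℂ) :
    lau (full_le_chart a) (chartHom a p) = chartLaurent a p := by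
  rw [lau_eq_iff, laurentHom_chartLaurent]

lemma lau_xCoord (a : ChartIdx) (k : Fin 2) :
    lau (full_le_chart a) (xCoord a k) = mon ((k : ℕ) - (a.fst : ℕ), 0) := by
  rw [lau_eq_iff, laurentHom_X, resO_xCoord]

lemma lau_zCoord (a : ChartIdx) (k : Fin 2) :
    lau (full_le_chart a) (zCoord a k) = mon (0, (k : ℕ) - (a.snd : ℕ)) := by
  rw [lau_eq_iff, laurentHom_Z, resO_zCoord]

lemma lau_injective {V : P1P1.Opens} (hV : full ≤ V) {T : Finset ChartIdx} (hT : T.Nonempty)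
    (hVT : V = interF T) : Function.Injective (lau hV) := by
  subst hVT
  exact laurentEquiv.symm.injective.comp (resO_interF_injective hT)

lemma neg_locExp_mem_cone {a : ChartIdx} {T : Finset ChartIdx} (ha : a ∈ T) :
    -locExp a T ∈ cone T := by
  have h1 : (∀ b ∈ T, b.fst = a.fst) → (locExp a T).1 = 0 := fun h => by
    rw [locExp, Prod.fst_sum]
    exact Finset.sum_eq_zero fun b hb => by simp [h b hb]
  have h2 : (∀ b ∈ T, b.snd = a.snd) → (locExp a T).2 = 0 := fun h => by
    rw [locExp, Prod.snd_sum]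
    exact Finset.sum_eq_zero fun b hb => by simp [h b hb]
  refine ⟨fun h => ?_, fun h => ?_, fun h => ?_, fun h => ?_⟩
  · simp [h1 fun b hb => (h b hb).trans (h a ha).symm]
  · simp [h1 fun b hb => (h b hb).trans (h a ha).symm]
  · simp [h2 fun b hb => (h b hb).trans (h a ha).symm]
  · simp [h2 fun b hb => (h b hb).trans (h a ha).symm]

/-- The functions on the intersection of the charts of `T` have their exponents in the cone of `T`.
-/
lemma lau_mem_regular {V : P1P1.Opens} (hV : full ≤ V) {T : Finset ChartIdx} (hT : T.Nonempty)
    (hVT : V = interF T) (g : Γ(P1P1, V)) : lau hV g ∈ regular T := by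
  subst hVT
  obtain ⟨a, ha⟩ := hT
  obtain ⟨n, p, h⟩ := exists_laurentHom_eq ha g
  rw [(lau_eq_iff hV).2 h.symm, ← smul_neg]
  exact mul_mem_regular (mon_mem_supp (nsmul_mem_cone (neg_locExp_mem_cone ha) n))
    (supp_mono (cone_mono (Finset.singleton_subset_iff.2 ha)) (chartLaurent_mem a p))

lemma exists_lau_eq_of_mem_singleton {V : P1P1.Opens} (hV : full ≤ V) {T : Finset ChartIdx}
    (hVT : V = interF T) {b : ChartIdx} (hb : b ∈ T) {l : Laurent} (hl : l ∈ regular {b}) :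
    ∃ g, lau hV g = l := by
  subst hVT
  obtain ⟨p, rfl⟩ := exists_chartLaurent_eq hl
  exact ⟨resO (interF_le hb) (chartHom b p), by rw [lau_resO, lau_chartHom]⟩

lemma exists_mem_regular_fst {T : Finset ChartIdx} (hT : T.Nonempty) {e : ℤ × ℤ} (he : e ∈ cone T) :
    ∃ b ∈ T, mon (e.1, 0) ∈ regular {b} := by
  obtain ⟨a, ha⟩ := hT
  rcases lt_trichotomy e.1 0 with h | h | h
  · obtain ⟨b, hb, hb'⟩ : ∃ b ∈ T, b.fst ≠ 0 := by
      by_contra! h'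
      exact absurd (he.1 h') (by omega)
    refine ⟨b, hb, mon_mem_supp (mem_cone_singleton.2 ⟨?_, fun _ => h.le, ?_, ?_⟩)⟩ <;> simp [hb']
  · exact ⟨a, ha, mon_mem_supp (mem_cone_singleton.2 ⟨by simp [h], by simp [h], by simp, by simp⟩)⟩
  · obtain ⟨b, hb, hb'⟩ : ∃ b ∈ T, b.fst ≠ 1 := by
      by_contra! h'
      exact absurd (he.2.1 h') (by omega)
    refine ⟨b, hb, mon_mem_supp (mem_cone_singleton.2 ⟨fun _ => h.le, ?_, ?_, ?_⟩)⟩ <;> simp [hb']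

lemma exists_mem_regular_snd {T : Finset ChartIdx} (hT : T.Nonempty) {e : ℤ × ℤ} (he : e ∈ cone T) :
    ∃ b ∈ T, mon (0, e.2) ∈ regular {b} := by
  obtain ⟨a, ha⟩ := hT
  rcases lt_trichotomy e.2 0 with h | h | h
  · obtain ⟨b, hb, hb'⟩ : ∃ b ∈ T, b.snd ≠ 0 := by
      by_contra! h'
      exact absurd (he.2.2.1 h') (by omega)
    refine ⟨b, hb, mon_mem_supp (mem_cone_singleton.2 ⟨?_, ?_, ?_, fun _ => h.le⟩)⟩ <;> simp [hb']
  · exact ⟨a, ha, mon_mem_supp (mem_cone_singleton.2 ⟨by simp, by simp, by simp [h], by simp [h]⟩)⟩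
  · obtain ⟨b, hb, hb'⟩ : ∃ b ∈ T, b.snd ≠ 1 := by
      by_contra! h'
      exact absurd (he.2.2.2 h') (by omega)
    refine ⟨b, hb, mon_mem_supp (mem_cone_singleton.2 ⟨?_, ?_, fun _ => h.le, ?_⟩)⟩ <;> simp [hb']

/-- Every Laurent polynomial with exponents in the cone of `T` is a function on the intersection of
the charts of `T`. Its monomials are products of a monomial in `x` and one in `z`, and each of these
is regular on some chart of `T`. -/
lemma exists_lau_eq {V : P1P1.Opens} (hV : full ≤ V) {T : Finset ChartIdx} (hT : T.Nonempty)
    (hVT : V = interF T) {l : Laurent} (hl : l ∈ regular T) : ∃ g, lau hV g = l := by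
  suffices h : l ∈ (lau hV).range from h
  rw [← AddMonoidAlgebra.sum_coeff_single l]
  refine sum_mem fun e he => ?_
  have he' := mem_supp_iff_support.1 hl e (Finsupp.mem_support_iff.1 he)
  obtain ⟨b, hb, h1⟩ := exists_mem_regular_fst hT he'
  obtain ⟨b', hb', h2⟩ := exists_mem_regular_snd hT he'
  have h3 : AddMonoidAlgebra.single e (l.coeff e) =
      algebraMap ℂ Laurent (l.coeff e) * (mon (e.1, 0) * mon (0, e.2)) := by
    rw [← mon_add, ← Algebra.smul_def, AddMonoidAlgebra.smul_single]
    simp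
  change AddMonoidAlgebra.single e (l.coeff e) ∈ _
  rw [h3]
  exact mul_mem ⟨_, lau_scalar hV _⟩ (mul_mem (exists_lau_eq_of_mem_singleton hV hVT hb h1)
    (exists_lau_eq_of_mem_singleton hV hVT hb' h2))

/-- The transition functions of `𝒪(m, n)` are monomials. -/
lemma lau_transition (m n : ℤ) (a b : ChartIdx) {V : P1P1.Opens} (hV : full ≤ V)
    (h : V ≤ chart a ⊓ chart b) :
    lau hV (resO h (transition m n a b)) = mon (tau m n a - tau m n b) := by
  have hz : ∀ m : ℤ, max m 0 - max (-m) 0 = m := fun m => by omega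
  simp only [lau_resO, transition, map_mul, map_pow, lau_xCoord, lau_zCoord]
  simp only [← mon_nsmul, ← mon_add]
  congr 1
  ext
  · simp [tau]
    linear_combination (((b.fst : ℕ) : ℤ) - (a.fst : ℕ)) * hz m
  · simp [tau]
    linear_combination (((b.snd : ℕ) : ℤ) - (a.snd : ℕ)) * hz n

/-! ### Quasi-coherent sheaves on affine open subsets -/

lemma fromSpec_image_le {X : Scheme.{0}} {U : X.Opens} (hU : IsAffineOpen U)
    (V : (Spec Γ(X, U)).Opens) : hU.fromSpec ''ᵁ V ≤ U := by
  refine (Scheme.Hom.image_le_opensRange _ _).trans ?_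
  rw [hU.opensRange_fromSpec]

lemma appIso_fromSpec_inv {X : Scheme.{0}} {U : X.Opens} (hU : IsAffineOpen U)
    (V : (Spec Γ(X, U)).Opens) (h : Γ(X, U)) :
    (hU.fromSpec.appIso V).inv.hom (((Spec Γ(X, U)).presheaf.map V.leTop.op).hom
      ((Scheme.ΓSpecIso Γ(X, U)).inv.hom h)) =
      (X.presheaf.map (homOfLE (fromSpec_image_le hU V)).op).hom h := by
  have h1 : (Scheme.ΓSpecIso Γ(X, U)).inv ≫ (Spec Γ(X, U)).presheaf.map V.leTop.op ≫
      (hU.fromSpec.appIso V).inv = X.presheaf.map (homOfLE (fromSpec_image_le hU V)).op := by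
    rw [← Category.assoc, Iso.comp_inv_eq, Scheme.Hom.appIso_hom', Scheme.Hom.map_appLE]
    rw [Scheme.Hom.appLE, hU.fromSpec_app_self, Category.assoc, ← Functor.map_comp]
    rfl
  exact congrArg (fun f => f.hom h) h1

lemma restrict_fromSpec_smul {X : Scheme.{0}} {U : X.Opens} (hU : IsAffineOpen U) (E : X.Modules)
    (V : (Spec Γ(X, U)).Opens) (h : Γ(X, U)) (x : Γ(E.restrict hU.fromSpec, V)) :
    (E.restrictAppIso hU.fromSpec V).hom (h • x) =
      X.presheaf.map (homOfLE (fromSpec_image_le hU V)).op h •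
        (E.restrictAppIso hU.fromSpec V).hom x := by
  rw [← appIso_fromSpec_inv, Scheme.Modules.smul_Spec_def]
  exact Scheme.Modules.smul_restrictAppIso_hom_apply _ _ _ _ _

/-- On an affine open subset, a quasi-coherent sheaf is given by localizations of its module of
sections. -/
lemma isLocalizing_restrict {X : Scheme.{0}} (E : X.Modules) (hE : E.IsQuasicoherent)
    {U : X.Opens} (hU : IsAffineOpen U) :
    IsLocalizing (modulesSpecToSheaf.obj (E.restrict hU.fromSpec)) := by
  rw [← isIso_fromTildeΓ_iff_isLocalizing]
  infer_instance

lemma exists_map_eq_pow_smul_Spec {R : CommRingCat.{0}} (M : (Spec R).Modules)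
    (hM : IsLocalizing (modulesSpecToSheaf.obj M)) (h : R) {D : (Spec R).Opens}
    (hD : PrimeSpectrum.basicOpen h = D) (y : Γ(M, D)) : ∃ (n : ℕ) (x : Γ(M, ⊤)),
      M.presheaf.map D.leTop.op x = h ^ n • y := by
  have h1 : IsLocalizedModule (.powers h) ((modulesSpecToSheaf.obj M).obj.map D.leTop.op).hom := by
    subst hD
    exact hM h
  obtain ⟨⟨x, s⟩, hx⟩ := h1.surj y
  obtain ⟨n, hn⟩ := s.2
  refine ⟨n, x, ?_⟩
  have hx' : s.1 • y = M.presheaf.map D.leTop.op x := hx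
  rw [← hx']
  exact congrArg (· • y) hn.symm

lemma exists_pow_smul_eq_zero_Spec {R : CommRingCat.{0}} (M : (Spec R).Modules)
    (hM : IsLocalizing (modulesSpecToSheaf.obj M)) (h : R) {D : (Spec R).Opens}
    (hD : PrimeSpectrum.basicOpen h = D) (x : Γ(M, ⊤))
    (hx : M.presheaf.map D.leTop.op x = 0) : ∃ n : ℕ, h ^ n • x = 0 := by
  have h1 : IsLocalizedModule (.powers h) ((modulesSpecToSheaf.obj M).obj.map D.leTop.op).hom := by
    subst hD
    exact hM h
  obtain ⟨s, hs⟩ := (IsLocalizedModule.eq_zero_iff (.powers h)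
    ((modulesSpecToSheaf.obj M).obj.map D.leTop.op).hom).1 hx
  obtain ⟨n, hn⟩ := s.2
  exact ⟨n, (congrArg (· • x) hn).trans hs⟩

/-- Sections of a quasi-coherent sheaf over a basic open subset of an affine open subset extend
after multiplication by a power of the equation. -/
lemma exists_map_eq_pow_smul {X : Scheme.{0}} (E : X.Modules) (hE : E.IsQuasicoherent)
    {U V : X.Opens} (hU : IsAffineOpen U) (h : Γ(X, U)) (hV : V = X.basicOpen h) (hVU : V ≤ U)
    (y : Γ(E, V)) : ∃ (n : ℕ) (x : Γ(E, U)), E.presheaf.map (homOfLE hVU).op x =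
      X.presheaf.map (homOfLE hVU).op (h ^ n) • y := by
  have hV' := hV.trans (hU.fromSpec_image_basicOpen h).symm
  subst hV'
  obtain ⟨n, x, hx⟩ := exists_map_eq_pow_smul_Spec _ (isLocalizing_restrict E hE hU) h rfl
    ((E.restrictAppIso hU.fromSpec (PrimeSpectrum.basicOpen h)).inv y)
  have htop : U ≤ hU.fromSpec ''ᵁ ⊤ := by
    rw [Scheme.Hom.image_top_eq_opensRange, hU.opensRange_fromSpec]
  have h1 := restrict_fromSpec_smul hU E (PrimeSpectrum.basicOpen h) (h ^ n)
    ((E.restrictAppIso hU.fromSpec (PrimeSpectrum.basicOpen h)).inv y)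
  have h2 : E.presheaf.map (homOfLE (hU.fromSpec.image_mono le_top)).op
    ((E.restrictAppIso hU.fromSpec ⊤).hom x) = _ :=
    (congrArg (E.restrictAppIso hU.fromSpec (PrimeSpectrum.basicOpen h)).hom hx).trans h1
  refine ⟨n, E.presheaf.map (homOfLE htop).op ((E.restrictAppIso hU.fromSpec ⊤).hom x), ?_⟩
  refine Eq.trans ?_ h2
  rw [← ConcreteCategory.comp_apply, ← Functor.map_comp]
  rfl

/-- A section over an affine open subset that vanishes on a basic open subset is annihilated by a
power of the equation. -/
lemma exists_pow_smul_eq_zero {X : Scheme.{0}} (E : X.Modules) (hE : E.IsQuasicoherent)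
    {U V : X.Opens} (hU : IsAffineOpen U) (h : Γ(X, U)) (hV : V = X.basicOpen h) (hVU : V ≤ U)
    (x : Γ(E, U)) (hx : E.presheaf.map (homOfLE hVU).op x = 0) : ∃ n : ℕ, h ^ n • x = 0 := by
  have hV' := hV.trans (hU.fromSpec_image_basicOpen h).symm
  subst hV'
  have htop : hU.fromSpec ''ᵁ ⊤ = U := by
    rw [Scheme.Hom.image_top_eq_opensRange, hU.opensRange_fromSpec]
  obtain ⟨n, hn⟩ := exists_pow_smul_eq_zero_Spec _ (isLocalizing_restrict E hE hU) h rfl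
    ((E.restrictAppIso hU.fromSpec ⊤).inv (E.presheaf.map (homOfLE htop.le).op x)) (by
      refine Eq.trans ?_ hx
      change (E.presheaf.map _) (E.presheaf.map _ x) = _
      rw [← ConcreteCategory.comp_apply, ← Functor.map_comp]
      rfl)
  refine ⟨n, ?_⟩
  have h1 := restrict_fromSpec_smul hU E ⊤ (h ^ n)
    ((E.restrictAppIso hU.fromSpec ⊤).inv (E.presheaf.map (homOfLE htop.le).op x))
  rw [hn, map_zero] at h1
  have h2 : (X.presheaf.map (homOfLE (fromSpec_image_le hU ⊤)).op) (h ^ n) •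
      E.presheaf.map (homOfLE htop.le).op x = 0 := h1.symm
  rw [← Scheme.Modules.map_smul] at h2
  have h3 := congrArg (E.presheaf.map (homOfLE htop.ge).op) h2
  rw [map_zero, ← ConcreteCategory.comp_apply, ← Functor.map_comp] at h3
  refine Eq.trans ?_ h3
  exact (congrArg (fun f => f.hom (h ^ n • x)) (E.presheaf.map_id _)).symm

/-! ### A criterion for coherence -/

lemma map_map {X : Scheme.{0}} (E : X.Modules) {U V W : X.Opens} (h : U ≤ V) (h' : V ≤ W)
    (x : Γ(E, W)) : E.presheaf.map (homOfLE h).op (E.presheaf.map (homOfLE h').op x) =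
      E.presheaf.map (homOfLE (h.trans h')).op x := by
  rw [← ConcreteCategory.comp_apply, ← Functor.map_comp]
  rfl

lemma map_self {X : Scheme.{0}} (E : X.Modules) {U : X.Opens} (h : U ≤ U)
    (x : Γ(E, U)) : E.presheaf.map (homOfLE h).op x = x :=
  congrArg (fun f => f.hom x) (E.presheaf.map_id _)

/-- The converse of `exists_map_eq_pow_smul` and `exists_pow_smul_eq_zero`: a sheaf whose sections
behave in this way on an affine open subset is given there by localizations of a module. -/
lemma isLocalizing_of_exists {X : Scheme.{0}} (E : X.Modules) {U : X.Opens} (hU : IsAffineOpen U)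
    (hsurj : ∀ (h : Γ(X, U)) (V : X.Opens) (_ : V = X.basicOpen h) (hVU : V ≤ U) (y : Γ(E, V)),
      ∃ (n : ℕ) (x : Γ(E, U)), E.presheaf.map (homOfLE hVU).op x =
        X.presheaf.map (homOfLE hVU).op (h ^ n) • y)
    (hinj : ∀ (h : Γ(X, U)) (V : X.Opens) (_ : V = X.basicOpen h) (hVU : V ≤ U) (x : Γ(E, U)),
      E.presheaf.map (homOfLE hVU).op x = 0 → ∃ n : ℕ, h ^ n • x = 0) :
    IsLocalizing (modulesSpecToSheaf.obj (E.restrict hU.fromSpec)) := by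
  intro h
  have htop : hU.fromSpec ''ᵁ ⊤ = U := by
    rw [Scheme.Hom.image_top_eq_opensRange, hU.opensRange_fromSpec]
  have hD := hU.fromSpec_image_basicOpen h
  refine IsLocalizedModule.Away.mk_of_addCommGroup ?_ ?_ ?_
  · exact Scheme.Modules.isUnit_algebraMap_end_of_le_basicOpen h le_rfl
  · intro y
    obtain ⟨n, x, hx⟩ := hsurj h _ hD (fromSpec_image_le hU _) y
    refine ⟨n, E.presheaf.map (homOfLE htop.le).op x, ?_⟩
    have h1 := restrict_fromSpec_smul hU E (PrimeSpectrum.basicOpen h) (h ^ n) y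
    refine h1.trans (hx.symm.trans ?_)
    have h2 := map_map E (hU.fromSpec.image_mono (U := PrimeSpectrum.basicOpen h) le_top) htop.le x
    exact h2.symm
  · intro x' hx'
    obtain ⟨n, hn⟩ := hinj h _ hD (fromSpec_image_le hU _) (E.presheaf.map (homOfLE htop.ge).op x')
      ((map_map E _ _ _).trans hx')
    refine ⟨n, ?_⟩
    have h1 := restrict_fromSpec_smul hU E ⊤ (h ^ n) x'
    refine h1.trans ?_
    have h3 := congrArg (E.presheaf.map (homOfLE htop.le).op) hn
    rw [map_zero, Scheme.Modules.map_smul] at h3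
    refine Eq.trans ?_ h3
    exact congrArg (_ • ·) ((map_map E _ _ _).trans (map_self E _ _)).symm

/-- The sheaf associated with a finitely generated module over a Noetherian ring has a finite
presentation. -/
lemma exists_presentation_tilde {R : CommRingCat.{0}} [IsNoetherianRing R] (N : ModuleCat.{0} R)
    [Module.Finite R N] : ∃ P : SheafOfModules.Presentation.{0} (tilde N), P.IsFinite := by
  obtain ⟨s, hs⟩ := Module.Finite.fg_top (R := R) (M := N)
  obtain ⟨t, ht⟩ := IsNoetherian.noetherian
    (LinearMap.ker (Finsupp.linearCombination R (fun x : (s : Set N) => (x : N))))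
  exact ⟨presentationTilde N s hs t ht,
    ⟨⟨inferInstanceAs (Finite s)⟩, ⟨inferInstanceAs (Finite t)⟩⟩⟩

/-- A finite presentation of the restriction of a sheaf of modules to an affine open subset, as a
sheaf on a spectrum, yields one of its restriction as a sheaf on the slice site. -/
lemma exists_presentation_over {X : Scheme.{0}} (E : X.Modules) {U : X.Opens} (hU : IsAffineOpen U)
    (P : SheafOfModules.Presentation.{0} (E.restrict hU.fromSpec)) (hP : P.IsFinite) :
    ∃ Q : SheafOfModules.Presentation.{0} (SheafOfModules.over.{0} E U), Q.IsFinite := by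
  let F : SheafOfModules.{0} (Spec Γ(X, U)).ringCatSheaf ⥤
      SheafOfModules.{0} (X.ringCatSheaf.over U) :=
    Scheme.Modules.restrictFunctor hU.isoSpec.hom ⋙ (Scheme.Modules.overEquiv U).inverse
  have : PreservesColimitsOfSize.{0, 0} (Scheme.Modules.restrictFunctor hU.isoSpec.hom ⋙
    (Scheme.Modules.overEquiv U).inverse) := inferInstance
  have : PreservesColimitsOfSize.{0, 0} F := this
  let e : Scheme.Modules.restrictFunctor hU.fromSpec ⋙ F ≅
      SheafOfModules.overFunctor X.ringCatSheaf U :=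
    (Functor.associator _ _ _).symm ≪≫ Functor.isoWhiskerRight
      ((Scheme.Modules.restrictFunctorComp _ _).symm ≪≫
        Scheme.Modules.restrictFunctorCongr hU.isoSpec_hom_fromSpec ≪≫
        (Scheme.Modules.overFunctorEquiv U).symm) _ ≪≫
      Functor.associator _ _ _ ≪≫
      Functor.isoWhiskerLeft _ (Scheme.Modules.overEquiv U).unitIso.symm ≪≫ Functor.rightUnitor _
  let η : SheafOfModules.unit (X.ringCatSheaf.over U) ≅
      F.obj (SheafOfModules.unit (Spec Γ(X, U)).ringCatSheaf) :=
    (e.app (SheafOfModules.unit X.ringCatSheaf)).symm ≪≫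
      F.mapIso (Scheme.Modules.restrictUnitIso hU.fromSpec)
  refine ⟨SheafOfModules.Presentation.ofIsIso.{0} (e.app E).hom (P.map F η), ?_⟩
  have : (P.map F η).IsFinite :=
    ⟨⟨hP.isFiniteType_generators.finite⟩, ⟨hP.isFiniteType_relations.finite⟩⟩
  infer_instance

/-- A sheaf is coherent if its modules of sections over the charts are finitely generated, and if
its sections over basic open subsets of the charts are obtained by localization. -/
lemma isCoherent_of_exists (E : P1P1.Modules)
    (hfin : ∀ a, Module.Finite Γ(P1P1, chart a) Γ(E, chart a))
    (hsurj : ∀ a (h : Γ(P1P1, chart a)) (V : P1P1.Opens) (_ : V = P1P1.basicOpen h)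
      (hVU : V ≤ chart a) (y : Γ(E, V)), ∃ (n : ℕ) (x : Γ(E, chart a)),
        E.presheaf.map (homOfLE hVU).op x = P1P1.presheaf.map (homOfLE hVU).op (h ^ n) • y)
    (hinj : ∀ a (h : Γ(P1P1, chart a)) (V : P1P1.Opens) (_ : V = P1P1.basicOpen h)
      (hVU : V ≤ chart a) (x : Γ(E, chart a)),
        E.presheaf.map (homOfLE hVU).op x = 0 → ∃ n : ℕ, h ^ n • x = 0) : IsCoherent E := by
  have h : ∀ a, ∃ Q : SheafOfModules.Presentation.{0} (SheafOfModules.over.{0} E (chart a)),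
      Q.IsFinite := by
    intro a
    have hU := isAffineOpen_chart a
    have hiso : IsIso (E.restrict hU.fromSpec).fromTildeΓ := by
      rw [isIso_fromTildeΓ_iff_isLocalizing]
      exact isLocalizing_of_exists E hU (hsurj a) (hinj a)
    have : IsNoetherianRing Γ(P1P1, chart a) :=
      isNoetherianRing_of_ringEquiv _ (chartEquiv a)
    have htop : hU.fromSpec ''ᵁ ⊤ = chart a := by
      rw [Scheme.Hom.image_top_eq_opensRange, hU.opensRange_fromSpec]
    have : Module.Finite Γ(P1P1, chart a)
        ((modulesSpecToSheaf.obj (E.restrict hU.fromSpec)).presheaf.obj (.op ⊤)) := by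
      have := hfin a
      let φ : Γ(E, chart a) →ₗ[Γ(P1P1, chart a)]
        ((modulesSpecToSheaf.obj (E.restrict hU.fromSpec)).presheaf.obj (.op ⊤)) :=
        { toFun := fun x => E.presheaf.map (homOfLE htop.le).op x
          map_add' := fun x y => map_add (E.presheaf.map (homOfLE htop.le).op).hom x y
          map_smul' := fun r x => (Scheme.Modules.map_smul E (homOfLE htop.le) r x).trans
            (restrict_fromSpec_smul hU E ⊤ r _).symm }
      refine Module.Finite.of_surjective φ fun y => ?_
      refine ⟨E.presheaf.map (homOfLE htop.ge).op y, ?_⟩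
      exact (map_map E htop.le htop.ge y).trans (map_self E _ _)
    obtain ⟨P, hP⟩ := exists_presentation_tilde
      ((modulesSpecToSheaf.obj (E.restrict hU.fromSpec)).presheaf.obj (.op ⊤))
    let f : @Quiver.Hom (SheafOfModules.{0} (Spec Γ(P1P1, chart a)).ringCatSheaf) _ (tilde _) _ :=
      (E.restrict hU.fromSpec).fromTildeΓ
    have hf : IsIso f := hiso
    exact exists_presentation_over E hU (SheafOfModules.Presentation.ofIsIso.{0} f P)
      ⟨⟨hP.isFiniteType_generators.finite⟩, ⟨hP.isFiniteType_relations.finite⟩⟩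
  choose Q hQ using h
  let q : SheafOfModules.QuasicoherentData.{0} E :=
    { I := ChartIdx
      X := chart
      coversTop := by
        rw [Opens.coversTop_iff]
        exact iSup_chart
      presentation := Q }
  have hq : q.IsFinitePresentation := ⟨hQ⟩
  have : SheafOfModules.IsFinitePresentation.{0} E := ⟨⟨q, hq⟩⟩
  exact ⟨SheafOfModules.instIsQuasicoherentOfIsFinitePresentation.{0} E,
    SheafOfModules.instIsFiniteTypeOfIsFinitePresentation.{0} E⟩

/-! ### Functions on the curve -/

section

variable {C : Scheme.{0}} (i : C ⟶ P1P1)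

/-- Restriction of functions to the curve. -/
def toO (V : P1P1.Opens) (g : Γ(P1P1, V)) : Sec (structureSheaf i) V :=
  show Γ(C, i ⁻¹ᵁ V) from (i.app V).hom g

lemma toO_add (V : P1P1.Opens) (g h : Γ(P1P1, V)) : toO i V (g + h) = toO i V g + toO i V h :=
  map_add (i.app V).hom g h

lemma toO_mul (V : P1P1.Opens) (g h : Γ(P1P1, V)) : toO i V (g * h) = g • toO i V h :=
  map_mul (i.app V).hom g h

lemma toO_zero (V : P1P1.Opens) : toO i V 0 = 0 :=
  map_zero (i.app V).hom

lemma res_toO {V W : P1P1.Opens} (h : V ≤ W) (g : Γ(P1P1, W)) :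
    res (structureSheaf i) h (toO i W g) = toO i V (resO h g) :=
  (congrArg (fun f => f.hom g) (i.naturality (homOfLE h).op)).symm

lemma toO_surjective [IsClosedImmersion i] {V : P1P1.Opens} (hV : IsAffineOpen V) :
    Function.Surjective (toO i V) :=
  i.app_surjective V hV

lemma isAffineOpen_preimage [IsClosedImmersion i] {V : P1P1.Opens} (hV : IsAffineOpen V) :
    IsAffineOpen (i ⁻¹ᵁ V) := hV.preimage i

end

/-- On the intersection of the charts of `T`, the ideal of the curve is generated by the
dehomogenized equation of any chart of `T`. -/
lemma toO_eq_zero_iff {C : Scheme.{0}} {i : C ⟶ P1P1} [IsClosedImmersion i] {f : BiPoly}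
    (hf : ∀ a : ChartIdx, RingHom.ker (i.app (chart a)).hom = Ideal.span {dehomogenize f a})
    {a : ChartIdx} {T : Finset ChartIdx} (ha : a ∈ T) {g : Γ(P1P1, interF T)} :
    toO i _ g = 0 ↔ ∃ h, g = resO (interF_le ha) (dehomogenize f a) * h := by
  have h0 : toO i (chart a) (dehomogenize f a) = 0 := by
    have : dehomogenize f a ∈ RingHom.ker (i.app (chart a)).hom := by
      rw [hf a]
      exact Ideal.mem_span_singleton_self _
    exact this
  constructor
  · intro hg
    obtain ⟨n, p, h⟩ := exists_pow_mul_eq_resO ha g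
    have h1 : res (structureSheaf i) (interF_le ha) (toO i _ p) = 0 := by
      rw [res_toO, ← h, toO_mul, hg, smul_zero]
    obtain ⟨m, hm⟩ := exists_pow_mul_eq_zero (isAffineOpen_preimage i (isAffineOpen_chart a))
      (g := (i.app (chart a)).hom (locElem a T)) (V := i ⁻¹ᵁ interF T)
      (by rw [interF_eq_basicOpen ha, Scheme.preimage_basicOpen])
      (i.preimage_mono (interF_le ha)) _ h1
    have h2 : locElem a T ^ m * p ∈ RingHom.ker (i.app (chart a)).hom := by
      rw [RingHom.mem_ker, map_mul, map_pow]
      exact hm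
    rw [hf a] at h2
    obtain ⟨q, hq⟩ := Ideal.mem_span_singleton.1 h2
    have h3 := congrArg (resO (interF_le ha)) hq
    rw [map_mul, map_mul, ← h, ← mul_assoc, map_pow, ← pow_add] at h3
    obtain ⟨u, hu⟩ := (isUnit_resO_locElem ha).pow (m + n)
    refine ⟨resO (interF_le ha) q * ↑u⁻¹, ?_⟩
    rw [← mul_assoc, ← h3, ← hu, mul_comm, ← mul_assoc, Units.inv_mul, one_mul]
  · rintro ⟨h, rfl⟩
    rw [mul_comm, toO_mul, ← res_toO, h0, map_zero, smul_zero]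

/-! ### Morphisms on sections -/

section

variable {E F G : P1P1.Modules} (φ : E ⟶ F)

/-- The map on sections of a morphism of sheaves of modules. -/
def secMap (V : P1P1.Opens) (y : Sec E V) : Sec F V :=
  show Γ(F, V) from φ.app V (show Γ(E, V) from y)

lemma secMap_add (V : P1P1.Opens) (y z : Sec E V) :
    secMap φ V (y + z) = secMap φ V y + secMap φ V z :=
  map_add (φ.app V).hom y z

lemma secMap_zero (V : P1P1.Opens) : secMap φ V 0 = 0 := map_zero (φ.app V).hom

lemma secMap_smul (V : P1P1.Opens) (g : Γ(P1P1, V)) (y : Sec E V) :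
    secMap φ V (g • y) = g • secMap φ V y :=
  Scheme.Modules.Hom.app_smul φ g y

lemma res_secMap {V W : P1P1.Opens} (h : V ≤ W) (y : Sec E W) :
    res F h (secMap φ W y) = secMap φ V (res E h y) :=
  (congrArg (fun f => f.hom y) (φ.mapPresheaf.naturality (homOfLE h).op)).symm

lemma secMap_injective [Mono φ] (V : P1P1.Opens) : Function.Injective (secMap φ V) := by
  have h : Mono ((Scheme.Modules.toPresheaf P1P1).map φ) := inferInstance
  have h1 := (NatTrans.mono_iff_mono_app _).1 h (.op V)
  exact (AddCommGrpCat.mono_iff_injective _).1 h1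

end

/-! ### The equation of the curve -/

/-- The equation of a curve on the chart `(0, 0)`, as a Laurent polynomial. -/
def curveEq (f : BiPoly) : Laurent :=
  lau (full_le_chart (toLex (0, 0))) (dehomogenize f (toLex (0, 0)))

/-- The exponent of a monomial in the coordinates of a chart. -/
def dehomExp (a : ChartIdx) (d : Fin 2 ⊕ Fin 2 →₀ ℕ) : ℤ × ℤ :=
  (d (.inl 0) * (0 - (a.fst : ℕ)) + d (.inl 1) * (1 - (a.fst : ℕ)),
    d (.inr 0) * (0 - (a.snd : ℕ)) + d (.inr 1) * (1 - (a.snd : ℕ)))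

lemma lau_dehomogenize (f : BiPoly) (a : ChartIdx) :
    lau (full_le_chart a) (dehomogenize f a) =
      ∑ d ∈ f.support, AddMonoidAlgebra.single (dehomExp a d) (f.coeff d) := by
  rw [dehomogenize, MvPolynomial.eval₂_eq', map_sum]
  refine Finset.sum_congr rfl fun d _ => ?_
  rw [map_mul, lau_scalar, map_prod, Fintype.prod_sum_type, Fin.prod_univ_two, Fin.prod_univ_two]
  simp only [Sum.elim_inl, Sum.elim_inr, map_pow, lau_xCoord, lau_zCoord, ← mon_nsmul, ← mon_add]
  rw [← Algebra.smul_def, AddMonoidAlgebra.smul_single, smul_eq_mul, mul_one]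
  congr 1
  ext <;> simp [dehomExp]

lemma degree_of_mem_support {f : BiPoly} {s r : ℕ} (hf : IsBihomogeneous f s r)
    {d : Fin 2 ⊕ Fin 2 →₀ ℕ} (hd : d ∈ f.support) :
    d (.inl 0) + d (.inl 1) = s ∧ d (.inr 0) + d (.inr 1) = r := by
  have h := hf (MvPolynomial.mem_support_iff.1 hd)
  rw [Finsupp.weight_apply, Finsupp.sum_fintype _ _ (by simp), Fintype.sum_sum_type,
    Fin.sum_univ_two, Fin.sum_univ_two, Prod.ext_iff] at h
  simpa using h

/-- The equations of a curve of bidegree `(s, r)` on the charts are the local expressions of a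
section of `𝒪(s, r)`. -/
lemma lau_dehomogenize_eq {f : BiPoly} {s r : ℕ} (hf : IsBihomogeneous f s r) (a : ChartIdx) :
    lau (full_le_chart a) (dehomogenize f a) = mon (tau s r a) * curveEq f := by
  rw [curveEq, lau_dehomogenize, lau_dehomogenize, Finset.mul_sum]
  refine Finset.sum_congr rfl fun d hd => ?_
  obtain ⟨h1, h2⟩ := degree_of_mem_support hf hd
  rw [AddMonoidAlgebra.single_mul_single, one_mul]
  congr 1
  ext
  · simp [dehomExp, tau, ← h1, ChartIdx.fst]
    ring
  · simp [dehomExp, tau, ← h2, ChartIdx.snd]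
    ring

lemma curveEq_ne_zero {f : BiPoly} (hf0 : f ≠ 0) {s r : ℕ} (hf : IsBihomogeneous f s r) :
    curveEq f ≠ 0 := by
  obtain ⟨d₀, hd₀⟩ := MvPolynomial.support_nonempty.2 hf0
  intro h
  have h1 := congrArg (fun g => AddMonoidAlgebra.coeff g (dehomExp (toLex (0, 0)) d₀)) h
  simp only [curveEq, lau_dehomogenize] at h1
  rw [AddMonoidAlgebra.coeff_sum, Finsupp.finsetSum_apply, Finset.sum_eq_single d₀] at h1
  · rw [AddMonoidAlgebra.coeff_single, Finsupp.single_eq_same] at h1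
    exact MvPolynomial.mem_support_iff.1 hd₀ h1
  · intro d hd hne
    rw [AddMonoidAlgebra.coeff_single, Finsupp.single_apply, if_neg]
    intro he
    apply hne
    obtain ⟨e1, e2⟩ := degree_of_mem_support hf hd
    obtain ⟨e3, e4⟩ := degree_of_mem_support hf hd₀
    simp [dehomExp, ChartIdx.fst, ChartIdx.snd] at he
    ext k
    rcases k with k | k <;> fin_cases k <;> simp <;> omega
  · exact fun h => absurd hd₀ h

lemma interF_singleton (a : ChartIdx) : interF {a} = chart a := Finset.inf_singleton

lemma curveEq_mem {f : BiPoly} {s r : ℕ} (hf : IsBihomogeneous f s r) (a : ChartIdx) :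
    mon (tau s r a) * curveEq f ∈ regular {a} := by
  rw [← lau_dehomogenize_eq hf]
  exact lau_mem_regular _ (Finset.singleton_nonempty a) (interF_singleton a).symm _

/-! ### Subsheaves of the structure sheaf as systems of ideals -/

section

variable {C : Scheme.{0}} {i : C ⟶ P1P1} {E : P1P1.Modules} (φ : E ⟶ structureSheaf i)

/-- The Laurent polynomial `l` is a regular function on `V` whose restriction to the curve is the
section `y` of the subsheaf `E` of its structure sheaf. -/
def Represents {V : P1P1.Opens} (hV : full ≤ V) (y : Sec E V) (l : Laurent) : Prop :=
  ∃ g, lau hV g = l ∧ secMap φ V y = toO i V g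

variable {φ} {V W : P1P1.Opens} {hV : full ≤ V} {y z : Sec E V} {l k : Laurent}

lemma Represents.add (h : Represents φ hV y l) (h' : Represents φ hV z k) :
    Represents φ hV (y + z) (l + k) := by
  obtain ⟨g, rfl, hg⟩ := h
  obtain ⟨g', rfl, hg'⟩ := h'
  exact ⟨g + g', map_add _ _ _, by rw [secMap_add, hg, hg', toO_add]⟩

lemma Represents.smul (h : Represents φ hV y l) (g : Γ(P1P1, V)) :
    Represents φ hV (g • y) (lau hV g * l) := by
  obtain ⟨g', rfl, hg'⟩ := h
  exact ⟨g * g', map_mul _ _ _, by rw [secMap_smul, hg', toO_mul]⟩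

lemma Represents.smulC (h : Represents φ hV y l) (c : ℂ) :
    Represents φ hV (c • y) (c • l) := by
  have := h.smul (scalar V c)
  rwa [lau_scalar, ← Algebra.smul_def] at this

lemma represents_zero : Represents φ hV (0 : Sec E V) 0 :=
  ⟨0, map_zero _, by rw [secMap_zero, toO_zero]⟩

lemma Represents.res (h : Represents φ hV y l) (hW : full ≤ W) (hWV : W ≤ V) :
    Represents φ hW (res E hWV y) l := by
  obtain ⟨g, rfl, hg⟩ := h
  exact ⟨resO hWV g, lau_resO _ _ _, by rw [← res_secMap, hg, res_toO]⟩

lemma Represents.unique [Mono φ] {T : Finset ChartIdx} (hT : T.Nonempty) (hVT : V = interF T)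
    (h : Represents φ hV y l) (h' : Represents φ hV z l) : y = z := by
  obtain ⟨g, rfl, hg⟩ := h
  obtain ⟨g', he, hg'⟩ := h'
  rw [lau_injective hV hT hVT he] at hg'
  exact secMap_injective φ V (hg.trans hg'.symm)

lemma exists_represents [IsClosedImmersion i] (φ : E ⟶ structureSheaf i) {T : Finset ChartIdx}
    (hT : T.Nonempty) (hVT : V = interF T)
    (y : Sec E V) : ∃ l, Represents φ hV y l := by
  obtain ⟨g, hg⟩ := toO_surjective i (V := V) (hVT ▸ isAffineOpen_interF hT) (secMap φ V y)
  exact ⟨_, g, rfl, hg.symm⟩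

lemma Represents.mem_regular {T : Finset ChartIdx}
    (hT : T.Nonempty) (hVT : V = interF T) (h : Represents φ hV y l) : l ∈ regular T := by
  obtain ⟨g, rfl, -⟩ := h
  exact lau_mem_regular hV hT hVT g

end

/-- The zero section is represented by the multiples of the equation of the curve. -/
lemma represents_zero_iff {C : Scheme.{0}} {i : C ⟶ P1P1} {f : BiPoly} {s r : ℕ}
    [IsClosedImmersion i] (hf : IsBihomogeneous f s r)
    (hker : ∀ a : ChartIdx, RingHom.ker (i.app (chart a)).hom = Ideal.span {dehomogenize f a})
    {E : P1P1.Modules} (φ : E ⟶ structureSheaf i) {V : P1P1.Opens} {hV : full ≤ V}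
    {T : Finset ChartIdx} {a : ChartIdx} (ha : a ∈ T) (hVT : V = interF T) {l : Laurent} :
    Represents φ hV 0 l ↔ ∃ q ∈ regular T, l = mon (tau s r a) * curveEq f * q := by
  subst hVT
  rw [← lau_dehomogenize_eq hf]
  constructor
  · rintro ⟨g, rfl, hg⟩
    rw [secMap_zero] at hg
    obtain ⟨h, rfl⟩ := (toO_eq_zero_iff hker ha).1 hg.symm
    exact ⟨lau hV h, lau_mem_regular _ ⟨a, ha⟩ rfl _, by rw [map_mul, lau_resO]⟩
  · rintro ⟨q, hq, rfl⟩
    obtain ⟨h, rfl⟩ := exists_lau_eq hV ⟨a, ha⟩ rfl hq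
    refine ⟨resO (interF_le ha) (dehomogenize f a) * h, by rw [map_mul, lau_resO], ?_⟩
    rw [secMap_zero, (toO_eq_zero_iff hker ha).2 ⟨h, rfl⟩]

lemma locExp_mem_cone (a : ChartIdx) (T : Finset ChartIdx) : locExp a T ∈ cone {a} := by
  have h : ∀ b : ChartIdx, (((b.fst : ℕ) : ℤ) - (a.fst : ℕ), ((b.snd : ℕ) : ℤ) - (a.snd : ℕ)) ∈
      cone {a} := by
    intro b
    rw [mem_cone_singleton]
    generalize a.fst = i
    generalize a.snd = j
    generalize b.fst = k
    generalize b.snd = l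
    revert i j k l
    decide
  induction T using Finset.induction_on with
  | empty => exact zero_mem_cone _
  | insert b T hb ih =>
    rw [locExp, Finset.sum_insert hb]
    exact add_mem_cone (h b) ih

lemma lau_locElem (a : ChartIdx) (T : Finset ChartIdx) :
    lau (full_le_chart a) (locElem a T) = mon (locExp a T) := by
  rw [lau_eq_iff, laurentHom_locExp]

/-- A quasi-coherent subsheaf of the structure sheaf of a curve, as a system of ideals: the
functions whose restrictions to the curve belong to the subsheaf. -/
def sheafIdeal {C : Scheme.{0}} {i : C ⟶ P1P1} {f : BiPoly} {s r : ℕ} [IsClosedImmersion i]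
    (hf : IsBihomogeneous f s r)
    (hker : ∀ a : ChartIdx, RingHom.ker (i.app (chart a)).hom = Ideal.span {dehomogenize f a})
    {E : P1P1.Modules} (hE : SheafOfModules.IsQuasicoherent.{0} E) (φ : E ⟶ structureSheaf i) :
    IdealSystem where
  J T :=
    { carrier := {l | ∃ y, Represents φ (full_le_interF T) y l}
      add_mem' := fun ⟨_, h⟩ ⟨_, h'⟩ => ⟨_, h.add h'⟩
      zero_mem' := ⟨0, represents_zero⟩
      smul_mem' := fun c _ ⟨_, h⟩ => ⟨_, h.smulC c⟩ }
  le_regular hT := fun l ⟨_, h⟩ => h.mem_regular hT rfl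
  mul_mem {T g l} hT hg h := by
    obtain ⟨y, hy⟩ := h
    obtain ⟨g', rfl⟩ := exists_lau_eq (full_le_interF T) hT rfl hg
    exact ⟨_, hy.smul g'⟩
  mono _ h _ := fun ⟨_, hy⟩ => ⟨_, hy.res (full_le_interF _) (interF_mono h)⟩
  loc {T a l} ha h := by
    obtain ⟨y, hy⟩ := h
    obtain ⟨n, x, hx⟩ := exists_map_eq_pow_smul E hE (isAffineOpen_chart a) (locElem a T)
      (interF_eq_basicOpen ha) (interF_le ha) y
    obtain ⟨k, hk⟩ := exists_represents (hV := full_le_chart a) φ (Finset.singleton_nonempty a)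
      (interF_singleton a).symm x
    -- Over the intersection of the charts of `T`, the two representatives of `x` differ by a
    -- multiple of the equation of the curve.
    have h1 : Represents φ (full_le_interF T) (0 : Sec E (interF T))
        (k - mon (n • locExp a T) * l) := by
      have h2 := hk.res (full_le_interF T) (interF_le ha)
      have h3 := hy.smul (resO (interF_le ha) (locElem a T ^ n))
      rw [lau_resO, map_pow (lau (full_le_chart a)), lau_locElem, ← mon_nsmul] at h3
      have h4 := h2.add (h3.smulC (-1))
      rw [neg_one_smul, neg_one_smul, ← sub_eq_add_neg, ← sub_eq_add_neg] at h4
      have h5 : res E (interF_le ha) x - resO (interF_le ha) (locElem a T ^ n) • y = 0 :=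
        sub_eq_zero.2 hx
      rwa [h5] at h4
    obtain ⟨q, hq, h6⟩ := (represents_zero_iff hf hker φ ha rfl).1 h1
    obtain ⟨u, hu, hu', huq⟩ := exists_mem_cone_neg_mem_cone ha hq
    refine ⟨u + n • locExp a T, add_mem_cone hu (nsmul_mem_cone (locExp_mem_cone a T) n), ?_, ?_⟩
    · rw [neg_add, ← smul_neg]
      exact add_mem_cone hu' (nsmul_mem_cone (neg_locExp_mem_cone ha) n)
    · obtain ⟨g, hg⟩ := exists_lau_eq (full_le_chart a) (Finset.singleton_nonempty a)
        (interF_singleton a).symm (mon_mem_supp hu)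
      have h7 := hk.smul g
      have h8 := (represents_zero_iff (V := chart a) (hV := full_le_chart a) hf hker φ
        (Finset.mem_singleton_self a) (interF_singleton a).symm).2 ⟨_, huq, rfl⟩
      have h9 := h7.add (h8.smulC (-1))
      have h10 : lau (full_le_chart a) g * k +
          (-1 : ℂ) • (mon (tau s r a) * curveEq f * (mon u * q)) =
            mon (u + n • locExp a T) * l := by
        rw [hg, mon_add, neg_one_smul]
        linear_combination mon u * h6
      rw [h10] at h9
      exact ⟨_, h9.res (full_le_interF _) (interF_singleton a).le⟩

lemma mem_sheafIdeal {C : Scheme.{0}} {i : C ⟶ P1P1} {f : BiPoly} {s r : ℕ} [IsClosedImmersion i]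
    {hf : IsBihomogeneous f s r}
    {hker : ∀ a : ChartIdx, RingHom.ker (i.app (chart a)).hom = Ideal.span {dehomogenize f a}}
    {E : P1P1.Modules} {hE : SheafOfModules.IsQuasicoherent.{0} E} {φ : E ⟶ structureSheaf i}
    {V : P1P1.Opens} {hV : full ≤ V} {T : Finset ChartIdx} (hVT : V = interF T) {l : Laurent} :
    l ∈ (sheafIdeal hf hker hE φ).J T ↔ ∃ y, Represents φ hV y l := by
  subst hVT
  exact Iff.rfl

/-! ### Comparison of complexes -/

/-- If a linear relation identifies the graded pieces of a complex `Y` with the quotients of the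
complexes `M` and `N`, then it identifies the cohomology of `Y` with that of `M / N`. -/
lemma nonempty_relH_equiv {K X : Type*} [Field K] [AddCommGroup X] [Module K X] {d : X →ₗ[K] X}
    {M N : SubCx d} {Y : ℕ → Type*} [∀ p, AddCommGroup (Y p)] [∀ p, Module K (Y p)]
    (δ : ∀ p, Y p →ₗ[K] Y (p + 1)) (B : ∀ p, Submodule K (Y p)) (hB0 : B 0 = ⊥)
    (hB : ∀ p, B (p + 1) = LinearMap.range (δ p)) (R : ∀ p, Submodule K (X × Y p))
    (hRM : ∀ {p x y}, (x, y) ∈ R p → x ∈ M.carr (p + 1))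
    (hMR : ∀ {p x}, x ∈ M.carr (p + 1) → ∃ y, (x, y) ∈ R p)
    (hYR : ∀ {p} (y : Y p), ∃ x, (x, y) ∈ R p)
    (hRN : ∀ {p x}, (x, 0) ∈ R p ↔ x ∈ N.carr (p + 1))
    (hR0 : ∀ {p y}, (0, y) ∈ R p → y = 0)
    (hRd : ∀ {p x y}, (x, y) ∈ R p → (d x, δ p y) ∈ R (p + 1)) (p : ℕ) :
    Nonempty (RelH M N p ≃ₗ[K] (LinearMap.ker (δ p) ⧸
      (B p).comap (LinearMap.ker (δ p)).subtype)) := by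
  have huniq : ∀ {p x y z}, (x, y) ∈ R p → (x, z) ∈ R p → y = z := by
    intro p x y z hy hz
    have := (R p).sub_mem hy hz
    rw [Prod.mk_sub_mk, sub_self] at this
    exact sub_eq_zero.1 (hR0 this)
  choose! G hG using fun p x => @hMR p x
  have hcyc : ∀ x : cyc M N p, G p x ∈ LinearMap.ker (δ p) := by
    intro x
    obtain ⟨h1, h2⟩ := mem_cyc.1 x.2
    exact huniq (hRd (hG p x h1)) (hRN.2 h2)
  let g : cyc M N p →ₗ[K] LinearMap.ker (δ p) :=
    { toFun := fun x => ⟨G p x, hcyc x⟩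
      map_add' := fun x y => Subtype.ext (huniq (hG p _ (mem_cyc.1 (x + y).2).1)
        ((R p).add_mem (hG p _ (mem_cyc.1 x.2).1) (hG p _ (mem_cyc.1 y.2).1)))
      map_smul' := fun c x => Subtype.ext (huniq (hG p _ (mem_cyc.1 (c • x).2).1)
        ((R p).smul_mem c (hG p _ (mem_cyc.1 x.2).1))) }
  let ψ := ((B p).comap (LinearMap.ker (δ p)).subtype).mkQ ∘ₗ g
  have hψ : Function.Surjective ψ := by
    intro y
    obtain ⟨⟨y, hy⟩, rfl⟩ := Submodule.Quotient.mk_surjective _ y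
    obtain ⟨x, hx⟩ := hYR y
    have h1 := hRd hx
    rw [LinearMap.mem_ker.1 hy] at h1
    refine ⟨⟨x, mem_cyc.2 ⟨hRM hx, hRN.1 h1⟩⟩, ?_⟩
    change Submodule.Quotient.mk _ = _
    congr 1
    exact Subtype.ext (huniq (hG p x (hRM hx)) hx)
  have hmem : ∀ x ∈ M.carr (p + 1), G p x ∈ B p ↔ x ∈ bdy M N p := by
    intro x hx
    rw [mem_bdy]
    cases p with
    | zero =>
      rw [hB0, Submodule.mem_bot]
      constructor
      · intro h
        refine ⟨0, zero_mem _, ?_⟩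
        rw [map_zero, sub_zero, ← hRN, ← h]
        exact hG 0 x hx
      · rintro ⟨m, hm, h⟩
        rw [M.zero, Submodule.mem_bot] at hm
        rw [hm, map_zero, sub_zero, ← hRN] at h
        exact huniq (hG 0 x hx) h
    | succ p =>
      rw [hB, LinearMap.mem_range]
      constructor
      · rintro ⟨y, hy⟩
        obtain ⟨m, hm⟩ := hYR y
        refine ⟨m, hRM hm, ?_⟩
        have h1 := (R (p + 1)).sub_mem (hG (p + 1) x hx) (hRd hm)
        rw [Prod.mk_sub_mk, hy, sub_self] at h1
        exact hRN.1 h1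
      · rintro ⟨m, hm, h⟩
        refine ⟨G p m, ?_⟩
        have h1 := (R (p + 1)).add_mem (hRN.2 h) (hRd (hG p m hm))
        rw [Prod.mk_add_mk, sub_add_cancel, zero_add] at h1
        exact huniq h1 (hG (p + 1) x hx)
  have hker : LinearMap.ker ψ = (bdy M N p).submoduleOf (cyc M N p) := by
    ext x
    rw [LinearMap.mem_ker, LinearMap.comp_apply, Submodule.mkQ_apply, Submodule.Quotient.mk_eq_zero]
    exact hmem x (mem_cyc.1 x.2).1
  exact ⟨(Submodule.quotEquivOfEq _ _ hker.symm).trans (ψ.quotKerEquivOfSurjective hψ)⟩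

/-! ### Cochains of subsheaves of the structure sheaf -/

/-- The set of charts of a sequence. -/
abbrev idxSet {p : ℕ} (σ : CechIdx p) : Finset ChartIdx := Finset.univ.map σ.toEmbedding

lemma idxSet_injective {p : ℕ} : Function.Injective (idxSet (p := p)) := by
  intro σ τ h
  have h1 : Set.range σ = Set.range τ := by
    have := congrArg (fun T : Finset ChartIdx => (T : Set ChartIdx)) h
    simpa using this
  exact DFunLike.coe_injective ((StrictMono.range_inj σ.strictMono τ.strictMono).1 h1)

lemma card_idxSet {p : ℕ} (σ : CechIdx p) : (idxSet σ).card = p + 1 := by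
  rw [Finset.card_map, Finset.card_univ, Fintype.card_fin]

lemma mem_idxSet {p : ℕ} (σ : CechIdx p) (k : Fin (p + 1)) : σ k ∈ idxSet σ :=
  Finset.mem_map_of_mem _ (Finset.mem_univ k)

lemma exists_idxSet_eq {p : ℕ} {T : Finset ChartIdx} (hT : T.card = p + 1) :
    ∃ σ : CechIdx p, idxSet σ = T := by
  refine ⟨T.orderEmbOfFin hT, ?_⟩
  ext a
  have h := Set.ext_iff.1 (Finset.range_orderEmbOfFin T hT) a
  rw [Finset.mem_coe] at h
  rw [← h, idxSet, Finset.mem_map, Set.mem_range]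
  exact ⟨fun ⟨k, _, hk⟩ => ⟨k, hk⟩, fun ⟨k, hk⟩ => ⟨k, Finset.mem_univ k, hk⟩⟩

lemma idxSet_face {p : ℕ} (σ : CechIdx (p + 1)) (k : Fin (p + 2)) :
    idxSet (face σ k) = (idxSet σ).erase (σ k) := by
  ext a
  simp only [idxSet, face, Finset.mem_map, Finset.mem_univ, true_and, Finset.mem_erase]
  constructor
  · rintro ⟨l, rfl⟩
    exact ⟨fun h => Fin.succAbove_ne k l (σ.injective h), _, rfl⟩
  · rintro ⟨hne, l, rfl⟩
    obtain ⟨m, hm⟩ := Fin.exists_succAbove_eq (x := l) (y := k) (fun h => hne (by rw [h]; rfl))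
    exact ⟨m, congrArg σ hm⟩

lemma sgn_idxSet {p : ℕ} (σ : CechIdx p) (k : Fin (p + 1)) :
    sgn (idxSet σ) (σ k) = (-1) ^ (k : ℕ) := by
  rw [sgn]
  congr 1
  have : (idxSet σ).filter (· < σ k) = (Finset.univ.filter (· < k)).map σ.toEmbedding := by
    ext a
    simp only [Finset.mem_filter, Finset.mem_map, Finset.mem_univ, true_and]
    constructor
    · rintro ⟨⟨l, rfl⟩, h⟩
      exact ⟨l, σ.lt_iff_lt.1 h, rfl⟩
    · rintro ⟨l, h, rfl⟩
      exact ⟨⟨l, rfl⟩, σ.lt_iff_lt.2 h⟩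
  rw [this, Finset.card_map, Finset.filter_gt_eq_Iio, Fin.card_Iio]

lemma cochD_idxSet {p : ℕ} (c : Cochain) (σ : CechIdx (p + 1)) :
    cochD c (idxSet σ) = ∑ k : Fin (p + 2), (-1 : ℂ) ^ (k : ℕ) • c (idxSet (face σ k)) := by
  rw [cochD_apply, Finset.sum_map]
  refine Finset.sum_congr rfl fun k _ => ?_
  rw [idxSet_face]
  change sgn (idxSet σ) (σ k) • _ = _
  rw [sgn_idxSet]
  rfl

lemma inter_inf_chart {p : ℕ} (σ : CechIdx p) (a : ChartIdx) :
    inter σ ⊓ chart a = interF (insert a (idxSet σ)) := by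
  rw [inter_eq_interF, interF, interF, Finset.inf_insert, inf_comm]

lemma full_le_inter_inf {p : ℕ} (σ : CechIdx p) (a : ChartIdx) : full ≤ inter σ ⊓ chart a := by
  rw [inter_inf_chart]
  exact full_le_interF _

lemma res_self (F : P1P1.Modules) {V : P1P1.Opens} (h : V ≤ V) (x : Sec F V) : res F h x = x :=
  map_self F h x

section

variable {C : Scheme.{0}} {i : C ⟶ P1P1} {E : P1P1.Modules} {φ : E ⟶ structureSheaf i}

lemma Represents.sum {ι : Type*} {V : P1P1.Opens} {hV : full ≤ V} (S : Finset ι) {y : ι → Sec E V}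
    {l : ι → Laurent} (h : ∀ k ∈ S, Represents φ hV (y k) (l k)) :
    Represents φ hV (∑ k ∈ S, y k) (∑ k ∈ S, l k) := by
  classical
  induction S using Finset.induction_on with
  | empty => exact represents_zero
  | insert k S hk ih =>
    rw [Finset.sum_insert hk, Finset.sum_insert hk]
    exact (h k (Finset.mem_insert_self k S)).add
      (ih fun k hk => h k (Finset.mem_insert_of_mem hk))

/-- A section of a twist is determined by its component on one chart. -/
lemma represents_of_mem_twist {m n : ℤ} {V : P1P1.Opens} (hV : full ≤ V)
    {y : ∀ a, Sec E (V ⊓ chart a)} (hy : y ∈ twist E m n V) {b : ChartIdx} (hb : V ≤ chart b)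
    {l : Laurent}
    (hl : Represents φ (le_inf hV (full_le_chart b)) (y b) (mon (tau m n b) * l)) (a : ChartIdx) :
    Represents φ (le_inf hV (full_le_chart a)) (y a) (mon (tau m n a) * l) := by
  have h1 : y a = resO (le_inf inf_le_right (inf_le_left.trans hb)) (transition m n a b) •
      res E (le_inf inf_le_left (inf_le_left.trans hb)) (y b) := by
    have h := congrArg (res E (le_inf inf_le_left (le_inf inf_le_right (inf_le_left.trans hb)) :
      V ⊓ chart a ≤ V ⊓ (chart a ⊓ chart b))) ((mem_twist y).1 hy a b)
    rw [res_mulBy, res_res, res_res, resO_resO, res_self] at h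
    exact h
  have h2 := (hl.res (le_inf hV (full_le_chart a))
    (le_inf inf_le_left (inf_le_left.trans hb))).smul
      (resO (le_inf inf_le_right (inf_le_left.trans hb)) (transition m n a b))
  rw [lau_transition, ← mul_assoc, ← mon_add, sub_add_cancel, ← h1] at h2
  exact h2

variable {f : BiPoly} {s r : ℕ} [IsClosedImmersion i] (hf : IsBihomogeneous f s r)
  (hker : ∀ a : ChartIdx, RingHom.ker (i.app (chart a)).hom = Ideal.span {dehomogenize f a})
  (hE : SheafOfModules.IsQuasicoherent.{0} E) (φ : E ⟶ structureSheaf i)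

/-- The relation between cochains of Laurent polynomials and the Čech cochains that they
represent. -/
def cechRel (m n : ℤ) (p : ℕ) : Submodule ℂ (Cochain × CechCochain E m n p) where
  carrier := {z | z.1 ∈ ((sheafIdeal hf hker hE φ).twist m n).cx.carr (p + 1) ∧
    ∀ σ a, Represents φ (full_le_inter_inf σ a) ((z.2 σ).1 a) (mon (tau m n a) * z.1 (idxSet σ))}
  add_mem' := by
    rintro z w ⟨hz, hz'⟩ ⟨hw, hw'⟩
    refine ⟨Submodule.add_mem _ hz hw, fun σ a => ?_⟩
    have := (hz' σ a).add (hw' σ a)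
    rw [← mul_add] at this
    exact this
  zero_mem' := by
    refine ⟨Submodule.zero_mem _, fun σ a => ?_⟩
    have : mon (tau m n a) * (0 : Laurent) = 0 := mul_zero _
    change Represents φ _ 0 (mon (tau m n a) * (0 : Laurent))
    rw [this]
    exact represents_zero
  smul_mem' := by
    rintro c z ⟨hz, hz'⟩
    refine ⟨Submodule.smul_mem _ c hz, fun σ a => ?_⟩
    have := (hz' σ a).smulC c
    rw [← mul_smul_comm] at this
    exact this

lemma principal_le_sheafIdeal {T : Finset ChartIdx} (hT : T.Nonempty) :
    (IdealSystem.principal (curveEq f) s r (curveEq_mem hf)).J T ≤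
      (sheafIdeal hf hker hE φ).J T := by
  obtain ⟨a, ha⟩ := hT
  intro l hl
  rw [IdealSystem.mem_principal ha] at hl
  exact (mem_sheafIdeal rfl).2
    ⟨0, (represents_zero_iff (hV := full_le_interF T) hf hker φ ha rfl).2 hl⟩

lemma inter_inf_chart_self {p : ℕ} (σ : CechIdx p) :
    inter σ ⊓ chart (σ 0) = interF (idxSet σ) := by
  rw [inter_inf_chart, Finset.insert_eq_of_mem (mem_idxSet σ 0)]

/-- The Čech cohomology of the twists of a subsheaf of the structure sheaf of a curve is that of the
corresponding ideal system, modulo the ideal of the curve. -/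
theorem cohomology_equiv [Mono φ] (m n : ℤ) (p : ℕ) :
    Nonempty (RelH ((sheafIdeal hf hker hE φ).twist m n).cx
      ((IdealSystem.principal (curveEq f) s r (curveEq_mem hf)).twist m n).cx p ≃ₗ[ℂ]
        Cohomology E m n p) := by
  refine nonempty_relH_equiv (cechD E m n) (cechB E m n) rfl (fun _ => rfl)
    (cechRel hf hker hE φ m n) (fun h => h.1) ?_ ?_ ?_ ?_ ?_ p
  · intro p x hx
    have h1 : ∀ σ : CechIdx p, ∀ a, ∃ y : Sec E (inter σ ⊓ chart a),
        Represents φ (full_le_inter_inf σ a) y (mon (tau m n a) * x (idxSet σ)) := fun σ a =>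
      (mem_sheafIdeal (inter_inf_chart σ a)).1
        (((sheafIdeal hf hker hE φ).twist m n).mono ⟨_, mem_idxSet σ 0⟩
          (Finset.subset_insert a _) ((Sys.mem_cx.1 hx).1 _ (card_idxSet σ) ⟨_, mem_idxSet σ 0⟩)
          a (Finset.mem_insert_self a _))
    choose y hy using h1
    refine ⟨fun σ => ⟨y σ, (mem_twist _).2 fun a b => ?_⟩, hx, hy⟩
    have hW : full ≤ inter σ ⊓ (chart a ⊓ chart b) :=
      le_inf ((full_le_inter_inf σ a).trans inf_le_left)
        (le_inf (full_le_chart a) (full_le_chart b))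
    have hWT : inter σ ⊓ (chart a ⊓ chart b) = interF (insert b (insert a (idxSet σ))) := by
      rw [← inf_assoc, inter_inf_chart, interF, interF, Finset.inf_insert (b := b), inf_comm]
    have h2 := ((hy σ b).res hW (inf_le_inf_left _ inf_le_right)).smul
      (resO inf_le_right (transition m n a b))
    rw [lau_transition, ← mul_assoc, ← mon_add, sub_add_cancel] at h2
    exact ((hy σ a).res hW (inf_le_inf_left _ inf_le_left)).unique (Finset.insert_nonempty _ _)
      hWT h2
  · intro p y
    have h1 : ∀ σ : CechIdx p, ∃ l, Represents φ (full_le_inter_inf σ (σ 0)) ((y σ).1 (σ 0)) l :=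
      fun σ => exists_represents φ ⟨_, mem_idxSet σ 0⟩ (inter_inf_chart_self σ) _
    choose l hl using h1
    let x : Cochain := Function.extend idxSet (fun σ => mon (-tau m n (σ 0)) * l σ) 0
    have hx : ∀ σ, mon (tau m n (σ 0)) * x (idxSet σ) = l σ := fun σ => by
      rw [show x (idxSet σ) = _ from idxSet_injective.extend_apply _ _ σ, ← mul_assoc,
        mon_mul_mon_neg, one_mul]
    refine ⟨x, Sys.mem_cx.2 ⟨fun T hT _ => ?_, fun T hT => ?_⟩, fun σ a => ?_⟩
    · obtain ⟨σ, rfl⟩ := exists_idxSet_eq hT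
      rw [IdealSystem.mem_twist_iff (mem_idxSet σ 0), hx]
      exact (mem_sheafIdeal (inter_inf_chart_self σ)).2 ⟨_, hl σ⟩
    · refine (Function.extend_apply' _ _ _ ?_ : x T = _)
      rintro ⟨σ, rfl⟩
      exact hT ⟨card_idxSet σ, _, mem_idxSet σ 0⟩
    · refine represents_of_mem_twist ((full_le_inter_inf σ a).trans inf_le_left) (y σ).2
        (iInf_le (fun k => chart (σ k)) 0) ?_ a
      rw [hx]
      exact hl σ
  · intro p x
    constructor
    · rintro ⟨h1, h2⟩
      refine Sys.mem_cx.2 ⟨fun T hT _ => ?_, (Sys.mem_cx.1 h1).2⟩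
      obtain ⟨σ, rfl⟩ := exists_idxSet_eq hT
      rw [IdealSystem.mem_twist_iff (mem_idxSet σ 0), IdealSystem.mem_principal (mem_idxSet σ 0)]
      exact (represents_zero_iff hf hker φ (mem_idxSet σ 0) (inter_inf_chart_self σ)).1 (h2 σ (σ 0))
    · intro h
      have h1 := Sys.mem_cx.1 h
      refine ⟨Sys.mem_cx.2 ⟨fun T hT hT' a ha => ?_, h1.2⟩, fun σ a => ?_⟩
      · exact principal_le_sheafIdeal hf hker hE φ hT' (h1.1 T hT hT' a ha)
      · refine (represents_zero_iff hf hker φ (Finset.mem_insert_self a (idxSet σ))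
          (inter_inf_chart σ a)).2 ?_
        rw [← IdealSystem.mem_principal (Finset.mem_insert_self a (idxSet σ))]
        exact ((IdealSystem.principal (curveEq f) s r (curveEq_mem hf)).twist m n).mono
          ⟨_, mem_idxSet σ 0⟩ (Finset.subset_insert a _)
          (h1.1 _ (card_idxSet σ) ⟨_, mem_idxSet σ 0⟩)
          a (Finset.mem_insert_self a _)
  · rintro p y ⟨-, h⟩
    refine funext fun σ => Subtype.ext (funext fun a => ?_)
    have h1 := h σ a
    have : mon (tau m n a) * (0 : Laurent) = 0 := mul_zero _
    change Represents φ _ _ (mon (tau m n a) * (0 : Laurent)) at h1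
    rw [this] at h1
    exact h1.unique (Finset.insert_nonempty a (idxSet σ)) (inter_inf_chart σ a) represents_zero
  · rintro p x y ⟨h1, h2⟩
    refine ⟨((sheafIdeal hf hker hE φ).twist m n).cx.d_mem h1, fun σ a => ?_⟩
    have h3 : ((cechD E m n p y σ).1 a) = ∑ k : Fin (p + 2), (-1 : ℂ) ^ (k : ℕ) •
        res E (inf_le_inf_right (chart a) (inter_le_inter_face σ k)) ((y (face σ k)).1 a) := by
      simp only [cechD, LinearMap.pi_apply, LinearMap.sum_apply, LinearMap.smul_apply]
      rw [AddSubmonoidClass.coe_finsetSum, Finset.sum_apply]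
      rfl
    have h4 : mon (tau m n a) * cochD x (idxSet σ) = ∑ k : Fin (p + 2), (-1 : ℂ) ^ (k : ℕ) •
        (mon (tau m n a) * x (idxSet (face σ k))) := by
      rw [cochD_idxSet, Finset.mul_sum]
      exact Finset.sum_congr rfl fun k _ => mul_smul_comm _ _ _
    change Represents φ _ ((cechD E m n p y σ).1 a) (mon (tau m n a) * cochD x (idxSet σ))
    rw [h3, h4]
    exact Represents.sum _ fun k _ => ((h2 (face σ k) a).res _ _).smulC _

/-- The Euler characteristic of a twist of a subsheaf, computed from its ideal system. -/
theorem eulerChar_of_chi [Mono φ] {m n e : ℤ} (h : ((sheafIdeal hf hker hE φ).twist m n).Chi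
    ((IdealSystem.principal (curveEq f) s r (curveEq_mem hf)).twist m n) e) :
    (∀ p, FiniteDimensional ℂ (Cohomology E m n p)) ∧ eulerChar E m n = e := by
  obtain ⟨h1, h2⟩ := h
  have h3 := fun p => (cohomology_equiv hf hker hE φ m n p).some
  refine ⟨fun p => have := h1 p; Module.Finite.equiv (h3 p), ?_⟩
  rw [← h2, eulerChar]
  exact Finset.sum_congr rfl fun p _ => by rw [(h3 p).finrank_eq]

end

/-! ### Coherence of the structure sheaf -/

/-- The structure sheaf of a closed subscheme is coherent: over each chart its module of sections is
a quotient of the coordinate ring. -/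
lemma isCoherent_structureSheaf {C : Scheme.{0}} (i : C ⟶ P1P1) [IsClosedImmersion i] :
    IsCoherent (structureSheaf i) := by
  refine isCoherent_of_exists _ (fun a => ?_) (fun a h V hV hVU y => ?_)
    (fun a h V hV hVU x hx => ?_)
  · let g : Γ(P1P1, chart a) →ₗ[Γ(P1P1, chart a)] Sec (structureSheaf i) (chart a) :=
      { toFun := toO i (chart a)
        map_add' := toO_add i _
        map_smul' := toO_mul i _ }
    exact Module.Finite.of_surjective g (toO_surjective i (isAffineOpen_chart a))
  · obtain ⟨n, p, hp⟩ := exists_pow_mul_eq_res (isAffineOpen_preimage i (isAffineOpen_chart a))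
      (g := (i.app (chart a)).hom h) (V := i ⁻¹ᵁ V) (by rw [hV, Scheme.preimage_basicOpen])
      (i.preimage_mono hVU) y
    refine ⟨n, p, ?_⟩
    have h1 : (i.app V).hom ((P1P1.presheaf.map (homOfLE hVU).op).hom h) =
        (C.presheaf.map (homOfLE (i.preimage_mono hVU)).op).hom ((i.app (chart a)).hom h) :=
      congrArg (fun f => f.hom h) (i.naturality (homOfLE hVU).op)
    rw [← h1, ← map_pow, ← map_pow] at hp
    exact hp.symm
  · obtain ⟨n, hn⟩ := exists_pow_mul_eq_zero (isAffineOpen_preimage i (isAffineOpen_chart a))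
      (g := (i.app (chart a)).hom h) (V := i ⁻¹ᵁ V) (by rw [hV, Scheme.preimage_basicOpen])
      (i.preimage_mono hVU) x hx
    refine ⟨n, ?_⟩
    rw [← map_pow] at hn
    exact hn

/-! ### Sections and the support of a sheaf -/

/-- A quasi-coherent sheaf with non-empty support has a non-zero section over some chart. -/
lemma exists_sec_ne_zero {E : P1P1.Modules} (hE : SheafOfModules.IsQuasicoherent.{0} E) {x : P1P1}
    (hx : x ∈ support E) : ∃ a, ∃ e : Sec E (chart a), e ≠ 0 := by
  have hx' : x ∈ (⊤ : P1P1.Opens) := trivial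
  rw [← iSup_chart, TopologicalSpace.Opens.mem_iSup] at hx'
  obtain ⟨a, ha⟩ := hx'
  refine ⟨a, ?_⟩
  by_contra! hzero
  have hn : Nontrivial (E.presheaf.stalk x) := hx
  refine not_subsingleton (E.presheaf.stalk x) ⟨fun s t => ?_⟩
  suffices h : ∀ s : E.presheaf.stalk x, s = 0 from (h s).trans (h t).symm
  intro s
  obtain ⟨V, hV, y, rfl⟩ := TopCat.Presheaf.exists_germ_eq E.presheaf s
  obtain ⟨h, hD, hxD⟩ := (isAffineOpen_chart a).exists_basicOpen_le ⟨x, hV⟩ ha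
  have hDa : P1P1.basicOpen h ≤ chart a := P1P1.basicOpen_le h
  obtain ⟨n, e, he⟩ := exists_map_eq_pow_smul E hE (isAffineOpen_chart a) h rfl hDa
    (E.presheaf.map (homOfLE hD).op y)
  have hu : IsUnit ((P1P1.presheaf.map (homOfLE hDa).op) (h ^ n)) := by
    rw [map_pow]
    exact (isUnit_res_of_le_basicOpen hDa le_rfl).pow n
  have he0 : e = 0 := hzero e
  rw [he0, map_zero] at he
  have hy : E.presheaf.map (homOfLE hD).op y = 0 := (hu.smul_eq_zero).1 he.symm
  rw [← TopCat.Presheaf.germ_res_apply E.presheaf (homOfLE hD) x hxD, hy, map_zero]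

/-- A quasi-coherent sheaf without non-zero sections over the charts is zero. -/
lemma isZero_of_forall_sec_eq_zero {E : P1P1.Modules} (hE : SheafOfModules.IsQuasicoherent.{0} E)
    (h : ∀ a, ∀ e : Sec E (chart a), e = 0) : IsZero E := by
  have hs : ∀ x, Subsingleton (E.presheaf.stalk x) := by
    intro x
    rw [← not_nontrivial_iff_subsingleton]
    intro hx
    obtain ⟨a, e, he⟩ := exists_sec_ne_zero hE (x := x) hx
    exact he (h a e)
  rw [IsZero.iff_id_eq_zero]
  apply (Scheme.Modules.toPresheaf P1P1).map_injective
  ext U y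
  refine TopCat.Presheaf.section_ext ⟨E.presheaf, E.isSheaf⟩ U _ _ fun x hx => ?_
  have := hs x
  exact Subsingleton.elim (α := E.presheaf.stalk x) _ _

/-- A monomorphism to a quasi-coherent sheaf is an isomorphism if it is surjective on the sections
over the charts. -/
lemma isIso_of_forall_surjective {E F : P1P1.Modules} (hF : SheafOfModules.IsQuasicoherent.{0} F)
    (φ : E ⟶ F) [Mono φ] (h : ∀ a, Function.Surjective (secMap φ (chart a))) : IsIso φ := by
  rw [Scheme.Modules.Hom.isIso_iff_isIso_app]
  intro U
  rw [ConcreteCategory.isIso_iff_bijective]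
  refine ⟨secMap_injective φ U, ?_⟩
  let f : (⟨E.presheaf, E.isSheaf⟩ : TopCat.Sheaf Ab P1P1) ⟶ ⟨F.presheaf, F.isSheaf⟩ :=
    ⟨φ.mapPresheaf⟩
  refine TopCat.Presheaf.app_surjective_of_injective_of_locally_surjective f U (fun x _ =>
    TopCat.Presheaf.stalkFunctor_map_injective_of_app_injective
      (fun V => secMap_injective φ V) x) fun t x hx => ?_
  have hx' : x ∈ (⊤ : P1P1.Opens) := trivial
  rw [← iSup_chart, TopologicalSpace.Opens.mem_iSup] at hx'
  obtain ⟨a, ha⟩ := hx'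
  obtain ⟨g, hD, hxD⟩ := (isAffineOpen_chart a).exists_basicOpen_le ⟨x, hx⟩ ha
  have hDa : P1P1.basicOpen g ≤ chart a := P1P1.basicOpen_le g
  obtain ⟨n, e, he⟩ := exists_map_eq_pow_smul F hF (isAffineOpen_chart a) g rfl hDa
    (F.presheaf.map (homOfLE hD).op t)
  obtain ⟨y, hy⟩ := h a e
  have hu : IsUnit ((P1P1.presheaf.map (homOfLE hDa).op) (g ^ n)) := by
    rw [map_pow]
    exact (isUnit_res_of_le_basicOpen hDa le_rfl).pow n
  obtain ⟨u, hu⟩ := hu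
  refine ⟨P1P1.basicOpen g, hxD, homOfLE hD, (↑u⁻¹ : Γ(P1P1, P1P1.basicOpen g)) • res E hDa y, ?_⟩
  have h1 : secMap φ (P1P1.basicOpen g) ((↑u⁻¹ : Γ(P1P1, P1P1.basicOpen g)) • res E hDa y) =
      res F hD t := by
    rw [secMap_smul, ← res_secMap, hy]
    have h2 : res F hDa e = (u : Γ(P1P1, P1P1.basicOpen g)) • res F hD t := by
      rw [hu]
      exact he
    rw [h2, smul_smul, Units.inv_mul, one_smul]
  exact h1

/-! ### Dimension of supports -/

/-- The Krull dimension of a space is at most `n` if it has an open cover by spaces of dimension at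
most `n`. -/
lemma topologicalKrullDim_le_of_cover {X ι : Type*} {n : WithBot ℕ∞} [TopologicalSpace X]
    {Y : ι → Type*} [∀ k, TopologicalSpace (Y k)] (f : ∀ k, Y k → X)
    (hf : ∀ k, Topology.IsOpenEmbedding (f k)) (hcov : ∀ x, ∃ k, x ∈ Set.range (f k))
    (hdim : ∀ k, topologicalKrullDim (Y k) ≤ n) : topologicalKrullDim X ≤ n := by
  refine iSup_le fun p => ?_
  obtain ⟨x, hx⟩ := p.head.isIrreducible.nonempty
  obtain ⟨k, y, rfl⟩ := hcov x
  let e := TopologicalSpace.IrreducibleCloseds.orderIsoOfIsOpenEmbedding (f k) (hf k)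
  have hne : ∀ j, (f k ⁻¹' (p j : Set X)).Nonempty := fun j =>
    ⟨y, (p.monotone (Fin.zero_le j) : p.head ≤ p j) hx⟩
  let q : LTSeries (TopologicalSpace.IrreducibleCloseds (Y k)) :=
    { length := p.length
      toFun := fun j => e.symm ⟨p j, hne j⟩
      step := fun j => e.symm.strictMono (p.step j) }
  exact (Order.LTSeries.length_le_krullDim q).trans (hdim k)

/-- A common divisor of `X - x 0` and `Z - x 1` does not involve either variable. -/
lemma isUnit_of_dvd_X_sub_C {π : MvPolynomial (Fin 2) ℂ} {x : Fin 2 → ℂ}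
    (h : ∀ k, π ∣ MvPolynomial.X k - MvPolynomial.C (x k)) : IsUnit π := by
  have hdeg : ∀ k l : Fin 2, k ≠ l → π.degreeOf l = 0 := by
    intro k l hkl
    obtain ⟨u, hu⟩ := h k
    have hne : MvPolynomial.X k - MvPolynomial.C (x k) ≠ (0 : MvPolynomial (Fin 2) ℂ) := by
      intro h0
      have := congrArg (MvPolynomial.eval fun _ => x k + 1) h0
      simp at this
    rw [hu] at hne
    have h1 :
        (MvPolynomial.X k - MvPolynomial.C (x k) : MvPolynomial (Fin 2) ℂ).degreeOf l = 0 := by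
      refine Nat.le_zero.1 ((MvPolynomial.degreeOf_sub_le _ _ _).trans ?_)
      rw [MvPolynomial.degreeOf_C, MvPolynomial.degreeOf_X, if_neg (Ne.symm hkl), max_self]
    rw [hu, MvPolynomial.degreeOf_mul_eq (left_ne_zero_of_mul hne) (right_ne_zero_of_mul hne)] at h1
    omega
  have hC : π = MvPolynomial.C (π.coeff 0) := by
    ext m
    rw [MvPolynomial.coeff_C]
    split_ifs with hm
    · rw [hm]
    · by_contra hne
      apply hm
      have := fun l : Fin 2 => MvPolynomial.le_degreeOf_of_mem_support l
        (MvPolynomial.mem_support_iff.2 hne)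
      ext l
      fin_cases l
      · have h0 := this 0
        rw [hdeg 1 0 (by decide)] at h0
        exact (Nat.le_zero.1 h0).symm
      · have h0 := this 1
        rw [hdeg 0 1 (by decide)] at h0
        exact (Nat.le_zero.1 h0).symm
  rw [hC]
  refine (isUnit_iff_ne_zero.2 fun h0 => ?_).map MvPolynomial.C
  rw [hC, h0, map_zero] at h
  have := zero_dvd_iff.1 (h 0)
  have := congrArg (MvPolynomial.eval fun _ => x 0 + 1) this
  simp at this

/-- By the Nullstellensatz, a principal prime ideal of `ℂ[X, Z]` is not maximal. -/
lemma not_isMaximal_span_of_prime {R : Type*} [CommRing R] (e : MvPolynomial (Fin 2) ℂ ≃+* R)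
    {π : R} (hπ : Prime π) : ¬ (Ideal.span {π}).IsMaximal := by
  intro h
  have h1 : (Ideal.comap e (Ideal.span {π})).IsMaximal := Ideal.comap_isMaximal_of_equiv e
  obtain ⟨x, hx⟩ := (MvPolynomial.isMaximal_iff_eq_vanishingIdeal_singleton).1 h1
  have h2 : ∀ k, e.symm π ∣ MvPolynomial.X k - MvPolynomial.C (x k) := by
    intro k
    have h3 : MvPolynomial.X k - MvPolynomial.C (x k) ∈ Ideal.comap e (Ideal.span {π}) := by
      rw [hx, MvPolynomial.mem_vanishingIdeal_singleton_iff]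
      simp
    rw [Ideal.mem_comap, Ideal.mem_span_singleton] at h3
    have h4 := map_dvd e.symm h3
    rwa [RingEquiv.symm_apply_apply] at h4
  exact hπ.not_isUnit ((MulEquiv.isUnit_map e.symm).1 (isUnit_of_dvd_X_sub_C h2))

instance (a : ChartIdx) : UniqueFactorizationMonoid Γ(P1P1, chart a) :=
  (chartEquiv a).toMulEquiv.uniqueFactorizationMonoid inferInstance

/-- If `f` does not divide `g`, then a prime divisor of `f` divides the annihilator of the class of
`g` modulo `f`. -/
lemma exists_prime_dvd_of_not_dvd {R : Type*} [CommRing R] [IsDomain R]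
    [UniqueFactorizationMonoid R] {f g : R} (hf : f ≠ 0) (h : ¬ f ∣ g) :
    ∃ π, Prime π ∧ ∀ k, f ∣ k * g → π ∣ k := by
  obtain ⟨f', g', c, hrel, hc, hc'⟩ := UniqueFactorizationMonoid.exists_reduced_factors f hf g
  subst hc hc'
  have hc0 : c ≠ 0 := left_ne_zero_of_mul hf
  have hu : ¬ IsUnit f' := fun hu => h (mul_dvd_mul_left c hu.dvd)
  obtain ⟨π, hπ, hdvd⟩ := WfDvdMonoid.exists_irreducible_factor hu (right_ne_zero_of_mul hf)
  refine ⟨π, hπ.prime, fun k hk => hdvd.trans ?_⟩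
  rw [mul_left_comm, mul_dvd_mul_iff_left hc0] at hk
  exact hrel.dvd_of_dvd_mul_right hk

/-- The support of a non-zero subsheaf of the structure sheaf of a curve has positive dimension:
it contains the generic point and a closed point of a component of the curve. -/
lemma one_le_dimSupport {C : Scheme.{0}} {i : C ⟶ P1P1} {f : BiPoly} {s r : ℕ}
    [IsClosedImmersion i] (hf0 : f ≠ 0) (hf : IsBihomogeneous f s r)
    (hker : ∀ a : ChartIdx, RingHom.ker (i.app (chart a)).hom = Ideal.span {dehomogenize f a})
    {E : P1P1.Modules} (hE : SheafOfModules.IsQuasicoherent.{0} E) (φ : E ⟶ structureSheaf i)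
    [Mono φ] {a : ChartIdx} {e : Sec E (chart a)} (he : e ≠ 0) : 1 ≤ dimSupport E := by
  have hU := isAffineOpen_chart a
  obtain ⟨g, hg⟩ := toO_surjective i hU (secMap φ (chart a) e)
  have hmem : ∀ g, toO i (chart a) g = 0 ↔ dehomogenize f a ∣ g := fun g => by
    rw [← Ideal.mem_span_singleton, ← hker a]
    rfl
  have hann : ∀ k : Γ(P1P1, chart a), k • e = 0 → dehomogenize f a ∣ k * g := by
    intro k hk
    rw [← hmem, toO_mul, hg, ← secMap_smul, hk, secMap_zero]
  have hndvd : ¬ dehomogenize f a ∣ g := by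
    rw [← hmem, hg, ← secMap_zero φ]
    exact fun h => he (secMap_injective φ _ h)
  have hfa : dehomogenize f a ≠ 0 := by
    intro h
    have h1 := lau_dehomogenize_eq hf a
    rw [h, map_zero] at h1
    exact mul_ne_zero (mon_ne_zero _) (curveEq_ne_zero hf0 hf) h1.symm
  obtain ⟨π, hπ, hdvd⟩ := exists_prime_dvd_of_not_dvd hfa hndvd
  -- Every point of the chart at which `π` vanishes belongs to the support.
  have hsupp : ∀ P : PrimeSpectrum Γ(P1P1, chart a), π ∈ P.asIdeal →
      hU.fromSpec P ∈ support E := by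
    intro P hP
    have hxa : hU.fromSpec P ∈ chart a := by
      rw [← SetLike.mem_coe, ← hU.range_fromSpec]
      exact Set.mem_range_self P
    refine ⟨E.presheaf.germ (chart a) (hU.fromSpec P) hxa e, 0, fun h0 => ?_⟩
    rw [← map_zero (E.presheaf.germ (chart a) (hU.fromSpec P) hxa).hom] at h0
    obtain ⟨W, hW, hWU, _, h1⟩ := TopCat.Presheaf.germ_eq E.presheaf _ hxa hxa _ _ h0
    obtain ⟨h, hD, hxD⟩ := hU.exists_basicOpen_le ⟨_, hW⟩ hxa
    have h2 : E.presheaf.map (homOfLE (P1P1.basicOpen_le h)).op e = 0 := by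
      have h3 := congrArg (E.presheaf.map (homOfLE hD).op) h1
      rw [map_zero, map_zero] at h3
      exact (map_map E hD hWU.le e).symm.trans h3
    obtain ⟨n, hn⟩ := exists_pow_smul_eq_zero E hE hU h rfl (P1P1.basicOpen_le h) e h2
    have h4 : h ∈ P.asIdeal := P.asIdeal.mem_of_dvd (hπ.dvd_of_dvd_pow (hdvd _ (hann _ hn))) hP
    have h5 : P ∈ hU.fromSpec ⁻¹ᵁ P1P1.basicOpen h := hxD
    rw [hU.fromSpec_preimage_basicOpen] at h5
    exact h5 h4
  have hprime : (Ideal.span {π}).IsPrime := (Ideal.span_singleton_prime hπ.ne_zero).2 hπ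
  obtain ⟨M, hM, hle⟩ := (Ideal.span {π}).exists_le_maximal hprime.ne_top
  let P : PrimeSpectrum Γ(P1P1, chart a) := ⟨_, hprime⟩
  let Q : PrimeSpectrum Γ(P1P1, chart a) := ⟨M, hM.isPrime⟩
  have hPQ : P ≠ Q := by
    intro h
    have h1 : Ideal.span {π} = M := congrArg PrimeSpectrum.asIdeal h
    exact not_isMaximal_span_of_prime (chartEquiv a) hπ (h1 ▸ hM)
  have hspec : P ⤳ Q := (PrimeSpectrum.le_iff_specializes P Q).1 hle
  let x : support E := ⟨hU.fromSpec P, hsupp P (Ideal.mem_span_singleton_self π)⟩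
  let y : support E := ⟨hU.fromSpec Q, hsupp Q (hle (Ideal.mem_span_singleton_self π))⟩
  have hxy : x ⤳ y := by
    rw [Topology.IsInducing.subtypeVal.specializes_iff.symm]
    exact hspec.map hU.fromSpec.continuous
  have hne : x ≠ y := fun h =>
    hPQ (hU.fromSpec.isOpenEmbedding.injective (congrArg (Subtype.val : support E → P1P1) h))
  rw [dimSupport, topologicalKrullDim, Order.one_le_krullDim_iff]
  refine ⟨⟨closure {y}, isIrreducible_singleton.closure, isClosed_closure⟩,
    ⟨closure {x}, isIrreducible_singleton.closure, isClosed_closure⟩, lt_of_le_of_ne ?_ ?_⟩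
  · exact specializes_iff_closure_subset.1 hxy
  · intro h
    have h1 : closure {y} = closure {x} :=
      congrArg (TopologicalSpace.IrreducibleCloseds.carrier (α := support E)) h
    have h2 : y ⤳ x := by
      rw [specializes_iff_closure_subset, h1]
    exact hne (hxy.antisymm h2).eq

/-- The support of the structure sheaf of a curve is contained in the curve, which is covered by
spectra of quotients of two-dimensional domains by non-zero elements. -/
lemma dimSupport_structureSheaf_le {C : Scheme.{0}} {i : C ⟶ P1P1} {f : BiPoly} {s r : ℕ}
    [IsClosedImmersion i] (hf0 : f ≠ 0) (hf : IsBihomogeneous f s r)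
    (hker : ∀ a : ChartIdx, RingHom.ker (i.app (chart a)).hom = Ideal.span {dehomogenize f a}) :
    dimSupport (structureSheaf i) ≤ 1 := by
  have hrange : ∀ x ∈ support (structureSheaf i), x ∈ Set.range i := by
    intro x hx
    by_contra hxr
    have hn : Nontrivial ((structureSheaf i).presheaf.stalk x) := hx
    let V : P1P1.Opens := ⟨(Set.range i)ᶜ, i.isClosedEmbedding.isClosed_range.isOpen_compl⟩
    have hV : i ⁻¹ᵁ V = ⊥ := by
      ext y
      simp [V]
    have h0 : ∀ y : Γ(structureSheaf i, V), y = 0 := by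
      have : Subsingleton Γ(C, i ⁻¹ᵁ V) := by
        rw [hV]
        infer_instance
      exact fun y => Subsingleton.elim (α := Γ(C, i ⁻¹ᵁ V)) _ _
    refine not_subsingleton ((structureSheaf i).presheaf.stalk x) ⟨fun s t => ?_⟩
    suffices h : ∀ s : (structureSheaf i).presheaf.stalk x, s = 0 from (h s).trans (h t).symm
    intro s
    obtain ⟨W, hW, y, rfl⟩ := TopCat.Presheaf.exists_germ_eq (structureSheaf i).presheaf s
    have hxWV : x ∈ W ⊓ V := ⟨hW, hxr⟩
    have h1 : (structureSheaf i).presheaf.map (homOfLE (inf_le_left : W ⊓ V ≤ W)).op y = 0 := by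
      have : Subsingleton Γ(C, i ⁻¹ᵁ (W ⊓ V)) := by
        have : i ⁻¹ᵁ (W ⊓ V) = ⊥ := by
          rw [eq_bot_iff, ← hV]
          exact i.preimage_mono inf_le_right
        rw [this]
        infer_instance
      exact Subsingleton.elim (α := Γ(C, i ⁻¹ᵁ (W ⊓ V))) _ _
    rw [← TopCat.Presheaf.germ_res_apply _ (homOfLE (inf_le_left : W ⊓ V ≤ W)) x hxWV, h1, map_zero]
  choose j hj using hrange
  have hind : Topology.IsInducing (fun x : support (structureSheaf i) => j x.1 x.2) := by
    rw [← i.isClosedEmbedding.isInducing.of_comp_iff]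
    have : i ∘ (fun x : support (structureSheaf i) => j x.1 x.2) = Subtype.val :=
      funext fun x => hj x.1 x.2
    rw [this]
    exact Topology.IsInducing.subtypeVal
  refine hind.topologicalKrullDim_le.trans ?_
  have hU : ∀ a, IsAffineOpen (i ⁻¹ᵁ chart a) := fun a =>
    isAffineOpen_preimage i (isAffineOpen_chart a)
  refine topologicalKrullDim_le_of_cover (fun a => (hU a).fromSpec)
    (fun a => (hU a).fromSpec.isOpenEmbedding) (fun x => ?_) (fun a => ?_)
  · have hx' : i x ∈ (⊤ : P1P1.Opens) := trivial
    rw [← iSup_chart, TopologicalSpace.Opens.mem_iSup] at hx'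
    obtain ⟨a, ha⟩ := hx'
    exact ⟨a, (hU a).range_fromSpec ▸ ha⟩
  · refine (PrimeSpectrum.topologicalKrullDim_eq_ringKrullDim Γ(C, i ⁻¹ᵁ chart a)).trans_le ?_
    have hfa : dehomogenize f a ≠ 0 := by
      intro h
      have h1 := lau_dehomogenize_eq hf a
      rw [h, map_zero] at h1
      exact mul_ne_zero (mon_ne_zero _) (curveEq_ne_zero hf0 hf) h1.symm
    have h1 := ringKrullDim_succ_le_of_surjective (i.app (chart a)).hom
      (i.app_surjective (chart a) (isAffineOpen_chart a)) (r := dehomogenize f a)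
      (mem_nonZeroDivisors_of_ne_zero hfa) (by
        rw [← RingHom.mem_ker, hker a]
        exact Ideal.mem_span_singleton_self _)
    rw [← ringKrullDim_eq_of_ringEquiv (chartEquiv a),
      MvPolynomial.ringKrullDim_of_isNoetherianRing, ringKrullDim_eq_zero_of_field, Nat.card_fin,
      zero_add] at h1
    generalize ringKrullDim Γ(C, i ⁻¹ᵁ chart a) = d at h1 ⊢
    induction d using WithBot.recBotCoe with
    | bot => exact bot_le
    | coe d =>
      have h3 : d + 1 ≤ 1 + 1 := by
        rw [one_add_one_eq_two]
        exact WithBot.coe_le_coe.1 h1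
      have h4 : d ≤ 1 := (ENat.add_le_add_iff_right (by simp)).1 h3
      exact_mod_cast h4

/-! ### Hilbert polynomials of the curve and of its subsheaves -/

section

variable {C : Scheme.{0}} {i : C ⟶ P1P1} {f : BiPoly} {s r : ℕ} [IsClosedImmersion i]

/-- The Hilbert polynomial of the structure sheaf of a curve is the difference of those of the
surface and of the ideal sheaf of the curve. -/
lemma hasHilbertPolynomial_structureSheaf (hf0 : f ≠ 0) (hf : IsBihomogeneous f s r)
    (hker : ∀ a : ChartIdx, RingHom.ker (i.app (chart a)).hom = Ideal.span {dehomogenize f a}) :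
    HasHilbertPolynomial (structureSheaf i) r s (r + s - r * s) := by
  intro m n
  have hE := (isCoherent_structureSheaf i).1
  refine eulerChar_of_chi hf hker hE (𝟙 (structureSheaf i)) ?_
  have hle1 : (sheafIdeal hf hker hE (𝟙 _)).twist m n ≤ IdealSystem.unit.twist m n :=
    fun T l hl a ha => (sheafIdeal hf hker hE (𝟙 _)).le_regular ⟨a, ha⟩ (hl a ha)
  have hle2 : IdealSystem.unit.twist m n ≤ (sheafIdeal hf hker hE (𝟙 _)).twist m n := by
    intro T l hl a ha
    obtain ⟨g, hg⟩ := exists_lau_eq (full_le_interF T) ⟨a, ha⟩ rfl (hl a ha)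
    exact ⟨toO i _ g, g, hg, rfl⟩
  have hprin : (IdealSystem.principal (curveEq f) s r (curveEq_mem hf)).twist m n ≤
      (sheafIdeal hf hker hE (𝟙 _)).twist m n :=
    fun T l hl a ha => principal_le_sheafIdeal hf hker hE _ ⟨a, ha⟩ (hl a ha)
  have h1 := chi_lineSys m n
  rw [← IdealSystem.twist_unit, ← le_antisymm hle1 hle2] at h1
  have h2 := h1.sub_right cochD_cochD (Sys.cx_mono (zeroSys_le _)) (Sys.cx_mono hprin)
    (IdealSystem.chi_principal (curveEq_ne_zero hf0 hf) (curveEq_mem hf) m n)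
  convert h2 using 1
  ring

/-- A non-zero proper coherent subsheaf of the structure sheaf has a Hilbert polynomial, and its
slope does not exceed that of the structure sheaf. -/
lemma exists_hilbertPolynomial_of_mono (hf0 : f ≠ 0) (hf : IsBihomogeneous f s r)
    (hker : ∀ a : ChartIdx, RingHom.ker (i.app (chart a)).hom = Ideal.span {dehomogenize f a})
    (hsr : 0 < s + r) {E : P1P1.Modules} (φ : E ⟶ structureSheaf i) [Mono φ] (hE : IsCoherent E)
    (h0 : ¬ IsZero E) (h1 : ¬ IsIso φ) : ∃ R S t : ℤ, HasHilbertPolynomial E R S t ∧ 0 < R + S ∧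
      t * (r + s) ≤ (r + s - r * s) * (R + S) ∧
      (0 < r → 0 < s → t * (r + s) < (r + s - r * s) * (R + S)) := by
  have hne : ∃ a, ∃ e : Sec E (chart a), e ≠ 0 := by
    by_contra! h
    exact h0 (isZero_of_forall_sec_eq_zero hE.1 h)
  obtain ⟨a, e, he⟩ := hne
  have hJ : ∀ a, mon (tau s r a) * curveEq f ∈ (sheafIdeal hf hker hE.1 φ).J {a} := fun a =>
    principal_le_sheafIdeal hf hker hE.1 φ (Finset.singleton_nonempty a)
      ((IdealSystem.mem_principal (Finset.mem_singleton_self a)).2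
        ⟨1, mon_zero ▸ mon_mem_supp (zero_mem_cone _), by rw [mul_one]⟩)
  have hprin : ∃ T : Finset ChartIdx, T.Nonempty ∧ ∃ g ∈ (sheafIdeal hf hker hE.1 φ).J T,
      g ∉ (IdealSystem.principal (curveEq f) s r (curveEq_mem hf)).J T := by
    obtain ⟨l, hl⟩ := exists_represents (hV := full_le_chart a) φ (Finset.singleton_nonempty a)
      (interF_singleton a).symm e
    refine ⟨{a}, Finset.singleton_nonempty a, l,
      (mem_sheafIdeal (interF_singleton a).symm).2 ⟨e, hl⟩, fun h => he ?_⟩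
    rw [IdealSystem.mem_principal (Finset.mem_singleton_self a)] at h
    exact hl.unique (Finset.singleton_nonempty a) (interF_singleton a).symm
      ((represents_zero_iff hf hker φ (Finset.mem_singleton_self a) (interF_singleton a).symm).2 h)
  have hproper : ∃ a, (sheafIdeal hf hker hE.1 φ).J {a} ≠ regular {a} := by
    by_contra! h
    refine h1 (isIso_of_forall_surjective (isCoherent_structureSheaf i).1 φ fun a y => ?_)
    obtain ⟨g, rfl⟩ := toO_surjective i (isAffineOpen_chart a) y
    have hg := lau_mem_regular (full_le_chart a) (Finset.singleton_nonempty a)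
      (interF_singleton a).symm g
    rw [← h a] at hg
    obtain ⟨z, g', hg', hz⟩ :=
      (mem_sheafIdeal (hV := full_le_chart a) (interF_singleton a).symm).1 hg
    rw [lau_injective (full_le_chart a) (Finset.singleton_nonempty a)
      (interF_singleton a).symm hg'] at hz
    exact ⟨z, hz⟩
  obtain ⟨R, S, t, hchi, hpos, hle, hlt⟩ := IdealSystem.exists_hilbert hsr
    (curveEq_ne_zero hf0 hf) (curveEq_mem hf) hJ hprin
  exact ⟨R, S, t, fun m n => eulerChar_of_chi hf hker hE.1 φ (hchi m n), hpos, hle,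
    fun hr hs => hlt hr hs hproper⟩

/-- A curve is not empty, since its Hilbert polynomial does not vanish. -/
lemma exists_structureSheaf_sec_ne_zero (hf0 : f ≠ 0) (hf : IsBihomogeneous f s r)
    (hker : ∀ a : ChartIdx, RingHom.ker (i.app (chart a)).hom = Ideal.span {dehomogenize f a})
    (hsr : 0 < s + r) : ∃ a, ∃ e : Sec (structureSheaf i) (chart a), e ≠ 0 := by
  by_contra! h
  have hzero := isZero_of_forall_sec_eq_zero (isCoherent_structureSheaf i).1 h
  have hsec : ∀ V, ∀ y : Sec (structureSheaf i) V, y = 0 := fun V y =>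
    congrArg (fun φ => secMap φ V y) ((IsZero.iff_id_eq_zero _).1 hzero)
  have hchi : ∀ m n, eulerChar (structureSheaf i) m n = 0 := by
    intro m n
    refine Finset.sum_eq_zero fun p _ => ?_
    have h1 : Subsingleton (CechCochain (structureSheaf i) m n p) :=
      ⟨fun c c' => funext fun σ => Subtype.ext (funext fun a =>
        (hsec _ _).trans (hsec _ _).symm)⟩
    have h2 : Subsingleton (LinearMap.ker (cechD (structureSheaf i) m n p)) := inferInstance
    have h3 : Subsingleton (Cohomology (structureSheaf i) m n p) :=
      Quotient.instSubsingletonQuotient _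
    rw [Module.finrank_zero_of_subsingleton, Nat.cast_zero, mul_zero]
  have e0 := (hasHilbertPolynomial_structureSheaf hf0 hf hker 0 0).2
  have e1 := (hasHilbertPolynomial_structureSheaf hf0 hf hker 1 0).2
  have e2 := (hasHilbertPolynomial_structureSheaf hf0 hf hker 0 1).2
  rw [hchi] at e0 e1 e2
  omega

/-- The structure sheaf of a curve has support of dimension one and no subsheaf with support of
dimension zero. -/
lemma isPureOneDimensional_structureSheaf (hf0 : f ≠ 0) (hf : IsBihomogeneous f s r)
    (hker : ∀ a : ChartIdx, RingHom.ker (i.app (chart a)).hom = Ideal.span {dehomogenize f a})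
    (hsr : 0 < s + r) : IsPureOneDimensional (structureSheaf i) := by
  refine ⟨isCoherent_structureSheaf i, le_antisymm (dimSupport_structureSheaf_le hf0 hf hker) ?_,
    fun E φ _ hE hdim => ?_⟩
  · obtain ⟨a, e, he⟩ := exists_structureSheaf_sec_ne_zero hf0 hf hker hsr
    exact one_le_dimSupport hf0 hf hker (isCoherent_structureSheaf i).1 (𝟙 _) he
  · rcases (support E).eq_empty_or_nonempty with h | ⟨x, hx⟩
    · rw [dimSupport, h, topologicalKrullDim] at hdim
      have : IsEmpty (TopologicalSpace.IrreducibleCloseds (∅ : Set P1P1)) :=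
        ⟨fun Z => Z.isIrreducible.nonempty.some.2⟩
      rw [Order.krullDim_eq_bot] at hdim
      exact WithBot.bot_ne_coe hdim
    · obtain ⟨a, e, he⟩ := exists_sec_ne_zero hE.1 hx
      have h1 := one_le_dimSupport hf0 hf hker hE.1 φ he
      rw [hdim] at h1
      exact absurd h1 (by decide)

end

end BiProj

end

theorem proposition3 (s r : ℕ) (hsr : (s, r) ≠ (0, 0))
    (C : AlgebraicGeometry.Scheme.{0}) (i : C ⟶ BiProj.P1P1)
    (hC : BiProj.IsCurveOfBidegree i s r) :
    BiProj.IsSemistable (BiProj.structureSheaf i) ∧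
      (0 < r → 0 < s → BiProj.IsStable (BiProj.structureSheaf i)) := by
  obtain ⟨hi, f, hf0, hf, hker⟩ := hC
  have hpos : 0 < s + r := by
    by_contra h
    exact hsr (Prod.ext (by omega) (by omega))
  have hpos' : (0 : ℚ) < (r : ℚ) + s := by exact_mod_cast (by omega : 0 < r + s)
  have hpure := BiProj.isPureOneDimensional_structureSheaf hf0 hf hker hpos
  have hslope : BiProj.HasSlope (BiProj.structureSheaf i)
      (((r + s - r * s : ℤ) : ℚ) / (((r : ℤ) : ℚ) + ((s : ℤ) : ℚ))) :=
    ⟨r, s, r + s - r * s, BiProj.hasHilbertPolynomial_structureSheaf hf0 hf hker, by omega, rfl⟩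
  refine ⟨⟨hpure, _, hslope, fun E φ _ hE h0 h1 => ?_⟩,
    fun hr hs => ⟨hpure, _, hslope, fun E φ _ hE h0 h1 => ?_⟩⟩
  · obtain ⟨R, S, t, hP, hRS, hle, -⟩ :=
      BiProj.exists_hilbertPolynomial_of_mono hf0 hf hker hpos φ hE h0 h1
    refine ⟨_, ⟨R, S, t, hP, hRS.ne', rfl⟩, ?_⟩
    rw [div_le_div_iff₀ (by exact_mod_cast hRS) (by exact_mod_cast hpos')]
    exact_mod_cast hle
  · obtain ⟨R, S, t, hP, hRS, -, hlt⟩ :=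
      BiProj.exists_hilbertPolynomial_of_mono hf0 hf hker hpos φ hE h0 h1
    refine ⟨_, ⟨R, S, t, hP, hRS.ne', rfl⟩, ?_⟩
    rw [div_lt_div_iff₀ (by exact_mod_cast hRS) (by exact_mod_cast hpos')]
    exact_mod_cast hlt hr hs
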